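/- **Conventions.** Let $K=\mathbb Q(\sqrt d)$ with $d=2$ or $d$ a prime $\equiv 1 \bmod 4$, with ring of integers $\mathbb Z_K$, idele group $I_K$, and $\mathrm{Gal}(K/\mathbb Q)=\langle c\rangle$. An *idele class character* of $K$ is a continuous homomorphism $\chi$ from $I_K$ to the unit circle that is trivial on $K^\times$; it is *quadratic* if it has order exactly $2$. For a finite place $v$ let $K_v$ be the completion, $\mathcal M_v$ the maximal ideal of its valuation ring, $\chi_v$ the restriction of $\chi$ to $K_v^\times$, and $n(\chi_v)\ge 0$ the least integer $n$ such that $\chi_v$ is trivial on the units $u$ of $K_v$ with $u\equiv 1 \bmod \mathcal M_v^n$ (on all units if $n=0$). The *conductor* of $\chi$ is the ideal $\mathfrak f_\chi=\prod_v v^{n(\chi_v)}$ of $\mathbb Z_K$. Put $\chi^c=\chi\circ c$. A character of $I_K$ *arises from base change* if it equals $\nu\circ N_{K/\mathbb Q}$ for an idele class character $\nu$ of $\mathbb Q$. For each prime $p$ split in $K$ choose one place of $K$ above $p$, and let $S_K$ be the set of chosen places. If $v$ is the place above $2$ and $2$ ramifies in $K$, fix a uniformizer $\pi_v$ of $K_v$;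 if $2$ is inert in $K$, fix a primitive cube root of unity $\mu_3\in K_v$. For a nonzero ideal $\mathfrak f=\prod_v v^{m(v)}$ of $\mathbb Z_K$ (and, for the conditions on $\chi_v$, a character $\chi$ with $\mathfrak f_\chi=\mathfrak f$) consider: * $(A)_r$ No place above an odd inert or ramified prime divides $\mathfrak f$. * $(C)_r$ If a place $v$ above a split prime $p$ divides $\mathfrak f$, then $v\in S_K$, and $m(v)=1$ if $p$ is odd, $m(v)\in\{2,3\}$ if $p=2$. * $(D)_r$ If $2$ does not split in $K$ and the place $v$ above $2$ divides $\mathfrak f$, then: if $2$ ramifies, $m(v)=4$, $\chi_v(1+\pi_v)=1$ and $\chi_v(1+\pi_v^3)=-1$; if $2$ is inert, $m(v)=2$, $\chi_v(-1)=-1$ and $\chi_v(1+2\mu_3)=1$. **Theorem.** (I) For every quadratic idele class character $\chi$ of $K$ there is an idele class character $\mu$ of $K$ arising from base change, with $\mu^2=1$, such that $\chi\mu$ (with its conductor) satisfies $(A)_r$, $(C)_r$, $(D)_r$. (II) A quadratic idele class character $\chi$ of $K$ with $\mathfrak f_\chi\ne\mathbb Z_K$ satisfying $(A)_r$, $(C)_r$,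 $(D)_r$ does not arise from base change; moreover $\chi^c=\chi\cdot\delta$ for some quadratic idele class character $\delta$ of $K$. (III) If $\chi\neq\eta$ are quadratic idele class characters of $K$ satisfying $(A)_r$, $(C)_r$, $(D)_r$, then there is no idele class character $\mu$ of $K$ arising from base change with $\chi=\eta\mu$. (IV) If $\mathfrak f=\prod_v v^{m(v)}$ is a nonzero ideal of $\mathbb Z_K$, $\mathfrak f\ne\mathbb Z_K$, whose exponents $m(v)$ satisfy the requirements on exponents and places in $(A)_r$, $(C)_r$, $(D)_r$, then there is a quadratic idele class character $\chi$ of $K$ with conductor $\mathfrak f$ satisfying $(A)_r$, $(C)_r$, $(D)_r$. -/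

import Mathlib

open NumberField IsDedekindDomain IsDedekindDomain.HeightOneSpectrum

noncomputable section

namespace QuadIdele

/-! ### Homomorphisms of completions induced by an embedding of number fields -/

section Completions

variable {K L : Type*} [Field K] [NumberField K] [Field L] [NumberField L]

theorem uniformContinuous_withVal_map (j : K →+* L) (v : HeightOneSpectrum (𝓞 K))
    (w : HeightOneSpectrum (𝓞 L))
    (h : w.asIdeal.comap (RingOfIntegers.mapRingHom j) = v.asIdeal) :
    UniformContinuous (WithVal.map (v.valuation K) (w.valuation L) j) := by
  let _ : Algebra K L := j.toAlgebra
  have : w.asIdeal.LiesOver v.asIdeal := ⟨h.symm⟩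
  exact uniformContinuous_algebraMap_liesOver K L v w

/-- For finite places `w` of `L` and `v` of `K` with `w` above `v` (along `j : K → L`), the
continuous extension `K_v → L_w` of `j`. -/
def finiteCompletionHom (j : K →+* L) (v : HeightOneSpectrum (𝓞 K))
    (w : HeightOneSpectrum (𝓞 L))
    (h : w.asIdeal.comap (RingOfIntegers.mapRingHom j) = v.asIdeal) :
    v.adicCompletion K →+* w.adicCompletion L :=
  ((adicCompletion.equiv L w).symm.toRingHom.comp
    (UniformSpace.Completion.mapRingHom (WithVal.map (v.valuation K) (w.valuation L) j)
      (uniformContinuous_withVal_map j v w h).continuous)).comp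
    (adicCompletion.equiv K v).toRingHom

theorem finiteCompletionHom_coe (j : K →+* L) (v : HeightOneSpectrum (𝓞 K))
    (w : HeightOneSpectrum (𝓞 L))
    (h : w.asIdeal.comap (RingOfIntegers.mapRingHom j) = v.asIdeal) (x : K) :
    finiteCompletionHom j v w h (x : v.adicCompletion K) = (j x : w.adicCompletion L) := by
  apply adicCompletion.ext
  exact UniformSpace.Completion.mapRingHom_coe
    (uniformContinuous_withVal_map j v w h).continuous (WithVal.toVal (v.valuation K) x)

theorem continuous_finiteCompletionHom (j : K →+* L) (v : HeightOneSpectrum (𝓞 K))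
    (w : HeightOneSpectrum (𝓞 L))
    (h : w.asIdeal.comap (RingOfIntegers.mapRingHom j) = v.asIdeal) :
    Continuous (finiteCompletionHom j v w h) :=
  (adicCompletion.continuous_ofCompletion L w).comp <|
    UniformSpace.Completion.continuous_map.comp (adicCompletion.continuous_toCompletion K v)

theorem finiteCompletionHom_mapsTo (j : K →+* L) (v : HeightOneSpectrum (𝓞 K))
    (w : HeightOneSpectrum (𝓞 L))
    (h : w.asIdeal.comap (RingOfIntegers.mapRingHom j) = v.asIdeal) :
    Set.MapsTo (finiteCompletionHom j v w h) (v.adicCompletionIntegers K)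
      (w.adicCompletionIntegers L) := by
  have hO : ∀ x : v.adicCompletion K, x ∉ v.adicCompletionIntegers K ∨
      finiteCompletionHom j v w h x ∈ w.adicCompletionIntegers L := by
    intro x
    refine (HeightOneSpectrum.denseRange_algebraMap K v).induction_on x ?_ ?_
    · exact ((Valued.isClopen_valuationSubring (v.adicCompletion K)).compl.isClosed).union
        ((Valued.isClopen_valuationSubring (w.adicCompletion L)).isClosed.preimage
          (continuous_finiteCompletionHom j v w h))
    · intro a
      let _ : Algebra K L := j.toAlgebra
      have : w.asIdeal.LiesOver v.asIdeal := ⟨h.symm⟩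
      rw [algebraMap_adicCompletion, Function.comp_apply, Algebra.algebraMap_self_apply,
        finiteCompletionHom_coe, mem_adicCompletionIntegers, mem_adicCompletionIntegers,
        valuedAdicCompletion_eq_valuation', valuedAdicCompletion_eq_valuation',
        show j a = algebraMap K L a from rfl, ← valuation_liesOver L v w a, or_iff_not_imp_left,
        not_not]
      exact fun ha => pow_le_one₀ zero_le ha
  exact fun x hx => (hO x).resolve_left fun hn => hn hx

/-- For infinite places `w` of `L` and `v` of `K` with `w` above `v` (along `j : K → L`), the
continuous extension `K_v → L_w` of `j`. -/
def infiniteCompletionHom (j : K →+* L) (v : InfinitePlace K) (w : InfinitePlace L)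
    (h : w.comap j = v) : v.Completion →+* w.Completion :=
  letI : Algebra K L := j.toAlgebra
  haveI : w.LiesOver v := ⟨congrArg Subtype.val h⟩
  NumberField.LiesOver.completionMap

end Completions

/-! ### Ideles and idele class characters -/

/-- The idele group `I_K`. -/
abbrev Idele (K : Type*) [Field K] [NumberField K] : Type _ := (AdeleRing (𝓞 K) K)ˣ

/-- The diagonal embedding `K^× → I_K`. -/
def principalIdele (K : Type*) [Field K] [NumberField K] : Kˣ →* Idele K :=
  Units.map (algebraMap K (AdeleRing (𝓞 K) K)).toMonoidHom

/-- The group of idele class characters of `K`: continuous homomorphisms from `I_K` to the unit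
circle that are trivial on `K^×`. -/
def IdeleClassCharacter (K : Type*) [Field K] [NumberField K] :
    Subgroup (Idele K →ₜ* Circle) where
  carrier := {χ | ∀ x : Kˣ, χ (principalIdele K x) = 1}
  mul_mem' := fun ha hb x => by
    rw [ContinuousMonoidHom.mul_apply, ha x, hb x, one_mul]
  one_mem' := fun _ => rfl
  inv_mem' := fun {χ} ha x => (congrArg (·⁻¹) (ha x)).trans inv_one

section Local

variable {K : Type*} [Field K] [NumberField K]

open Classical in
/-- The embedding `K_v^× → I_K` at a finite place `v`: the component at `v` is the given element,
all other components are `1`. -/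
def localIdele (v : HeightOneSpectrum (𝓞 K)) : (v.adicCompletion K)ˣ →* Idele K :=
  let f : (v.adicCompletion K)ˣ →* (FiniteAdeleRing (𝓞 K) K)ˣ :=
    { toFun := fun x =>
        (RestrictedProduct.unitsEquiv
          (fun w : HeightOneSpectrum (𝓞 K) => w.adicCompletion K)).symm
          (RestrictedProduct.mulSingle _ v x)
      map_one' := by rw [RestrictedProduct.mulSingle_one, map_one]; rfl
      map_mul' := fun x y => by rw [RestrictedProduct.mulSingle_mul, map_mul]; rfl }
  (MulEquiv.prodUnits (M := InfiniteAdeleRing K)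
    (N := FiniteAdeleRing (𝓞 K) K)).symm.toMonoidHom.comp (MonoidHom.prod 1 f)

/-- The local component `χ_v` of a character at a finite place `v`, extended by `0` to `0 ∈ K_v`. -/
def localValue (χ : Idele K →ₜ* Circle) (v : HeightOneSpectrum (𝓞 K))
    (x : v.adicCompletion K) : ℂ :=
  open Classical in if h : x = 0 then 0 else (χ (localIdele v (Units.mk0 x h)) : ℂ)

/-- The exponent of the conductor of `χ_v`: the least `n` such that `χ_v` is trivial on the units
`u` of `K_v` with `u ≡ 1 mod 𝓜_v ^ n` (so `n = 0` exactly when `χ` is unramified at `v`). -/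
def condExponent (χ : Idele K →ₜ* Circle) (v : HeightOneSpectrum (𝓞 K)) : ℕ :=
  sInf {n : ℕ | ∀ u : v.adicCompletion K, Valued.v u = 1 →
    Valued.v (u - 1) ≤ WithZero.exp (-(n : ℤ)) → localValue χ v u = 1}

/-- The (finite) conductor of `χ`, an ideal of the ring of integers. -/
def finiteConductor (χ : Idele K →ₜ* Circle) : Ideal (𝓞 K) :=
  ∏ᶠ v : HeightOneSpectrum (𝓞 K), v.asIdeal ^ condExponent χ v

end Local

/-! ### Galois conjugation -/

section Conj

variable {K : Type*} [Field K] [NumberField K]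

/-- The finite place `σ⁻¹ w`. -/
def conjPlace (σ : K ≃ₐ[ℚ] K) (w : HeightOneSpectrum (𝓞 K)) : HeightOneSpectrum (𝓞 K) :=
  HeightOneSpectrum.equivOfRingEquiv
    (RingOfIntegers.mapRingEquiv (σ : K ≃+* K)).symm w

/-- The action of `σ` on finite adeles: the component of `σ x` at `w` is `σ (x_{σ⁻¹ w})`. -/
def conjFiniteAdele (σ : K ≃ₐ[ℚ] K) : FiniteAdeleRing (𝓞 K) K →+* FiniteAdeleRing (𝓞 K) K :=
  RestrictedProduct.mapAlongRingHom
    (fun v : HeightOneSpectrum (𝓞 K) => v.adicCompletion K)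
    (fun v : HeightOneSpectrum (𝓞 K) => v.adicCompletion K)
    (conjPlace σ) (Equiv.injective _).tendsto_cofinite
    (fun w => finiteCompletionHom (σ : K →+* K) (conjPlace σ w) w rfl)
    (Filter.Eventually.of_forall fun w => finiteCompletionHom_mapsTo _ _ w rfl)

/-- The action of `σ` on infinite adeles. -/
def conjInfiniteAdele (σ : K ≃ₐ[ℚ] K) : InfiniteAdeleRing K →+* InfiniteAdeleRing K :=
  RingHom.pi fun w => (infiniteCompletionHom (σ : K →+* K) (w.comap (σ : K →+* K)) w rfl).comp
    (Pi.evalRingHom (fun v : InfinitePlace K => v.Completion) (w.comap (σ : K →+* K)))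

/-- The action of `σ` on ideles. -/
def conjIdele (σ : K ≃ₐ[ℚ] K) : Idele K →* Idele K :=
  Units.map (RingHom.prodMap (conjInfiniteAdele σ) (conjFiniteAdele σ)).toMonoidHom

end Conj

/-! ### The idele norm and base change -/

section Norm

variable (k K : Type*) [Field k] [NumberField k] [Field K] [NumberField K] [Algebra k K]

/-- The local norm `K_v → k_p` at a finite place `v` of `K` above the place `p` of `k`. -/
def finiteLocalNorm (p : HeightOneSpectrum (𝓞 k)) (v : HeightOneSpectrum (𝓞 K))
    (h : v.asIdeal.comap (RingOfIntegers.mapRingHom (algebraMap k K)) = p.asIdeal) :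
    v.adicCompletion K →* p.adicCompletion k :=
  letI : Algebra (p.adicCompletion k) (v.adicCompletion K) :=
    (finiteCompletionHom (algebraMap k K) p v h).toAlgebra
  Algebra.norm (p.adicCompletion k)

/-- The local norm `K_v → k_p` at an infinite place `v` of `K` above the place `p` of `k`. -/
def infiniteLocalNorm (p : InfinitePlace k) (v : InfinitePlace K)
    (h : v.comap (algebraMap k K) = p) : v.Completion →* p.Completion :=
  letI : Algebra p.Completion v.Completion :=
    (infiniteCompletionHom (algebraMap k K) p v h).toAlgebra
  Algebra.norm p.Completion

/-- `y` is the norm `N_{K/k} x` of the idele `x`: for every place `p` of `k`, the component of `y`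
at `p` is the product of the local norms of the components of `x` at the places above `p`. -/
def IsIdeleNorm (x : Idele K) (y : Idele k) : Prop :=
  (∀ p : HeightOneSpectrum (𝓞 k), y.val.2 p =
    ∏ᶠ v : {v : HeightOneSpectrum (𝓞 K) //
      v.asIdeal.comap (RingOfIntegers.mapRingHom (algebraMap k K)) = p.asIdeal},
      finiteLocalNorm k K p v.1 v.2 (x.val.2 v.1)) ∧
  (∀ p : InfinitePlace k, y.val.1 p =
    ∏ᶠ v : {v : InfinitePlace K // v.comap (algebraMap k K) = p},
      infiniteLocalNorm k K p v.1 v.2 (x.val.1 v.1))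

variable {K}

/-- `μ = ν ∘ N_{K/ℚ}` for some idele class character `ν` of `ℚ`. -/
def FromBaseChange (μ : Idele K →ₜ* Circle) : Prop :=
  ∃ ν ∈ IdeleClassCharacter ℚ, ∀ x : Idele K, ∃ y : Idele ℚ, IsIdeleNorm ℚ K x y ∧ μ x = ν y

end Norm

/-! ### Splitting of rational primes in a quadratic field -/

section Splitting

variable (K : Type*) [Field K] [NumberField K]

/-- The place `v` lies above the rational prime `p`. -/
def Above {K : Type*} [Field K] [NumberField K] (v : HeightOneSpectrum (𝓞 K)) (p : ℕ) : Prop :=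
  (p : 𝓞 K) ∈ v.asIdeal

/-- The rational prime `p` splits in the quadratic field `K`. -/
def SplitIn (p : ℕ) : Prop :=
  ∃ v w : HeightOneSpectrum (𝓞 K), v ≠ w ∧ Ideal.span {(p : 𝓞 K)} = v.asIdeal * w.asIdeal

/-- The rational prime `p` is inert in the quadratic field `K`. -/
def InertIn (p : ℕ) : Prop :=
  ∃ v : HeightOneSpectrum (𝓞 K), Ideal.span {(p : 𝓞 K)} = v.asIdeal

/-- The rational prime `p` ramifies in the quadratic field `K`. -/
def RamifiedIn (p : ℕ) : Prop :=
  ∃ v : HeightOneSpectrum (𝓞 K), Ideal.span {(p : 𝓞 K)} = v.asIdeal ^ 2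

variable {K}

/-- `S` consists of exactly one place above each rational prime that splits in `K`. -/
def IsSplitChoice (S : Set (HeightOneSpectrum (𝓞 K))) : Prop :=
  (∀ v ∈ S, ∃ p : ℕ, p.Prime ∧ SplitIn K p ∧ Above v p) ∧
  ∀ p : ℕ, p.Prime → SplitIn K p → ∃! v : HeightOneSpectrum (𝓞 K), v ∈ S ∧ Above v p

end Splitting

/-! ### The conditions on conductors and characters -/

section Conditions

variable {K : Type*} [Field K] [NumberField K]

/-- The exponent `m(v)` of the place `v` in a nonzero ideal. -/
def ordAt (v : HeightOneSpectrum (𝓞 K)) (f : Ideal (𝓞 K)) : ℕ := multiplicity v.asIdeal f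

/-- No place above an odd inert or ramified prime divides the ideal. -/
def CondA (f : Ideal (𝓞 K)) : Prop :=
  ∀ p : ℕ, p.Prime → p ≠ 2 → (InertIn K p ∨ RamifiedIn K p) →
    ∀ v : HeightOneSpectrum (𝓞 K), Above v p → ¬ v.asIdeal ∣ f

/-- A place above a split prime `p` that divides the ideal belongs to `S`, with exponent `1` if `p`
is odd, and `2` or `3` if `p = 2`. -/
def CondC (S : Set (HeightOneSpectrum (𝓞 K))) (f : Ideal (𝓞 K)) : Prop :=
  ∀ p : ℕ, p.Prime → SplitIn K p → ∀ v : HeightOneSpectrum (𝓞 K), Above v p → v.asIdeal ∣ f →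
    v ∈ S ∧ (p ≠ 2 → ordAt v f = 1) ∧ (p = 2 → ordAt v f = 2 ∨ ordAt v f = 3)

/-- A place above `2` that divides the ideal has exponent `4` if `2` ramifies, `2` if `2` is
inert. -/
def CondDExponent (f : Ideal (𝓞 K)) : Prop :=
  ∀ v : HeightOneSpectrum (𝓞 K), Above v 2 → v.asIdeal ∣ f →
    (RamifiedIn K 2 → ordAt v f = 4) ∧ (InertIn K 2 → ordAt v f = 2)

/-- The exponent condition above a non-split `2`, together with the prescribed local values there:
`χ_v(1 + π_v) = 1`, `χ_v(1 + π_v ^ 3) = -1` in the ramified case, and `χ_v(-1) = -1`,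
`χ_v(1 + 2 μ₃) = 1` in the inert case. -/
def CondD (ϖ ζ : (v : HeightOneSpectrum (𝓞 K)) → v.adicCompletion K)
    (χ : Idele K →ₜ* Circle) : Prop :=
  CondDExponent (finiteConductor χ) ∧
  ∀ v : HeightOneSpectrum (𝓞 K), Above v 2 → v.asIdeal ∣ finiteConductor χ →
    (RamifiedIn K 2 → localValue χ v (1 + ϖ v) = 1 ∧ localValue χ v (1 + ϖ v ^ 3) = -1) ∧
    (InertIn K 2 → localValue χ v (-1) = -1 ∧ localValue χ v (1 + ζ v * 2) = 1)

/-- The conjunction of the three conditions, for a character. -/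
def SatisfiesACD (S : Set (HeightOneSpectrum (𝓞 K)))
    (ϖ ζ : (v : HeightOneSpectrum (𝓞 K)) → v.adicCompletion K)
    (χ : Idele K →ₜ* Circle) : Prop :=
  CondA (finiteConductor χ) ∧ CondC S (finiteConductor χ) ∧ CondD ϖ ζ χ

/-- A quadratic idele class character: an idele class character of order `2`. -/
def IsQuadratic (χ : Idele K →ₜ* Circle) : Prop :=
  χ ∈ IdeleClassCharacter K ∧ orderOf χ = 2

end Conditions

end QuadIdele

end

open QuadIdele

/-! The arithmetic input is a unit `ε` of norm `-1`: it is `1 + √2` when `d = 2`, and otherwise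
comes from the negative Pell equation. Ideals stable under conjugation are principal, because only
`d` can ramify and the prime above it is `(√d)`. A Hilbert 90 argument then shows that `-1` and `ε`
generate the units modulo squares (`exists_unit_eq`). An ambiguous-class argument shows that the
class number is odd (`odd_classNumber`).

These facts reduce quadratic characters to their restrictions to local units. A quadratic character
of one completion extends, on units, to a global quadratic character ramified at no other finite
place, since sign characters at the two real places can cancel its values at `-1` and `ε`
(`exists_quadratic_character`). Conversely, a quadratic character unramified at all finite places is
trivial (`eq_one_of_unramified`). Over `ℚ` the only units are `±1`, and one sign character suffices
(`exists_rat_character`). The three conditions become a condition `Good` on each local component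
(`satisfiesACD_iff`).

For (I), each prime `p` is repaired by a twist `ν ∘ N` with `ν` ramified at no other finite place.
If `p` splits, `ν` copies the component at the place outside `S`. If `p` is odd and inert, the
residue norm is surjective and all ramified quadratic characters agree on units, so a quadratic `ν`
works. If `p = d` is odd, norms of integers are squares, and a `ν` of order dividing `4` is needed;
it exists because `d ≡ 1 mod 4`. At a non-split `2` the unit filtration has explicit generators,
whose norms are rational integers on which `ν` can be prescribed. Twists at distinct primes do not
interfere (`exists_twist_finset`).

For (II) and (III), a base change takes the value `1` at `-1` at non-split places, since `N(-1) =
1`, and its components at two conjugate split places come from the same component of `ν`. If it is a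
product of two characters satisfying the conditions, this makes it unramified everywhere, hence
trivial (`eq_of_good`). The character `δ` in (II) is `χ^c χ`; it is non-trivial because invariance
under `c` would make `χ` unramified (`conjChar_ne`). For (IV), local characters with the exact
conductor are exhibited and glued (`exists_of_conductor`). -/

noncomputable section

namespace QuadIdele

/-! ### Characters of the multiplicative group of a discretely valued field -/

section LocalCharacters

variable {L : Type*} [Field L] (V : Valuation L (WithZero (Multiplicative ℤ)))

/-- `x` lies in the `n`-th power of the maximal ideal. -/
def Lev (n : ℕ) (x : L) : Prop := V x ≤ WithZero.exp (-(n : ℤ))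

/-- `ψ` is trivial on the units congruent to `1` modulo the `n`-th power of the maximal ideal. -/
def Triv (ψ : L →*₀ ℂ) (n : ℕ) : Prop := ∀ u, V u = 1 → Lev V n (u - 1) → ψ u = 1

variable {V}

theorem Lev.mono {m n : ℕ} {x : L} (h : Lev V n x) (hmn : m ≤ n) : Lev V m x :=
  h.trans (WithZero.exp_le_exp.2 (by omega))

theorem Lev.add {n : ℕ} {x y : L} (hx : Lev V n x) (hy : Lev V n y) : Lev V n (x + y) :=
  V.map_add_le hx hy

theorem Lev.neg {n : ℕ} {x : L} (hx : Lev V n x) : Lev V n (-x) := by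
  rwa [Lev, V.map_neg]

theorem Lev.sub {n : ℕ} {x y : L} (hx : Lev V n x) (hy : Lev V n y) : Lev V n (x - y) :=
  V.map_sub_le hx hy

theorem Lev.symm {n : ℕ} {x y : L} (h : Lev V n (x - y)) : Lev V n (y - x) := by
  have := h.neg
  rwa [neg_sub] at this

theorem Lev.mul {m n : ℕ} {x y : L} (hx : Lev V m x) (hy : Lev V n y) :
    Lev V (m + n) (x * y) := by
  rw [Lev, map_mul, show -((m + n : ℕ) : ℤ) = -(m : ℤ) + -(n : ℤ) by push_cast; ring,
    WithZero.exp_add]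
  exact mul_le_mul' hx hy

theorem lev_zero_iff {x : L} : Lev V 0 x ↔ V x ≤ 1 := by simp [Lev]

theorem lev_one_iff {x : L} : Lev V 1 x ↔ V x < 1 := by
  rcases eq_or_ne x 0 with rfl | hx
  · simp [Lev]
  · have h0 : V x ≠ 0 := V.ne_zero_iff.2 hx
    rw [Lev, ← WithZero.exp_log h0, ← WithZero.exp_zero, WithZero.exp_le_exp, WithZero.exp_lt_exp]
    push_cast
    omega

theorem Lev.mul_left {n : ℕ} {a x : L} (ha : V a ≤ 1) (hx : Lev V n x) : Lev V n (a * x) := by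
  have := (lev_zero_iff.2 ha).mul hx
  rwa [zero_add] at this

theorem Lev.mul_right {n : ℕ} {a x : L} (hx : Lev V n x) (ha : V a ≤ 1) : Lev V n (x * a) := by
  rw [mul_comm]; exact hx.mul_left ha

theorem Lev.pow {n : ℕ} {x : L} (hx : Lev V n x) (k : ℕ) : Lev V (k * n) (x ^ k) := by
  induction k with
  | zero => simp [Lev]
  | succ k ih =>
    rw [pow_succ, Nat.succ_mul]
    exact ih.mul hx

theorem Lev.zero (n : ℕ) : Lev V n 0 := by simp [Lev]

theorem Lev.of_eq {n : ℕ} {x : L} (h : V x = WithZero.exp (-(n : ℤ))) : Lev V n x := h.le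

theorem natCast_le_one (n : ℕ) : V (n : L) ≤ 1 := by
  induction n with
  | zero => simp
  | succ n ih => rw [Nat.cast_succ]; exact V.map_add_le ih V.map_one.le

theorem ofNat_le_one (n : ℕ) [n.AtLeastTwo] : V (OfNat.ofNat n : L) ≤ 1 :=
  natCast_le_one (V := V) n

theorem unit_of_close {x y : L} (hx : V x = 1) (h : Lev V 1 (x - y)) : V y = 1 := by
  have h1 : V (x - y) < V x := by rw [hx]; exact lev_one_iff.1 h
  rw [← hx, ← V.map_sub_eq_of_lt_right (x := x - y) (y := x) h1]
  simp [V.map_neg]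

theorem unit_of_lev {x : L} (h : Lev V 1 (x - 1)) : V x = 1 :=
  unit_of_close V.map_one h.symm

theorem lev_div {m n : ℕ} {x y : L} (hx : Lev V (m + n) x)
    (hy : V y = WithZero.exp (-(n : ℤ))) : Lev V m (x / y) := by
  have hy0 : y ≠ 0 := by
    rintro rfl
    rw [map_zero] at hy
    exact WithZero.exp_ne_zero hy.symm
  rcases eq_or_ne x 0 with rfl | hx0
  · simp [Lev]
  rw [Lev, map_div₀, hy, div_le_iff₀ (by exact zero_lt_iff.2 WithZero.exp_ne_zero),
    ← WithZero.exp_add]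
  refine hx.trans (WithZero.exp_le_exp.2 ?_)
  push_cast
  omega

theorem ne_zero_of_unit {x : L} (hx : V x = 1) : x ≠ 0 := by
  rintro rfl
  simp at hx

theorem Triv.mono {ψ : L →*₀ ℂ} {m n : ℕ} (h : Triv V ψ m) (hmn : m ≤ n) : Triv V ψ n :=
  fun u hu hu' => h u hu (hu'.mono hmn)

theorem Triv.eq_of_close {ψ : L →*₀ ℂ} {n : ℕ} (h : Triv V ψ n) {x y : L} (hx : V x = 1)
    (hy : V y = 1) (hxy : Lev V n (x - y)) : ψ x = ψ y := by
  have hy0 := ne_zero_of_unit hy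
  have h1 : ψ (x / y) = 1 := by
    refine h _ (by rw [map_div₀, hx, hy, div_one]) ?_
    rw [div_sub_one hy0, Lev, map_div₀, hy, div_one]
    exact hxy
  rw [← div_mul_cancel₀ x hy0, map_mul, h1, one_mul]

/-- `ψ` takes the values `1` and `-1` on non-zero elements. -/
def IsSq1 (ψ : L →*₀ ℂ) : Prop := ∀ x, x ≠ 0 → ψ x ^ 2 = 1

theorem IsSq1.cases {ψ : L →*₀ ℂ} (h : IsSq1 ψ) {x : L} (hx : x ≠ 0) : ψ x = 1 ∨ ψ x = -1 :=
  by
  have h1 : (ψ x - 1) * (ψ x + 1) = 0 := by linear_combination h x hx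
  rcases mul_eq_zero.1 h1 with h2 | h2
  · exact Or.inl (sub_eq_zero.1 h2)
  · exact Or.inr (eq_neg_of_add_eq_zero_left h2)

/-- A unit `1 + 2y` with `y` of level `e + 1 + k` equals the square `(1 + y) ^ 2` up to `y ^ 2`,
which is at least as deep as the level where `ψ` is already trivial. So triviality moves down one
level at a time. For `e = 0, 1, 2` this bounds the conductor exponent of a quadratic character by
`1`, `3`, `5`. -/
theorem Triv.descend {ψ : L →*₀ ℂ} (hψ : IsSq1 ψ) {e : ℕ}
    (h2 : V 2 = WithZero.exp (-(e : ℤ))) {N : ℕ} (hN : Triv V ψ N) : Triv V ψ (2 * e + 1) := by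
  have h20 : (2 : L) ≠ 0 := by
    intro h
    rw [h, map_zero] at h2
    exact WithZero.exp_ne_zero h2.symm
  have key : ∀ k, Triv V ψ (2 * e + 1 + k) → Triv V ψ (2 * e + 1) := by
    intro k
    induction k with
    | zero => exact id
    | succ k ih =>
      intro hk
      refine ih fun u hu hu1 => ?_
      set y := (u - 1) / 2 with hy
      have hy1 : Lev V (e + 1 + k) y := lev_div (n := e) (hu1.mono (by omega)) h2
      have hu' : u = 1 + 2 * y := by rw [hy]; field_simp; ring
      have ht : V (1 + y) = 1 := unit_of_lev (by simpa using hy1.mono (by omega))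
      have hcl : Lev V (2 * e + 1 + (k + 1)) (u - (1 + y) ^ 2) := by
        rw [hu', show 1 + 2 * y - (1 + y) ^ 2 = -(y * y) by ring]
        exact ((hy1.mul hy1).mono (by omega)).neg
      rw [hk.eq_of_close hu (by rw [map_pow, ht, one_pow]) hcl, map_pow]
      exact hψ _ (ne_zero_of_unit ht)
  exact key N (hN.mono (by omega))

/-- The residue field has two elements. -/
def ResTwo (V : Valuation L (WithZero (Multiplicative ℤ))) : Prop :=
  ∀ x, V x ≤ 1 → Lev V 1 x ∨ Lev V 1 (x - 1)

/-- For `n ≥ 1`, units of level `n` modulo those of level `n + 1` form a group of order two when the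
residue field has two elements, so it is enough to test `ψ` on one element `w` of the non-trivial
class. -/
theorem Triv.step {ψ : L →*₀ ℂ} (hR : ResTwo V) {p : L} (hp : V p = WithZero.exp (-1 : ℤ))
    {n : ℕ} (hn : 1 ≤ n) (h : Triv V ψ (n + 1)) {w : L} (hw : Lev V (n + 1) (w - (1 + p ^ n)))
    (hψw : ψ w = 1) : Triv V ψ n := by
  have hpn : V (p ^ n) = WithZero.exp (-(n : ℤ)) := by
    rw [map_pow, hp, ← WithZero.exp_nsmul]; simp
  have hp0 : p ^ n ≠ 0 := by
    intro h0
    rw [h0, map_zero] at hpn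
    exact WithZero.exp_ne_zero hpn.symm
  have hw1 : V w = 1 := by
    refine unit_of_lev ?_
    have := (hw.mono (by omega : 1 ≤ n + 1)).add ((Lev.of_eq hpn).mono hn)
    convert this using 1
    ring
  intro u hu hu1
  have hz : V ((u - 1) / p ^ n) ≤ 1 := lev_zero_iff.1 (lev_div (by simpa using hu1) hpn)
  have hz' : u - 1 = (u - 1) / p ^ n * p ^ n := by field_simp
  rcases hR _ hz with h1 | h1
  · refine h u hu ?_
    rw [hz', add_comm]
    exact h1.mul (Lev.of_eq hpn)
  · rw [← hψw]
    refine h.eq_of_close hu hw1 ?_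
    have h3 := h1.mul (Lev.of_eq hpn)
    rw [add_comm 1 n] at h3
    convert h3.sub hw using 1
    rw [sub_mul, ← hz']
    ring

theorem Triv.zero_of_one {ψ : L →*₀ ℂ} (hR : ResTwo V) (h : Triv V ψ 1) : Triv V ψ 0 := by
  intro u hu _
  refine h u hu ?_
  rcases hR u hu.le with h1 | h1
  · rw [lev_one_iff, hu] at h1
    exact absurd h1 (lt_irrefl _)
  · exact h1

/-! ### Unit filtration when `2` is the square of a uniformizer up to a unit and the residue field
is `𝔽₂` -/

section RamifiedTwo

variable {p : L} (hR : ResTwo V) (h2 : V 2 = WithZero.exp (-2 : ℤ))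
  (hp : V p = WithZero.exp (-1 : ℤ))
include hR h2 hp

/-- The pieces of the filtration at levels `3`, `2`, `1` are represented by `1 + p ^ 3`, `(1 + p) ^
2` and `1 + p`. The middle one costs nothing, since `(1 + p) ^ 2` is `1 + p ^ 2` up to `2 * p`, of
level `3`. -/
theorem triv_zero_of_ramified {ψ : L →*₀ ℂ} (h4 : Triv V ψ 4)
    (h1 : ψ (1 + p) = 1) (h3 : ψ (1 + p ^ 3) = 1) : Triv V ψ 0 := by
  have t3 : Triv V ψ 3 := Triv.step hR hp (by norm_num) h4 (w := 1 + p ^ 3)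
    (by simpa using Lev.zero _) h3
  have hl2 : Lev V 2 (2 : L) := Lev.of_eq h2
  have hl1 : Lev V 1 p := Lev.of_eq hp
  have hu1 : V (1 + p) = 1 := unit_of_lev (by simpa using hl1)
  have t2 : Triv V ψ 2 := by
    refine Triv.step hR hp (by norm_num) t3 (w := (1 + p) ^ 2) ?_ ?_
    · rw [show (1 + p) ^ 2 - (1 + p ^ 2) = 2 * p by ring]
      exact hl2.mul hl1
    · rw [map_pow, h1, one_pow]
  exact Triv.zero_of_one hR (Triv.step hR hp le_rfl t2 (w := 1 + p)
    (by simpa using Lev.zero _) h1)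

/-- `5 = 1 + 4`, and `4` and `p ^ 4` have the same valuation; over a residue field with two elements
they are therefore congruent at level `5`. -/
theorem triv_four_of_ramified {ψ : L →*₀ ℂ} (h5 : Triv V ψ 5) (h : ψ 5 = 1) : Triv V ψ 4 := by
  refine Triv.step hR hp (by norm_num) h5 (w := 5) ?_ h
  have hp4 : V (p ^ 4) = WithZero.exp (-(4 : ℕ) : ℤ) := by
    rw [map_pow, hp, ← WithZero.exp_nsmul]; simp
  have hp0 : p ^ 4 ≠ 0 := by
    intro h0
    rw [h0, map_zero] at hp4
    exact WithZero.exp_ne_zero hp4.symm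
  have h4 : V 4 = WithZero.exp (-(4 : ℕ) : ℤ) := by
    rw [show (4 : L) = 2 * 2 by norm_num, map_mul, h2, ← WithZero.exp_add]; simp
  have hz : V (4 / p ^ 4) = 1 := by rw [map_div₀, h4, hp4, div_self WithZero.exp_ne_zero]
  rcases hR _ hz.le with h1 | h1
  · rw [lev_one_iff, hz] at h1
    exact absurd h1 (lt_irrefl _)
  · have := h1.mul (Lev.of_eq hp4)
    rw [add_comm] at this
    convert this using 1
    rw [sub_mul, div_mul_cancel₀ _ hp0]
    ring

/-- When `2 = s ^ 2`, the quotient `s / p` is a unit congruent to `1`, so its square is `1` at level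
`2` and `2 ≡ p ^ 2` at level `4`. Expanding then gives `(1 + p) ^ 2 * (1 + p ^ 3) ≡ -1` at level
`4`. Thus the value prescribed at `1 + p ^ 3` is really the value at `-1`. -/
theorem ramified_neg_one {ψ : L →*₀ ℂ} (hψ : IsSq1 ψ) (h4 : Triv V ψ 4) {s : L}
    (hs : s ^ 2 = 2) : ψ (-1) = ψ (1 + p ^ 3) := by
  have hl2 : Lev V 2 (2 : L) := Lev.of_eq h2
  have hl1 : Lev V 1 p := Lev.of_eq hp
  have hl3 : Lev V 3 (p ^ 3) := by simpa using hl1.pow 3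
  have hp0 : p ≠ 0 := by
    rintro rfl
    rw [map_zero] at hp
    exact WithZero.exp_ne_zero hp.symm
  have hu1 : V (1 + p) = 1 := unit_of_lev (by simpa using hl1)
  have hu3 : V (1 + p ^ 3) = 1 := unit_of_lev (by simpa using hl3.mono (by norm_num))
  have hVs : V s = WithZero.exp (-1 : ℤ) := by
    have h := congrArg V hs
    rw [map_pow, h2] at h
    have hs0 : V s ≠ 0 := by
      intro h0
      rw [h0, zero_pow two_ne_zero] at h
      exact WithZero.exp_ne_zero h.symm
    rw [← WithZero.exp_log hs0, ← WithZero.exp_nsmul, WithZero.exp_inj] at h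
    rw [← WithZero.exp_log hs0, WithZero.exp_inj]
    simp only [nsmul_eq_mul] at h
    push_cast at h
    omega
  set w := s / p with hw
  have hVw : V w = 1 := by rw [hw, map_div₀, hVs, hp, div_self WithZero.exp_ne_zero]
  have hw1 : Lev V 1 (w - 1) := by
    rcases hR _ hVw.le with h1 | h1
    · rw [lev_one_iff, hVw] at h1
      exact absurd h1 (lt_irrefl _)
    · exact h1
  have hw2 : Lev V 2 (w ^ 2 - 1) := by
    rw [show w ^ 2 - 1 = (w - 1) * (w - 1) + 2 * (w - 1) by ring]
    exact (hw1.mul hw1).add ((hl2.mul hw1).mono (by norm_num))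
  have h2p : (2 : L) = p ^ 2 * w ^ 2 := by rw [hw, ← hs]; field_simp
  have hl22 : Lev V 4 (2 - p ^ 2) := by
    rw [h2p, show p ^ 2 * w ^ 2 - p ^ 2 = p * p * (w ^ 2 - 1) by ring]
    exact (hl1.mul hl1).mul hw2
  have hcl : Lev V 4 ((1 + p) ^ 2 * (1 + p ^ 3) - (-1)) := by
    have e : (1 + p) ^ 2 * (1 + p ^ 3) - (-1) =
        2 * 2 + (p ^ 2 - 2) + 2 * p ^ 3 + (2 - p ^ 2) * p + 2 * p ^ 3 * p + p ^ 3 * p * p := by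
      ring
    have a1 : Lev V 4 (2 * 2 : L) := hl2.mul hl2
    have a3 : Lev V 4 (2 * p ^ 3) := (hl2.mul hl3).mono (by norm_num)
    have a4 : Lev V 4 ((2 - p ^ 2) * p) := (hl22.mul hl1).mono (by norm_num)
    have a5 : Lev V 4 (2 * p ^ 3 * p) := (a3.mul hl1).mono (by norm_num)
    have a6 : Lev V 4 (p ^ 3 * p * p) := ((hl3.mul hl1).mul hl1).mono (by norm_num)
    rw [e]
    exact ((((a1.add hl22.symm).add a3).add a4).add a5).add a6
  have := h4.eq_of_close (x := (1 + p) ^ 2 * (1 + p ^ 3)) (y := -1)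
    (by rw [map_mul, map_pow, hu1, hu3]; simp) (by rw [V.map_neg, V.map_one]) hcl
  rw [← this, map_mul, map_pow, hψ _ (ne_zero_of_unit hu1), one_mul]

end RamifiedTwo

/-! ### Unit filtration when `2` is a uniformizer and the residue field is `𝔽₄` -/

section InertTwo

variable {z : L} (h2 : V 2 = WithZero.exp (-1 : ℤ)) (hz : z ^ 2 + z + 1 = 0)

/-- The residue field is generated by the cube root of unity `z`. -/
def ResFour (V : Valuation L (WithZero (Multiplicative ℤ))) (z : L) : Prop :=
  ∀ x, V x ≤ 1 → Lev V 1 x ∨ Lev V 1 (x - 1) ∨ Lev V 1 (x - z) ∨ Lev V 1 (x - z ^ 2)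

include hz in
theorem cube_root_pow_three : z ^ 3 = 1 := by linear_combination (z - 1) * hz

include hz in
theorem cube_root_unit : V z = 1 := by
  have h := congrArg V (cube_root_pow_three hz)
  rw [map_pow, map_one] at h
  exact (pow_eq_one_iff.1 h).resolve_right (by norm_num)

include h2

/-- The piece of the filtration at level `n` is a copy of the residue field, with classes `0, 1, z,
z ^ 2`; the elements `w₀, w₁, w₂` represent the three non-zero ones. -/
theorem triv_step_inert (hR : ResFour V z) {ψ : L →*₀ ℂ}
    {n : ℕ} (hn : 1 ≤ n) (h : Triv V ψ (n + 1))
    {w₀ w₁ w₂ : L} (h0 : ψ w₀ = 1) (hw0 : Lev V (n + 1) (w₀ - (1 + 2 ^ n)))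
    (h1 : ψ w₁ = 1) (hw1 : Lev V (n + 1) (w₁ - (1 + 2 ^ n * z)))
    (h2' : ψ w₂ = 1) (hw2 : Lev V (n + 1) (w₂ - (1 + 2 ^ n * z ^ 2)))
    (hz1 : V z = 1) : Triv V ψ n := by
  have hpn : V ((2 : L) ^ n) = WithZero.exp (-(n : ℤ)) := by
    rw [map_pow, h2, ← WithZero.exp_nsmul]; simp
  have hp0 : (2 : L) ^ n ≠ 0 := by
    intro h0
    rw [h0, map_zero] at hpn
    exact WithZero.exp_ne_zero hpn.symm
  have main : ∀ (t a u : L), V a ≤ 1 → ψ t = 1 → Lev V (n + 1) (t - (1 + 2 ^ n * a)) → V u = 1 →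
      Lev V 1 ((u - 1) / 2 ^ n - a) → ψ u = 1 := by
    intro t a u ha hψt ht hu hua
    have ht1 : V t = 1 := by
      refine unit_of_lev ?_
      convert (ht.mono (by omega : 1 ≤ n + 1)).add
        (((Lev.of_eq hpn).mono hn).mul_right ha) using 1
      ring
    rw [← hψt]
    refine h.eq_of_close hu ht1 ?_
    have h3 := hua.mul (Lev.of_eq hpn)
    rw [add_comm 1 n, sub_mul, div_mul_cancel₀ _ hp0] at h3
    convert h3.sub ht using 1
    ring
  intro u hu hu1
  have hx : V ((u - 1) / 2 ^ n) ≤ 1 := lev_zero_iff.1 (lev_div (by simpa using hu1) hpn)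
  rcases hR _ hx with h4 | h4 | h4 | h4
  · exact main 1 0 u (by simp) (map_one _) (by simpa using Lev.zero _) hu (by simpa using h4)
  · exact main w₀ 1 u (by simp) h0 (by simpa using hw0) hu h4
  · exact main w₁ z u hz1.le h1 hw1 hu h4
  · exact main w₂ (z ^ 2) u (by simp [hz1]) h2' hw2 hu h4

include hz

/-- At level `1` the three classes are represented by `-1`, which is `1 + 2` modulo `4`, by `1 +
2z`, and by their product, which equals `1 + 2z ^ 2`. Below level `1` the remaining classes are
powers of `z`, on which a character with values `±1` is trivial because `z` has order three. -/
theorem triv_zero_of_inert (hR : ResFour V z) {ψ : L →*₀ ℂ} (hψ : IsSq1 ψ) (ht : Triv V ψ 2)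
    (h1 : ψ (-1) = 1) (h3 : ψ (1 + z * 2) = 1) : Triv V ψ 0 := by
  have hz1 : V z = 1 := cube_root_unit hz
  have hl : Lev V 1 (2 : L) := Lev.of_eq h2
  have t1 : Triv V ψ 1 := by
    refine triv_step_inert h2 hR le_rfl ht h1 ?_ h3 ?_
      (w₂ := -1 * (1 + z * 2)) (by rw [map_mul, h1, h3, one_mul]) ?_ hz1
    · simpa [show (-1 : L) - (1 + 2) = -(2 * 2) by norm_num] using (hl.mul hl).neg
    · simpa [mul_comm] using Lev.zero _
    · have e : (-1 * (1 + z * 2)) - (1 + 2 ^ 1 * z ^ 2) = 0 := by linear_combination (-2) * hz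
      rw [e]
      exact Lev.zero _
  intro u hu _
  have hz3 : ψ z = 1 := by
    have a := hψ z (ne_zero_of_unit hz1)
    have b : ψ z ^ 3 = 1 := by rw [← map_pow, cube_root_pow_three hz, map_one]
    rw [pow_succ, a, one_mul] at b
    exact b
  rcases hR u hu.le with h | h | h | h
  · rw [lev_one_iff, hu] at h
    exact absurd h (lt_irrefl _)
  · exact t1 u hu h
  · rw [t1.eq_of_close hu hz1 h, hz3]
  · rw [t1.eq_of_close hu (by rw [map_pow, hz1, one_pow]) h, map_pow, hz3, one_pow]

/-- `(1 + 2z) ^ 2 = -3`, which is `1 + 4` modulo `8`, so the class of `1` is represented by a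
square. The other two classes are represented by `1 + 4z` and its product with this square. -/
theorem triv_two_of_inert (hR : ResFour V z) {ψ : L →*₀ ℂ} (hψ : IsSq1 ψ) (ht : Triv V ψ 3)
    (h3 : ψ (1 + 4 * z) = 1) : Triv V ψ 2 := by
  have hz1 : V z = 1 := cube_root_unit hz
  have hl : Lev V 1 (2 : L) := Lev.of_eq h2
  have hl3 : Lev V 3 (2 * 2 * 2 : L) := (hl.mul hl).mul hl
  have hu : V (1 + 2 * z) = 1 := unit_of_lev (by simpa using hl.mul_right hz1.le)
  have hsq : ψ ((1 + 2 * z) ^ 2) = 1 := by rw [map_pow]; exact hψ _ (ne_zero_of_unit hu)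
  refine triv_step_inert h2 hR (by norm_num) ht hsq ?_ h3 ?_
    (w₂ := (1 + 2 * z) ^ 2 * (1 + 4 * z)) (by rw [map_mul, hsq, h3, one_mul]) ?_ hz1
  · have e : (1 + 2 * z) ^ 2 - (1 + 2 ^ 2) = -(2 * 2 * 2) := by linear_combination 4 * hz
    rw [e]
    exact hl3.neg
  · have e : (1 + 4 * z) - (1 + 2 ^ 2 * z) = 0 := by ring
    rw [e]
    exact Lev.zero _
  · have e : (1 + 2 * z) ^ 2 * (1 + 4 * z) - (1 + 2 ^ 2 * z ^ 2) = 2 * 2 * 2 * (-z) := by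
      linear_combination 16 * z * hz
    rw [e]
    exact hl3.mul_right (by rw [V.map_neg]; exact hz1.le)

end InertTwo

/-- Among two units and their product, one is a square in the residue field. -/
def ResCyclic (V : Valuation L (WithZero (Multiplicative ℤ))) : Prop :=
  ∀ a b, V a = 1 → V b = 1 → ∃ t, V t = 1 ∧
    (Lev V 1 (a - t ^ 2) ∨ Lev V 1 (b - t ^ 2) ∨ Lev V 1 (a * b - t ^ 2))

/-- Both characters factor through the residue field on units. A product of two non-squares there is
a square, so there is only one non-trivial possibility, and `a` and `b` witness that both characters
realise it. -/
theorem eq_of_resCyclic (hR : ResCyclic V) {ψ φ : L →*₀ ℂ} (hψ : IsSq1 ψ) (hφ : IsSq1 φ)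
    (tψ : Triv V ψ 1) (tφ : Triv V φ 1) {a b : L} (ha : V a = 1) (hb : V b = 1) (hψa : ψ a ≠ 1)
    (hφb : φ b ≠ 1) {u : L} (hu : V u = 1) : ψ u = φ u := by
  have sq : ∀ (f : L →*₀ ℂ), IsSq1 f → Triv V f 1 → ∀ x t, V x = 1 → V t = 1 →
      Lev V 1 (x - t ^ 2) → f x = 1 := by
    intro f hf tf x t hx ht hxt
    rw [tf.eq_of_close hx (by rw [map_pow, ht, one_pow]) hxt, map_pow, hf t (ne_zero_of_unit ht)]
  have key : ∀ (f g : L →*₀ ℂ), IsSq1 f → IsSq1 g → Triv V f 1 → Triv V g 1 → ∀ c, V c = 1 →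
      g c ≠ 1 → f u ≠ 1 → g u ≠ 1 := by
    intro f g hf hg tf tg c hc hgc hfu hgu
    obtain ⟨t, ht, h | h | h⟩ := hR u c hu hc
    · exact hfu (sq f hf tf u t hu ht h)
    · exact hgc (sq g hg tg c t hc ht h)
    · have := sq g hg tg (u * c) t (by rw [map_mul, hu, hc, one_mul]) ht h
      rw [map_mul, hgu, one_mul] at this
      exact hgc this
  have hu0 := ne_zero_of_unit hu
  rcases hψ.cases hu0 with h1 | h1 <;> rcases hφ.cases hu0 with h2 | h2
  · rw [h1, h2]
  · exact absurd h1 (key φ ψ hφ hψ tφ tψ a ha hψa (by rw [h2]; norm_num))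
  · exact absurd h2 (key ψ φ hψ hφ tψ tφ b hb hφb (by rw [h1]; norm_num))
  · rw [h1, h2]

end LocalCharacters

end QuadIdele

namespace QuadIdele

/-! ### Components and neighbourhoods of ideles -/

section Ideles

variable {F : Type*} [Field F] [NumberField F]

/-- The component at a finite place. -/
def finComp (v : HeightOneSpectrum (𝓞 F)) : Idele F →* (v.adicCompletion F)ˣ :=
  Units.map
    { toFun := fun a : AdeleRing (𝓞 F) F => a.2 v
      map_one' := rfl
      map_mul' := fun _ _ => rfl }

/-- The component at an infinite place. -/
def infComp (w : InfinitePlace F) : Idele F →* (w.Completion)ˣ :=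
  Units.map
    { toFun := fun a : AdeleRing (𝓞 F) F => a.1 w
      map_one' := rfl
      map_mul' := fun _ _ => rfl }

theorem finComp_val (v : HeightOneSpectrum (𝓞 F)) (x : Idele F) :
    (finComp v x : v.adicCompletion F) = x.val.2 v := rfl

theorem infComp_val (w : InfinitePlace F) (x : Idele F) :
    (infComp w x : w.Completion) = x.val.1 w := rfl

theorem idele_ext {x y : Idele F} (hf : ∀ v, finComp v x = finComp v y)
    (hi : ∀ w, infComp w x = infComp w y) : x = y := by
  apply Units.ext
  apply Prod.ext
  · funext w
    exact congrArg Units.val (hi w)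
  · exact FiniteAdeleRing.ext F fun v => congrArg Units.val (hf v)

theorem infComp_localIdele (v : HeightOneSpectrum (𝓞 F)) (u : (v.adicCompletion F)ˣ)
    (w : InfinitePlace F) : infComp w (localIdele v u) = 1 := rfl

open Classical in
theorem localIdele_val_snd (v : HeightOneSpectrum (𝓞 F)) (u : (v.adicCompletion F)ˣ)
    (w : HeightOneSpectrum (𝓞 F)) :
    (localIdele v u).val.2 w =
      ((Pi.mulSingle (M := fun w : HeightOneSpectrum (𝓞 F) => (w.adicCompletion F)ˣ) v u w :
        (w.adicCompletion F)ˣ) : w.adicCompletion F) := rfl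

theorem finComp_localIdele (v : HeightOneSpectrum (𝓞 F)) (u : (v.adicCompletion F)ˣ) :
    finComp v (localIdele v u) = u := by
  classical
  apply Units.ext
  rw [finComp_val, localIdele_val_snd, Pi.mulSingle_eq_same]

theorem finComp_localIdele_ne {v w : HeightOneSpectrum (𝓞 F)} (h : w ≠ v)
    (u : (v.adicCompletion F)ˣ) : finComp w (localIdele v u) = 1 := by
  classical
  apply Units.ext
  rw [finComp_val, localIdele_val_snd, Pi.mulSingle_eq_of_ne h]

theorem finComp_principal (v : HeightOneSpectrum (𝓞 F)) (k : Fˣ) :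
    (finComp v (principalIdele F k) : v.adicCompletion F) = ((k : F) : v.adicCompletion F) := rfl

theorem infComp_principal (w : InfinitePlace F) (k : Fˣ) :
    (infComp w (principalIdele F k) : w.Completion) = ((k : F) : w.Completion) := rfl

theorem eventually_unit (x : Idele F) :
    ∀ᶠ v in Filter.cofinite, Valued.v (x.val.2 v) = 1 := by
  have hu : IsUnit x.val.2 := by
    refine ⟨⟨x.val.2, x.inv.2, ?_, ?_⟩, rfl⟩
    · exact congrArg Prod.snd x.val_inv
    · exact congrArg Prod.snd x.inv_val
  exact (FiniteAdeleRing.isUnit_iff.1 hu).2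

/-- An idele with prescribed components. -/
theorem exists_idele (a : ∀ w : InfinitePlace F, w.Completion)
    (b : ∀ v : HeightOneSpectrum (𝓞 F), v.adicCompletion F) (ha : ∀ w, a w ≠ 0)
    (hb : ∀ v, b v ≠ 0) (hb' : ∀ᶠ v in Filter.cofinite, Valued.v (b v) = 1) :
    ∃ x : Idele F, (∀ w, x.val.1 w = a w) ∧ ∀ v, x.val.2 v = b v := by
  have h1 : ∀ᶠ v in Filter.cofinite, b v ∈ v.adicCompletionIntegers F := by
    filter_upwards [hb'] with v hv
    exact (mem_adicCompletionIntegers _ _ _).2 hv.le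
  have h2 : ∀ᶠ v in Filter.cofinite, (b v)⁻¹ ∈ v.adicCompletionIntegers F := by
    filter_upwards [hb'] with v hv
    rw [mem_adicCompletionIntegers, map_inv₀, hv, inv_one]
  refine ⟨⟨(a, ⟨b, h1⟩), (fun w => (a w)⁻¹, ⟨fun v => (b v)⁻¹, h2⟩), ?_, ?_⟩, fun _ => rfl,
    fun _ => rfl⟩
  · refine Prod.ext (funext fun w => mul_inv_cancel₀ (ha w)) ?_
    exact FiniteAdeleRing.ext F fun v => mul_inv_cancel₀ (hb v)
  · refine Prod.ext (funext fun w => inv_mul_cancel₀ (ha w)) ?_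
    exact FiniteAdeleRing.ext F fun v => inv_mul_cancel₀ (hb v)

/-- The ideles which are units at all finite places. -/
def unitIdeles (F : Type*) [Field F] [NumberField F] : Subgroup (Idele F) where
  carrier := {x | ∀ v, Valued.v (x.val.2 v) = 1}
  mul_mem' := fun {x y} hx hy v => by
    change Valued.v (x.val.2 v * y.val.2 v) = 1
    rw [map_mul, hx v, hy v, one_mul]
  one_mem' := fun v => map_one _
  inv_mem' := fun {x} hx v => by
    have : x.val.2 v * x⁻¹.val.2 v = 1 := congrArg Units.val (by
      rw [← map_mul, mul_inv_cancel, map_one] : finComp v x * finComp v x⁻¹ = 1)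
    have h := congrArg Valued.v this
    rwa [map_mul, hx v, one_mul, map_one] at h

/-- A basic neighbourhood of `1`. -/
def idealBox (T : Finset (HeightOneSpectrum (𝓞 F))) (n : ℕ) : Set (Idele F) :=
  {x | x ∈ unitIdeles F ∧ (∀ v ∈ T, Lev Valued.v n (x.val.2 v - 1)) ∧
    ∀ w, IsSquare (x.val.1 w)}

omit [NumberField F] in
theorem isSquare_of_norm_sub_one_lt {w : InfinitePlace F} {y : w.Completion}
    (hy : ‖y - 1‖ < 1) : IsSquare y := by
  rcases w.isReal_or_isComplex with hw | hw
  · set e := InfinitePlace.Completion.ringEquivRealOfIsReal hw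
    have hn : |e y - 1| < 1 := by
      have := (InfinitePlace.Completion.isometry_extensionEmbeddingOfIsReal hw).dist_eq y 1
      rw [map_one, dist_eq_norm, dist_eq_norm] at this
      rw [← Real.norm_eq_abs]
      exact this.trans_lt hy
    have hpos : 0 < e y := by linarith [(abs_lt.1 hn).1]
    have h : IsSquare (e.symm (e y)) := by
      refine ⟨e.symm (Real.sqrt (e y)), ?_⟩
      rw [← map_mul, Real.mul_self_sqrt hpos.le]
    rwa [e.symm_apply_apply] at h
  · set e := InfinitePlace.Completion.ringEquivComplexOfIsComplex hw
    have h : IsSquare (e.symm (e y)) := by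
      obtain ⟨r, hr⟩ := IsAlgClosed.exists_pow_nat_eq (e y) (n := 2) (by norm_num)
      exact ⟨e.symm r, by rw [← map_mul, ← hr, sq]⟩
    rwa [e.symm_apply_apply] at h

theorem isOpen_lev_sub (v : HeightOneSpectrum (𝓞 F)) (n : ℕ) (a : v.adicCompletion F) :
    IsOpen {y : v.adicCompletion F | Lev Valued.v n (y - a)} := by
  obtain ⟨b, hb⟩ := valuedAdicCompletion_surjective F v (WithZero.exp (-(n : ℤ)))
  have hb0 : Valued.v.restrict b ≠ 0 := by
    rw [← map_zero Valued.v.restrict, ne_eq, Valuation.restrict_inj, map_zero, hb]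
    exact WithZero.exp_ne_zero
  have h : {y : v.adicCompletion F | Lev Valued.v n y} = {y | Valued.v.restrict y ≤
      Valued.v.restrict b} := by
    ext y
    rw [Set.mem_ofPred, Set.mem_ofPred, Valuation.restrict_le_iff, hb, Lev]
  have h' : IsOpen {y : v.adicCompletion F | Lev Valued.v n y} := by
    rw [h]
    exact Valued.isOpen_closedBall _ hb0
  exact h'.preimage (continuous_id.sub continuous_const)

theorem exists_lev_of_mem_nhds {v : HeightOneSpectrum (𝓞 F)} {a : v.adicCompletion F}
    {s : Set (v.adicCompletion F)} (hs : s ∈ nhds a) :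
    ∃ n : ℕ, ∀ y, Lev Valued.v n (y - a) → y ∈ s := by
  obtain ⟨γ, hγ⟩ := Valued.mem_nhds.1 hs
  simp_rw [Valuation.restrict_lt_iff_lt_embedding] at hγ
  set δ := MonoidWithZeroHom.ValueGroup₀.embedding (γ : MonoidWithZeroHom.ValueGroup₀
    (.ofClass (Valued.v : Valuation (v.adicCompletion F) _))) with hδ
  have hδ0 : δ ≠ 0 := by
    rw [hδ, map_ne_zero]
    exact γ.ne_zero
  obtain ⟨n, hn⟩ : ∃ n : ℕ, WithZero.exp (-(n : ℤ)) < δ := by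
    refine ⟨(1 - WithZero.log δ).toNat, ?_⟩
    conv_rhs => rw [← WithZero.exp_log hδ0]
    rw [WithZero.exp_lt_exp]
    omega
  exact ⟨n, fun y hy => hγ (lt_of_le_of_lt hy hn)⟩

theorem continuous_finEval (v : HeightOneSpectrum (𝓞 F)) :
    Continuous fun a : AdeleRing (𝓞 F) F => a.2 v :=
  (RestrictedProduct.continuous_eval v).comp continuous_snd

theorem continuous_infEval (w : InfinitePlace F) :
    Continuous fun a : AdeleRing (𝓞 F) F => a.1 w :=
  (continuous_apply w).comp continuous_fst

theorem idealBox_mem_nhds (T : Finset (HeightOneSpectrum (𝓞 F))) (n : ℕ) :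
    idealBox T n ∈ nhds (1 : Idele F) := by
  set S : Set (AdeleRing (𝓞 F) F) := {a | (∀ v, a.2 v ∈ v.adicCompletionIntegers F) ∧
    (∀ v ∈ T, Lev Valued.v n (a.2 v - 1)) ∧ ∀ w, ‖a.1 w - 1‖ < 1} with hS
  have hopen : IsOpen S := by
    refine IsOpen.inter ?_ (IsOpen.inter ?_ ?_)
    · have : IsOpen {f : FiniteAdeleRing (𝓞 F) F | ∀ v, f.1 v ∈ v.adicCompletionIntegers F} :=
        RestrictedProduct.isOpen_forall_mem fun v => Valued.isOpen_valuationSubring _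
      exact this.preimage continuous_snd
    · have : {a : AdeleRing (𝓞 F) F | ∀ v ∈ T, Lev Valued.v n (a.2 v - 1)} =
          ⋂ v ∈ T, {a | Lev Valued.v n (a.2 v - 1)} := by ext; simp
      change IsOpen {a : AdeleRing (𝓞 F) F | ∀ v ∈ T, Lev Valued.v n (a.2 v - 1)}
      rw [this]
      exact isOpen_biInter_finset fun v _ => (isOpen_lev_sub v n 1).preimage (continuous_finEval v)
    · have : {a : AdeleRing (𝓞 F) F | ∀ w, ‖a.1 w - 1‖ < 1} =
          ⋂ w, {a | ‖a.1 w - 1‖ < 1} := by ext; simp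
      change IsOpen {a : AdeleRing (𝓞 F) F | ∀ w, ‖a.1 w - 1‖ < 1}
      rw [this]
      exact isOpen_iInter_of_finite fun w => isOpen_lt
        (((continuous_infEval w).sub continuous_const).norm) continuous_const
  have h1 : (1 : AdeleRing (𝓞 F) F) ∈ S := by
    refine ⟨fun v => one_mem _, fun v _ => ?_, fun w => ?_⟩
    · change Lev Valued.v n ((1 : v.adicCompletion F) - 1)
      rw [sub_self]
      exact Lev.zero n
    · change ‖(1 : w.Completion) - 1‖ < 1
      simp
  have hv : ∀ᶠ x : Idele F in nhds 1, x.val ∈ S :=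
    Units.continuous_val.continuousAt.eventually (hopen.mem_nhds h1)
  -- Integrality of both `x` and `x⁻¹` is what forces the components to be units.
  have hi : ∀ᶠ x : Idele F in nhds 1, x⁻¹.val ∈ S := by
    refine (Units.continuous_val.comp continuous_inv).continuousAt.eventually
      (hopen.mem_nhds ?_)
    simpa using h1
  filter_upwards [hv, hi] with x hx hx'
  refine ⟨fun v => ?_, hx.2.1, fun w => isSquare_of_norm_sub_one_lt (hx.2.2 w)⟩
  have e : x.val.2 v * x⁻¹.val.2 v = 1 := congrArg Units.val (by
      rw [← map_mul, mul_inv_cancel, map_one] : finComp v x * finComp v x⁻¹ = 1)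
  have h := congrArg Valued.v e
  rw [map_mul, map_one] at h
  have a1 := (mem_adicCompletionIntegers _ _ _).1 (hx.1 v)
  have a2 := (mem_adicCompletionIntegers _ _ _).1 (hx'.1 v)
  refine le_antisymm a1 ?_
  calc 1 = _ := h.symm
    _ ≤ _ := mul_le_of_le_one_right' a2

theorem continuous_of_trivial_on_box (χ : Idele F →* Circle)
    (T : Finset (HeightOneSpectrum (𝓞 F))) (n : ℕ) (h : ∀ x ∈ idealBox T n, χ x = 1) :
    Continuous χ := by
  refine continuous_of_continuousAt_one χ ?_
  rw [ContinuousAt, map_one]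
  refine tendsto_const_nhds.congr' ?_
  filter_upwards [idealBox_mem_nhds T n] with x hx
  exact (h x hx).symm

/-- The `m`-th roots of unity are finite in number, so those other than `1` form a closed set that
can be avoided near the identity. -/
theorem eventually_eq_one_of_pow {m : ℕ} (hm : 0 < m) (χ : Idele F →ₜ* Circle)
    (hχ : ∀ x, χ x ^ m = 1) : ∀ᶠ x in nhds 1, χ x = 1 := by
  have hfin : {z : Circle | z ^ m = 1 ∧ z ≠ 1}.Finite := by
    have : {z : ℂ | z ^ m = 1}.Finite := by
      refine ((Polynomial.nthRootsFinset m (1 : ℂ)).finite_toSet).subset ?_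
      intro z hz
      exact (Polynomial.mem_nthRootsFinset hm _).2 hz
    refine (this.preimage (f := ((↑) : Circle → ℂ)) Circle.coe_injective.injOn).subset ?_
    intro z hz
    exact (Circle.coe_pow z m).symm.trans ((congrArg _ hz.1).trans Circle.coe_one)
  have h := hfin.isClosed.isOpen_compl.mem_nhds (x := (1 : Circle)) (by simp)
  have hc : Filter.Tendsto χ (nhds 1) (nhds 1) := by
    have := χ.continuous_toFun.tendsto 1
    rwa [show χ.toFun 1 = 1 from map_one χ] at this
  filter_upwards [hc.eventually h] with x hx
  by_contra hne
  exact hx ⟨hχ x, hne⟩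

/-- A character of finite order is trivial on the unit ideles which are `1` at infinity and
sufficiently close to `1` at finitely many places. -/
theorem exists_trivial_box {m : ℕ} (hm : 0 < m) (χ : Idele F →ₜ* Circle)
    (hχ : ∀ x, χ x ^ m = 1) : ∃ (T : Finset (HeightOneSpectrum (𝓞 F))) (n : ℕ),
      ∀ x ∈ unitIdeles F, (∀ w, x.val.1 w = 1) → (∀ v ∈ T, Lev Valued.v n (x.val.2 v - 1)) →
        χ x = 1 := by
  have h := eventually_eq_one_of_pow hm χ hχ
  -- The idele topology is induced by `x ↦ (x, x⁻¹)`, so a neighbourhood of `1` is controlled by a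
  -- neighbourhood `A` for `x` and a neighbourhood `B` for `x⁻¹`.
  rw [Units.isEmbedding_embedProduct.nhds_eq_comap, Filter.eventually_comap, map_one,
    show (1 : AdeleRing (𝓞 F) F × (AdeleRing (𝓞 F) F)ᵐᵒᵖ) = (1, 1) from rfl, nhds_prod_eq] at h
  obtain ⟨A, hA, B, hB, hAB⟩ := Filter.mem_prod_iff.1 h
  have hB' : MulOpposite.op ⁻¹' B ∈ nhds (1 : AdeleRing (𝓞 F) F) :=
    MulOpposite.continuous_op.continuousAt hB
  set g : (∀ v : HeightOneSpectrum (𝓞 F), v.adicCompletionIntegers F) → AdeleRing (𝓞 F) F :=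
    fun y => ((1 : InfiniteAdeleRing F), RestrictedProduct.structureMap
      (fun v : HeightOneSpectrum (𝓞 F) => v.adicCompletion F)
      (fun v => (v.adicCompletionIntegers F : Set (v.adicCompletion F))) Filter.cofinite y)
  have hg : Continuous g :=
    continuous_const.prodMk (RestrictedProduct.isEmbedding_structureMap.continuous)
  have hg1 : g 1 = 1 := rfl
  have hnb : g ⁻¹' (A ∩ MulOpposite.op ⁻¹' B) ∈ nhds 1 := by
    refine hg.continuousAt ?_
    rw [hg1]
    exact Filter.inter_mem hA hB'
  rw [nhds_pi, Filter.mem_pi] at hnb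
  obtain ⟨I, hI, t, ht, hsub⟩ := hnb
  have hn : ∀ v : HeightOneSpectrum (𝓞 F), ∃ n : ℕ, ∀ y : v.adicCompletionIntegers F,
      Lev Valued.v n ((y : v.adicCompletion F) - 1) → y ∈ t v := by
    intro v
    obtain ⟨s, hs, hst⟩ := mem_nhds_induced _ _ _ |>.1 (ht v)
    obtain ⟨n, hn⟩ := exists_lev_of_mem_nhds hs
    exact ⟨n, fun y hy => hst (hn y hy)⟩
  choose n hn using hn
  refine ⟨hI.toFinset, hI.toFinset.sup n, fun x hx hx1 hxT => ?_⟩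
  have hmem : ∀ z : Idele F, z ∈ unitIdeles F → (∀ w, z.val.1 w = 1) →
      (∀ v ∈ hI.toFinset, Lev Valued.v (hI.toFinset.sup n) (z.val.2 v - 1)) →
      z.val ∈ A ∩ MulOpposite.op ⁻¹' B := by
    intro z hz hz1 hzT
    set y : ∀ v : HeightOneSpectrum (𝓞 F), v.adicCompletionIntegers F :=
      fun v => ⟨z.val.2 v, (mem_adicCompletionIntegers _ _ _).2 (hz v).le⟩
    have hgy : g y = z.val := Prod.ext (funext fun w => (hz1 w).symm) rfl
    rw [← hgy]
    refine hsub fun v hv => hn v _ ?_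
    have hv' : v ∈ hI.toFinset := hI.mem_toFinset.2 hv
    exact (hzT v hv').mono (Finset.le_sup hv')
  have h1 := hmem x hx hx1 hxT
  have h2 := hmem x⁻¹ (inv_mem hx) (fun w => ?_) (fun v hv => ?_)
  · exact hAB (show (x.val, MulOpposite.op x⁻¹.val) ∈ A ×ˢ B from ⟨h1.1, h2.2⟩) x rfl
  · have e : infComp w x = 1 := Units.ext (hx1 w)
    have e' : infComp w x⁻¹ = 1 := by rw [map_inv, e, inv_one]
    exact congrArg Units.val e'
  · have e : ((x⁻¹).val.2 v) = (x.val.2 v)⁻¹ := by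
      rw [← finComp_val, ← finComp_val, map_inv, Units.val_inv_eq_inv_val]
    have h0 : x.val.2 v ≠ 0 := ne_zero_of_unit (hx v)
    rw [e, Lev, ← one_div, div_sub_one h0, map_div₀, hx v, div_one, Valuation.map_sub_swap]
    exact hxT v hv

end Ideles

end QuadIdele

namespace QuadIdele

/-! ### Characters of abelian groups -/

/-- The embedding of `ℚ / ℤ` into the unit circle. -/
def ratCircle : Multiplicative (AddCircle (1 : ℚ)) →* Circle :=
  AddMonoidHom.toMultiplicativeLeft <|
    (QuotientAddGroup.lift (AddSubgroup.zmultiples (1 : ℚ))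
      ({ toFun := fun q : ℚ => Additive.ofMul (AddCircle.toCircle ((q : ℝ) : AddCircle (1 : ℝ)))
         map_zero' := by simp
         map_add' := fun a b => by
          rw [Rat.cast_add, AddCircle.coe_add, AddCircle.toCircle_add, ofMul_mul] } :
        ℚ →+ Additive Circle)
      (fun q hq => by
        obtain ⟨n, rfl⟩ := AddSubgroup.mem_zmultiples_iff.1 hq
        have h : (((n • (1 : ℚ) : ℚ) : ℝ) : AddCircle (1 : ℝ)) = 0 :=
          (AddCircle.coe_eq_zero_iff _).2 ⟨n, by simp⟩
        change Additive.ofMul (AddCircle.toCircle (((n • (1 : ℚ) : ℚ) : ℝ) : AddCircle (1 : ℝ))) = 0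
        rw [h, AddCircle.toCircle_zero, ofMul_one]))

theorem ratCircle_injective : Function.Injective ratCircle := by
  rw [injective_iff_map_eq_one]
  intro x hx
  obtain ⟨q, hq⟩ := QuotientAddGroup.mk_surjective (Multiplicative.toAdd x)
  have hx' : x = Multiplicative.ofAdd ((q : ℚ) : AddCircle (1 : ℚ)) := by
    rw [show ((q : ℚ) : AddCircle (1 : ℚ)) = Multiplicative.toAdd x from hq, ofAdd_toAdd]
  rw [hx'] at hx ⊢
  have h1 : AddCircle.toCircle ((q : ℝ) : AddCircle (1 : ℝ)) = 1 := hx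
  have h2 : ((q : ℝ) : AddCircle (1 : ℝ)) = 0 :=
    AddCircle.injective_toCircle one_ne_zero (by rw [h1, AddCircle.toCircle_zero])
  obtain ⟨n, hn⟩ := (AddCircle.coe_eq_zero_iff _).1 h2
  have h3 : ((q : ℚ) : AddCircle (1 : ℚ)) = 0 :=
    (AddCircle.coe_eq_zero_iff _).2 ⟨n, by
      have : ((n • (1 : ℚ) : ℚ) : ℝ) = q := by rw [← hn]; simp
      exact_mod_cast this⟩
  rw [h3, ofAdd_zero]

/-- Characters of an abelian group separate the points of a quotient. -/
theorem exists_character {G : Type*} [CommGroup G] (H : Subgroup G) {a : G} (ha : a ∉ H) :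
    ∃ φ : G →* Circle, (∀ x ∈ H, φ x = 1) ∧ φ a ≠ 1 := by
  have h0 : Additive.ofMul (a : G ⧸ H) ≠ 0 := by
    rw [Ne, ofMul_eq_zero, QuotientGroup.eq_one_iff]
    exact ha
  -- Characters with values in the injective group `ℚ / ℤ` separate points; `ratCircle` moves them
  -- into the circle.
  obtain ⟨c, hc⟩ := CharacterModule.exists_character_apply_ne_zero_of_ne_zero h0
  refine ⟨(ratCircle.comp (AddMonoidHom.toMultiplicativeRight c)).comp (QuotientGroup.mk' H),
    fun x hx => ?_, fun h => hc ?_⟩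
  · have : (QuotientGroup.mk' H) x = 1 := (QuotientGroup.eq_one_iff x).2 hx
    rw [MonoidHom.comp_apply, this, map_one]
  · rw [MonoidHom.comp_apply, MonoidHom.comp_apply] at h
    have := ratCircle_injective (h.trans (map_one ratCircle).symm)
    exact Multiplicative.ofAdd.injective this

/-- A character of a subgroup `U` which is trivial on `P ∩ U` extends, up to an `h`-th power, to a
character trivial on `P` when `P U` contains all `h`-th powers. -/
theorem exists_extension {G M : Type*} [CommGroup G] [CommGroup M] (P U : Subgroup G) (h : ℕ)
    (hPU : ∀ x : G, ∃ p ∈ P, ∃ u ∈ U, x ^ h = p * u) (ψ : G →* M)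
    (hψ : ∀ x ∈ P, x ∈ U → ψ x = 1) :
    ∃ χ : G →* M, (∀ x ∈ P, χ x = 1) ∧ (∀ u ∈ U, χ u = ψ u ^ h) ∧
      ∀ x, ∃ u ∈ U, χ x = ψ u := by
  choose p hp u hu hx using hPU
  -- The extension sends `x` to `ψ (u x)`, where `x ^ h = p x * u x`. The factor `u x` is determined
  -- only up to `P ∩ U`, where `ψ` is trivial; this gives both well-definedness and
  -- multiplicativity.
  have key : ∀ x q w, q ∈ P → w ∈ U → x ^ h = q * w → ψ (u x) = ψ w := by
    intro x q w hq hw hqw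
    have e : u x * w⁻¹ = q * (p x)⁻¹ := by
      have := (hx x).symm.trans hqw
      rw [mul_inv_eq_iff_eq_mul, mul_right_comm, ← this, mul_comm (p x), mul_inv_cancel_right]
    have h1 : ψ (u x * w⁻¹) = 1 :=
      hψ _ (by rw [e]; exact P.mul_mem hq (P.inv_mem (hp x))) (U.mul_mem (hu x) (U.inv_mem hw))
    rwa [map_mul, map_inv, mul_inv_eq_one] at h1
  refine ⟨{ toFun := fun x => ψ (u x), map_one' := ?_, map_mul' := fun x y => ?_ }, fun x hxP => ?_,
    fun w hw => ?_, fun x => ⟨u x, hu x, rfl⟩⟩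
  · rw [key 1 1 1 P.one_mem U.one_mem (by simp), map_one]
  · rw [key (x * y) (p x * p y) (u x * u y) (P.mul_mem (hp x) (hp y)) (U.mul_mem (hu x) (hu y))
      (by rw [mul_pow, hx, hx, mul_mul_mul_comm]), map_mul]
  · exact (key x (x ^ h) 1 (P.pow_mem hxP h) U.one_mem (by simp)).trans (map_one ψ)
  · exact (key w 1 (w ^ h) P.one_mem (U.pow_mem hw h) (by simp)).trans (map_pow ψ w h)

/-! ### Ideals with prescribed exponents -/

section Exponents

variable {R : Type*} [CommRing R] [IsDedekindDomain R]

theorem emultiplicity_asIdeal_of_ne {v w : HeightOneSpectrum R} (h : v ≠ w) :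
    emultiplicity v.asIdeal w.asIdeal = 0 := by
  rw [emultiplicity_eq_zero]
  intro hd
  have hle : w.asIdeal ≤ v.asIdeal := Ideal.dvd_iff_le.1 hd
  exact h (HeightOneSpectrum.ext (w.isMaximal.eq_of_le v.isPrime.ne_top hle)).symm

theorem finprod_pow_ne_bot (e : HeightOneSpectrum R → ℕ) :
    ∏ᶠ v : HeightOneSpectrum R, v.asIdeal ^ e v ≠ ⊥ :=
  finprod_induction (p := fun I : Ideal R => I ≠ ⊥) one_ne_zero (fun _ _ h h' => mul_ne_zero h h')
    fun v => pow_ne_zero _ v.ne_bot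

theorem multiplicity_finprod_pow (e : HeightOneSpectrum R → ℕ) (he : e.support.Finite)
    (v : HeightOneSpectrum R) :
    multiplicity v.asIdeal (∏ᶠ w : HeightOneSpectrum R, w.asIdeal ^ e w) = e v := by
  classical
  have hs : (Function.mulSupport fun w : HeightOneSpectrum R => w.asIdeal ^ e w) ⊆
      ((he.toFinset ∪ {v} : Finset _) : Set (HeightOneSpectrum R)) := by
    intro w hw
    rw [Function.mem_mulSupport] at hw
    have : e w ≠ 0 := fun h => hw (by rw [h, pow_zero])
    simp [this]
  rw [finprod_eq_prod_of_mulSupport_subset _ hs]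
  apply multiplicity_eq_of_emultiplicity_eq_some
  rw [Finset.emultiplicity_prod v.prime, Finset.sum_eq_single v]
  · rw [emultiplicity_pow v.prime]
    have : emultiplicity v.asIdeal v.asIdeal = 1 :=
      (FiniteMultiplicity.of_prime_left v.prime v.ne_bot).emultiplicity_self
    rw [this, mul_one]
  · intro w _ hw
    rw [emultiplicity_pow v.prime, emultiplicity_asIdeal_of_ne hw.symm, mul_zero]
  · intro h
    simp at h

end Exponents

/-! ### Existence of idele class characters -/

section Existence

variable {F : Type*} [Field F] [NumberField F]

/-- The `h`-th power of any ideal is principal, `h` being the class number, and a generator has the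
required valuations. -/
theorem exists_generator_pow_classNumber (e : HeightOneSpectrum (𝓞 F) → ℕ)
    (he : e.support.Finite) : ∃ b : 𝓞 F, b ≠ 0 ∧ ∀ v : HeightOneSpectrum (𝓞 F),
      v.valuation F (b : F) = WithZero.exp (-((classNumber F * e v : ℕ) : ℤ)) := by
  have hf : (fun v => classNumber F * e v).support.Finite :=
    he.subset fun v hv => by
      simp only [Function.mem_support, ne_eq, mul_eq_zero, not_or] at hv ⊢
      exact hv.2
  set I := ∏ᶠ v : HeightOneSpectrum (𝓞 F), v.asIdeal ^ e v with hI
  have hI0 : I ≠ ⊥ := finprod_pow_ne_bot e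
  have hpow : I ^ classNumber F = ∏ᶠ v : HeightOneSpectrum (𝓞 F),
      v.asIdeal ^ (classNumber F * e v) := by
    rw [hI, finprod_pow]
    · exact finprod_congr fun v => by rw [← pow_mul, mul_comm]
    · refine he.subset fun v hv => ?_
      rw [Function.mem_mulSupport] at hv
      exact fun h => hv (by rw [h, pow_zero])
  have hprin : (I ^ classNumber F).IsPrincipal := by
    have h1 : ClassGroup.mk0 ⟨I, mem_nonZeroDivisors_of_ne_zero hI0⟩ ^ classNumber F = 1 :=
      pow_card_eq_one
    rw [← map_pow, ClassGroup.mk0_eq_one_iff] at h1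
    exact h1
  obtain ⟨b, hb⟩ := hprin
  have hb' : I ^ classNumber F = Ideal.span {b} := hb
  have hb0 : b ≠ 0 := by
    rintro rfl
    rw [Set.singleton_zero, Ideal.span_zero] at hb'
    exact pow_ne_zero _ hI0 hb'
  refine ⟨b, hb0, fun v => ?_⟩
  rw [show (b : F) = algebraMap (𝓞 F) F b from rfl, valuation_of_algebraMap,
    intValuation_eq_exp_neg_multiplicity v hb0, ← hb', hpow, multiplicity_finprod_pow _ hf]

theorem exists_pow_eq_principal_mul_unit (x : Idele F) :
    ∃ k : Fˣ, ∃ u ∈ unitIdeles F, x ^ classNumber F = principalIdele F k * u := by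
  set ℓ : HeightOneSpectrum (𝓞 F) → ℤ := fun v => WithZero.log (Valued.v (x.val.2 v)) with hℓ
  have hfin : {v | ℓ v ≠ 0}.Finite := by
    have := eventually_unit x
    rw [Filter.eventually_cofinite] at this
    refine this.subset fun v hv h => hv ?_
    simp [hℓ, h]
  -- The order of `x` at `v` is `-ℓ v`. Its positive part is carried by the numerator `a` and its
  -- negative part by the denominator `b`, since the generators come from integral ideals.
  obtain ⟨a, ha0, ha⟩ := exists_generator_pow_classNumber (fun v => (-ℓ v).toNat)
    (hfin.subset fun v hv h => hv (by simp [h]))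
  obtain ⟨b, hb0, hb⟩ := exists_generator_pow_classNumber (fun v => (ℓ v).toNat)
    (hfin.subset fun v hv h => hv (by simp [h]))
  have ha1 : (a : F) ≠ 0 := by exact_mod_cast ha0
  have hb1 : (b : F) ≠ 0 := by exact_mod_cast hb0
  set k : Fˣ := Units.mk0 (a / b : F) (div_ne_zero ha1 hb1) with hk
  refine ⟨k, (principalIdele F k)⁻¹ * x ^ classNumber F, fun v => ?_, by
    rw [mul_inv_cancel_left]⟩
  have e : ((principalIdele F k)⁻¹ * x ^ classNumber F).val.2 v =
      ((a / b : F) : v.adicCompletion F)⁻¹ * (x.val.2 v) ^ classNumber F := by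
    rw [← finComp_val, map_mul, map_inv, map_pow, Units.val_mul, Units.val_inv_eq_inv_val,
      Units.val_pow_eq_pow_val, finComp_principal, finComp_val, hk, Units.val_mk0]
  have hx0 : Valued.v (x.val.2 v) ≠ 0 := by
    rw [Valuation.ne_zero_iff]
    exact (finComp v x).ne_zero
  rw [e, map_mul, map_inv₀, map_pow, valuedAdicCompletion_eq_valuation', map_div₀, ha, hb,
    ← WithZero.exp_log hx0, ← WithZero.exp_nsmul, ← WithZero.exp_sub, ← WithZero.exp_neg,
    ← WithZero.exp_add, ← WithZero.exp_zero, WithZero.exp_inj]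
  change -(-((classNumber F * (-ℓ v).toNat : ℕ) : ℤ) - -((classNumber F * (ℓ v).toNat : ℕ) : ℤ)) +
    classNumber F • ℓ v = 0
  have h3 : ((-ℓ v).toNat : ℤ) - ((ℓ v).toNat : ℤ) = -ℓ v := by omega
  push_cast
  rw [nsmul_eq_mul]
  linear_combination (classNumber F : ℤ) * h3

/-- A unit of the ring of integers as a principal idele. -/
def globalUnit : (𝓞 F)ˣ →* Idele F :=
  (principalIdele F).comp (Units.map (algebraMap (𝓞 F) F).toMonoidHom)

theorem globalUnit_mem (η : (𝓞 F)ˣ) : globalUnit η ∈ unitIdeles F := by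
  intro v
  change Valued.v (((algebraMap (𝓞 F) F η : F)) : v.adicCompletion F) = 1
  rw [valuedAdicCompletion_eq_valuation', valuation_of_algebraMap, intValuation_eq_one_iff]
  exact fun h => v.isPrime.ne_top (Ideal.eq_top_of_isUnit_mem _ h η.isUnit)

theorem exists_globalUnit {k : Fˣ} (hk : principalIdele F k ∈ unitIdeles F) :
    ∃ η : (𝓞 F)ˣ, principalIdele F k = globalUnit η := by
  have hv : ∀ v : HeightOneSpectrum (𝓞 F), v.valuation F (k : F) = 1 := fun v => by
    rw [← valuedAdicCompletion_eq_valuation']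
    exact hk v
  obtain ⟨a, ha⟩ := mem_integers_of_valuation_le_one F (k : F) fun v => (hv v).le
  obtain ⟨b, hb⟩ := mem_integers_of_valuation_le_one F ((k : F)⁻¹) fun v => by
    rw [map_inv₀, hv v, inv_one]
  have hab : a * b = 1 := by
    apply FaithfulSMul.algebraMap_injective (𝓞 F) F
    rw [map_mul, ha, hb, map_one, mul_inv_cancel₀ k.ne_zero]
  refine ⟨⟨a, b, hab, by rw [mul_comm, hab]⟩, ?_⟩
  change _ = principalIdele F _
  congr 1
  exact Units.ext ha.symm

/-- Existence of an idele class character ramified at a single finite place. -/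
theorem exists_ideleClassCharacter (v : HeightOneSpectrum (𝓞 F))
    (ψ : (v.adicCompletion F)ˣ →* Circle) (n : ℕ)
    (hn : ∀ u : (v.adicCompletion F)ˣ, Valued.v (u : v.adicCompletion F) = 1 →
      Lev Valued.v n ((u : v.adicCompletion F) - 1) → ψ u = 1)
    (φ : ∀ w : InfinitePlace F, (w.Completion)ˣ →* Circle)
    (hφ : ∀ w (y : (w.Completion)ˣ), IsSquare (y : w.Completion) → φ w y = 1)
    (hglob : ∀ η : (𝓞 F)ˣ, ψ (finComp v (globalUnit η)) *
      ∏ w, φ w (infComp w (globalUnit η)) = 1)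
    (m : ℕ) (hψm : ∀ u, ψ u ^ m = 1) (hφm : ∀ w y, φ w y ^ m = 1)
    (hm : classNumber F ≡ 1 [MOD m]) :
    ∃ χ ∈ IdeleClassCharacter F, (∀ x, χ x ^ m = 1) ∧ ∀ x ∈ unitIdeles F,
      χ x = ψ (finComp v x) * ∏ w, φ w (infComp w x) := by
  set Ψ : Idele F →* Circle :=
    { toFun := fun x => ψ (finComp v x) * ∏ w, φ w (infComp w x)
      map_one' := by simp
      map_mul' := fun x y => by
        simp only [map_mul, Finset.prod_mul_distrib]
        exact mul_mul_mul_comm _ _ _ _ } with hΨ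
  have hΨm : ∀ x, Ψ x ^ m = 1 := fun x => by
    change (ψ (finComp v x) * ∏ w, φ w (infComp w x)) ^ m = 1
    rw [mul_pow, hψm, one_mul, ← Finset.prod_pow]
    exact Finset.prod_eq_one fun w _ => hφm w _
  -- Principal ideles that are units everywhere are global units, and on those `Ψ` is trivial by
  -- `hglob`.
  obtain ⟨χ, h1, h2, h3⟩ := exists_extension (principalIdele F).range (unitIdeles F)
    (classNumber F) (fun x => by
      obtain ⟨k, u, hu, hx⟩ := exists_pow_eq_principal_mul_unit x
      exact ⟨_, ⟨k, rfl⟩, u, hu, hx⟩) Ψ (fun x hx hxU => by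
      obtain ⟨k, rfl⟩ := hx
      obtain ⟨η, hη⟩ := exists_globalUnit hxU
      rw [hη]
      exact hglob η)
  have h4 : ∀ x ∈ unitIdeles F, χ x = Ψ x := by
    intro x hx
    -- The `h`-th power introduced by the extension is harmless: `Ψ` has exponent `m` and `h ≡ 1`
    -- modulo `m`.
    have e : Ψ x ^ classNumber F = Ψ x ^ 1 := pow_eq_pow_of_modEq hm (hΨm x)
    rw [h2 x hx, e, pow_one]
  have hcont : Continuous χ := by
    refine continuous_of_trivial_on_box χ {v} n fun x hx => ?_
    rw [h4 x hx.1]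
    change ψ (finComp v x) * ∏ w, φ w (infComp w x) = 1
    rw [hn (finComp v x) (hx.1 v) (hx.2.1 v (Finset.mem_singleton_self v)), one_mul]
    exact Finset.prod_eq_one fun w _ => hφ w _ (hx.2.2 w)
  refine ⟨⟨χ, hcont⟩, fun k => h1 _ ⟨k, rfl⟩, fun x => ?_, h4⟩
  obtain ⟨u, hu, hxu⟩ := h3 x
  change χ x ^ m = 1
  rw [hxu, hΨm]

end Existence

end QuadIdele

namespace QuadIdele

/-! ### Real quadratic fields of prime discriminant -/

/-- The field `ℚ(√d)` with `d = 2` or `d` a prime congruent to `1` modulo `4`. -/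
structure RealQuad (K : Type*) [Field K] [NumberField K] where
  /-- the radicand -/
  d : ℕ
  d_cases : d = 2 ∨ (d.Prime ∧ d % 4 = 1)
  /-- the square root -/
  s : K
  s_sq : s ^ 2 = (d : K)
  adjoin_s : IntermediateField.adjoin ℚ {s} = ⊤
  /-- the non-trivial automorphism -/
  c : K ≃ₐ[ℚ] K
  c_ne : c ≠ 1

theorem exists_prime_mem {F : Type*} [Field F] [NumberField F] (v : HeightOneSpectrum (𝓞 F)) :
    ∃ p : ℕ, p.Prime ∧ Above v p := by
  have h : ∀ n : ℕ, n ≠ 0 → (n : 𝓞 F) ∈ v.asIdeal → ∃ p : ℕ, p.Prime ∧ (p : 𝓞 F) ∈ v.asIdeal := by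
    intro n
    induction n using Nat.recOnMul with
    | zero => intro h; exact absurd rfl h
    | one =>
      intro _ h
      rw [Nat.cast_one] at h
      exact absurd ((Ideal.eq_top_iff_one _).2 h) v.isPrime.ne_top
    | prime p hp => intro _ h; exact ⟨p, hp, h⟩
    | mul a b ha hb =>
      intro hab h
      rw [Nat.cast_mul] at h
      rcases v.isPrime.mem_or_mem h with h | h
      · exact ha (left_ne_zero_of_mul hab) h
      · exact hb (right_ne_zero_of_mul hab) h
  exact h _ (fun h0 => v.ne_bot (Ideal.absNorm_eq_zero_iff.1 h0)) (Ideal.absNorm_mem v.asIdeal)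

theorem Above.one_notMem {F : Type*} [Field F] [NumberField F] (v : HeightOneSpectrum (𝓞 F)) :
    (1 : 𝓞 F) ∉ v.asIdeal := fun h => v.isPrime.ne_top ((Ideal.eq_top_iff_one _).2 h)

theorem Above.intCast_mem_iff {F : Type*} [Field F] [NumberField F]
    {v : HeightOneSpectrum (𝓞 F)} {p : ℕ} (hp : p.Prime) (h : Above v p) (n : ℤ) :
    (n : 𝓞 F) ∈ v.asIdeal ↔ (p : ℤ) ∣ n := by
  constructor
  · intro hn
    by_contra hd
    obtain ⟨a, b, hab⟩ := ((Nat.prime_iff_prime_int.1 hp).coprime_iff_not_dvd.2 hd : IsCoprime (p : ℤ) n)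
    refine Above.one_notMem v ?_
    have e : (1 : 𝓞 F) = (a : 𝓞 F) * (p : 𝓞 F) + (b : 𝓞 F) * (n : 𝓞 F) := by
      exact_mod_cast congrArg (Int.cast : ℤ → 𝓞 F) hab.symm
    rw [e]
    exact v.asIdeal.add_mem (Ideal.mul_mem_left _ _ h) (Ideal.mul_mem_left _ _ hn)
  · rintro ⟨m, rfl⟩
    push_cast
    exact Ideal.mul_mem_right _ _ h

theorem Above.unique {F : Type*} [Field F] [NumberField F] {v : HeightOneSpectrum (𝓞 F)} {p q : ℕ}
    (hp : p.Prime) (hq : q.Prime) (h : Above v p) (h' : Above v q) : p = q := by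
  have := (h.intCast_mem_iff hp q).1 (by exact_mod_cast h')
  exact (Nat.prime_dvd_prime_iff_eq hp hq).1 (by exact_mod_cast this)

theorem Above.exists_int_sub_mem {F : Type*} [Field F] [NumberField F]
    {v : HeightOneSpectrum (𝓞 F)} {p : ℕ} (hp : p.Prime) (h : Ideal.absNorm v.asIdeal = p)
    (x : 𝓞 F) : ∃ n : ℤ, x - n ∈ v.asIdeal := by
  have hcard : Nat.card (𝓞 F ⧸ v.asIdeal) = p := by rw [← h]; rfl
  have := Fact.mk hp
  have h1 : (1 : 𝓞 F ⧸ v.asIdeal) ≠ 0 := by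
    rw [← map_one (Ideal.Quotient.mk v.asIdeal), Ne, Ideal.Quotient.eq_zero_iff_mem]
    exact Above.one_notMem v
  have := zmultiples_eq_top_of_prime_card hcard h1
  obtain ⟨n, hn⟩ := AddSubgroup.mem_zmultiples_iff.1
    (this ▸ AddSubgroup.mem_top (Ideal.Quotient.mk v.asIdeal x))
  refine ⟨n, ?_⟩
  rw [← Ideal.Quotient.eq_zero_iff_mem, map_sub, ← hn, map_intCast, zsmul_eq_mul, mul_one, sub_self]

namespace RealQuad

variable {K : Type*} [Field K] [NumberField K] (Q : RealQuad K)

theorem prime_d : Q.d.Prime := by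
  rcases Q.d_cases with h | h
  · rw [h]; exact Nat.prime_two
  · exact h.1

theorem s_ne_zero : Q.s ≠ 0 := by
  intro h
  have h1 := Q.s_sq
  rw [h, zero_pow two_ne_zero] at h1
  exact Q.prime_d.ne_zero (by exact_mod_cast h1.symm)

theorem exists_eq (x : K) : ∃ a b : ℚ, x = a + b * Q.s := by
  have hint : IsIntegral ℚ Q.s := Algebra.IsIntegral.isIntegral _
  have hx : x ∈ Algebra.adjoin ℚ {Q.s} := by
    rw [← IntermediateField.adjoin_simple_toSubalgebra_of_isAlgebraic hint.isAlgebraic, Q.adjoin_s]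
    trivial
  induction hx using Algebra.adjoin_induction with
  | mem y hy => exact ⟨0, 1, by rw [Set.mem_singleton_iff.1 hy]; simp⟩
  | algebraMap r => exact ⟨r, 0, by simp⟩
  | add y z _ _ hy hz =>
    obtain ⟨a, b, rfl⟩ := hy
    obtain ⟨a', b', rfl⟩ := hz
    exact ⟨a + a', b + b', by push_cast; ring⟩
  | mul y z _ _ hy hz =>
    obtain ⟨a, b, rfl⟩ := hy
    obtain ⟨a', b', rfl⟩ := hz
    refine ⟨a * a' + b * b' * Q.d, a * b' + b * a', ?_⟩
    push_cast
    linear_combination (b : K) * b' * Q.s_sq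

theorem c_ratCast (q : ℚ) : Q.c (q : K) = q := map_ratCast Q.c q

theorem c_s : Q.c Q.s = -Q.s := by
  have h : Q.c Q.s ^ 2 = Q.s ^ 2 := by rw [← map_pow, Q.s_sq, map_natCast]
  rcases sq_eq_sq_iff_eq_or_eq_neg.1 h with h | h
  · refine absurd (AlgEquiv.ext fun x => ?_) Q.c_ne
    obtain ⟨a, b, rfl⟩ := Q.exists_eq x
    rw [map_add, map_mul, h, c_ratCast, c_ratCast]
    rfl
  · exact h

theorem c_add_mul (a b : ℚ) : Q.c (a + b * Q.s) = a - b * Q.s := by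
  rw [map_add, map_mul, Q.c_s, c_ratCast, c_ratCast]
  ring

theorem c_c (x : K) : Q.c (Q.c x) = x := by
  obtain ⟨a, b, rfl⟩ := Q.exists_eq x
  rw [c_add_mul, map_sub, map_mul, Q.c_s, c_ratCast, c_ratCast]
  ring

theorem exists_rat_of_fixed {x : K} (h : Q.c x = x) : ∃ q : ℚ, x = q := by
  obtain ⟨a, b, rfl⟩ := Q.exists_eq x
  rw [c_add_mul] at h
  refine ⟨a, ?_⟩
  have h2 : 2 * ((b : K) * Q.s) = 0 := by linear_combination -h
  rw [(mul_eq_zero.1 h2).resolve_left two_ne_zero, add_zero]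

include Q in
theorem finrank_eq_two : Module.finrank ℚ K = 2 := by
  have hli : LinearIndependent ℚ ![(1 : K), Q.s] := by
    rw [LinearIndependent.pair_iff]
    intro a b h
    have h1 : (a : K) + b * Q.s = 0 := by
      simpa [Algebra.smul_def] using h
    have h2 := congrArg Q.c h1
    rw [c_add_mul, map_zero] at h2
    have ha : 2 * (a : K) = 0 := by linear_combination h1 + h2
    have hb : 2 * ((b : K) * Q.s) = 0 := by linear_combination h1 - h2
    have ha' := (mul_eq_zero.1 ha).resolve_left two_ne_zero
    have hb' := (mul_eq_zero.1 ((mul_eq_zero.1 hb).resolve_left two_ne_zero)).resolve_right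
      Q.s_ne_zero
    exact ⟨by exact_mod_cast ha', by exact_mod_cast hb'⟩
  have hsp : ⊤ ≤ Submodule.span ℚ (Set.range ![(1 : K), Q.s]) := by
    intro x _
    obtain ⟨a, b, rfl⟩ := Q.exists_eq x
    have h1 : (1 : K) ∈ Submodule.span ℚ (Set.range ![(1 : K), Q.s]) :=
      Submodule.subset_span ⟨0, rfl⟩
    have h2 : Q.s ∈ Submodule.span ℚ (Set.range ![(1 : K), Q.s]) := Submodule.subset_span ⟨1, rfl⟩
    have := Submodule.add_mem _ (Submodule.smul_mem _ a h1) (Submodule.smul_mem _ b h2)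
    simpa [Algebra.smul_def] using this
  simpa using Module.finrank_eq_card_basis (Module.Basis.mk hli hsp)

/-- Conjugation on the ring of integers. -/
def conj : 𝓞 K ≃+* 𝓞 K := RingOfIntegers.mapRingEquiv (Q.c : K ≃+* K)

theorem coe_conj (x : 𝓞 K) : (Q.conj x : K) = Q.c x := rfl

theorem conj_conj (x : 𝓞 K) : Q.conj (Q.conj x) = x := RingOfIntegers.ext (Q.c_c x)

theorem exists_int_of_fixed {x : 𝓞 K} (h : Q.conj x = x) : ∃ n : ℤ, x = n := by
  obtain ⟨q, hq⟩ := Q.exists_rat_of_fixed (congrArg (algebraMap (𝓞 K) K) h : Q.c (x : K) = x)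
  have hi : IsIntegral ℤ (algebraMap ℚ K q) := by
    have := RingOfIntegers.isIntegral_coe x
    rw [show (algebraMap (𝓞 K) K) x = (q : K) from hq] at this
    simpa using this
  obtain ⟨n, hn⟩ := IsIntegrallyClosed.isIntegral_iff.1
    ((isIntegral_algebraMap_iff (algebraMap ℚ K).injective).1 hi)
  refine ⟨n, RingOfIntegers.ext ?_⟩
  change (x : K) = algebraMap (𝓞 K) K n
  rw [hq, ← hn]
  simp

/-- The square root of `d` as an algebraic integer. -/
def sInt : 𝓞 K := ⟨Q.s, by
  refine IsIntegral.of_pow (n := 2) (by norm_num) ?_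
  rw [Q.s_sq]
  exact_mod_cast isIntegral_algebraMap (R := ℤ) (A := K) (x := (Q.d : ℤ))⟩

theorem sInt_sq : Q.sInt ^ 2 = (Q.d : 𝓞 K) := RingOfIntegers.ext (by
  change Q.s ^ 2 = algebraMap (𝓞 K) K (Q.d : 𝓞 K)
  rw [map_natCast, Q.s_sq])

theorem conj_sInt : Q.conj Q.sInt = -Q.sInt := RingOfIntegers.ext (by
  change Q.c Q.s = -Q.s
  exact Q.c_s)

/-! ### Prime ideals -/

theorem mem_conjPlace {v : HeightOneSpectrum (𝓞 K)} {x : 𝓞 K} :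
    x ∈ (conjPlace Q.c v).asIdeal ↔ Q.conj x ∈ v.asIdeal := Iff.rfl

theorem conjPlace_conjPlace (v : HeightOneSpectrum (𝓞 K)) :
    conjPlace Q.c (conjPlace Q.c v) = v := by
  ext x
  rw [mem_conjPlace, mem_conjPlace, conj_conj]

theorem above_conjPlace {v : HeightOneSpectrum (𝓞 K)} {p : ℕ} (h : Above v p) :
    Above (conjPlace Q.c v) p := by
  rw [Above, mem_conjPlace, map_natCast]
  exact h

theorem map_conj_asIdeal (v : HeightOneSpectrum (𝓞 K)) :
    v.asIdeal.map Q.conj = (conjPlace Q.c v).asIdeal := by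
  ext x
  rw [mem_conjPlace, Ideal.mem_map_of_equiv]
  constructor
  · rintro ⟨y, hy, rfl⟩
    rwa [conj_conj]
  · exact fun h => ⟨_, h, Q.conj_conj x⟩

theorem eq_of_asIdeal_le {v w : HeightOneSpectrum (𝓞 K)} (h : v.asIdeal ≤ w.asIdeal) : v = w :=
  HeightOneSpectrum.ext (v.isMaximal.eq_of_le w.isPrime.ne_top h)

/-- For `x` in `w` the integer `x * conj x` is divisible by `p`, hence lies in `v`. So `w` is
contained in the union of `v` and its conjugate, and an ideal inside a union of two ideals is inside
one of them. -/
theorem eq_or_eq_conjPlace {v w : HeightOneSpectrum (𝓞 K)} {p : ℕ} (hp : p.Prime)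
    (hv : Above v p) (hw : Above w p) : w = v ∨ w = conjPlace Q.c v := by
  have h : (w.asIdeal : Set (𝓞 K)) ⊆ v.asIdeal ∪ (conjPlace Q.c v).asIdeal := by
    intro x hx
    obtain ⟨n, hn⟩ := Q.exists_int_of_fixed (x := x * Q.conj x) (by
      rw [map_mul, conj_conj, mul_comm])
    have h1 : (n : 𝓞 K) ∈ w.asIdeal := by rw [← hn]; exact Ideal.mul_mem_right _ _ hx
    have h2 : x * Q.conj x ∈ v.asIdeal := by
      rw [hn]
      exact (hv.intCast_mem_iff hp n).2 ((hw.intCast_mem_iff hp n).1 h1)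
    rcases v.isPrime.mem_or_mem h2 with h3 | h3
    · exact Or.inl h3
    · exact Or.inr h3
  rcases Ideal.subset_union.1 h with h | h
  · exact Or.inl (eq_of_asIdeal_le h)
  · exact Or.inr (eq_of_asIdeal_le h)

include Q in
theorem absNorm_span_natCast (p : ℕ) : Ideal.absNorm (Ideal.span {(p : 𝓞 K)}) = p ^ 2 := by
  have h := Algebra.norm_algebraMap_of_basis (RingOfIntegers.basis K) (p : ℤ)
  rw [← Module.finrank_eq_card_chooseBasisIndex, RingOfIntegers.rank, Q.finrank_eq_two] at h
  rw [Ideal.absNorm_span_singleton]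
  have e : (p : 𝓞 K) = algebraMap ℤ (𝓞 K) (p : ℤ) := by simp
  rw [e, h, Int.natAbs_pow, Int.natAbs_natCast]

/-- The three possible decompositions of a rational prime. -/
theorem trichotomy {v : HeightOneSpectrum (𝓞 K)} {p : ℕ} (hp : p.Prime) (hv : Above v p) :
    (conjPlace Q.c v ≠ v ∧ Ideal.span {(p : 𝓞 K)} = v.asIdeal * (conjPlace Q.c v).asIdeal ∧
      Ideal.absNorm v.asIdeal = p) ∨
    (conjPlace Q.c v = v ∧ Ideal.span {(p : 𝓞 K)} = v.asIdeal ∧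
      Ideal.absNorm v.asIdeal = p ^ 2) ∨
    (conjPlace Q.c v = v ∧ Ideal.span {(p : 𝓞 K)} = v.asIdeal ^ 2 ∧
      Ideal.absNorm v.asIdeal = p) := by
  have hle : v.asIdeal ∣ Ideal.span {(p : 𝓞 K)} :=
    Ideal.dvd_iff_le.2 ((Ideal.span_singleton_le_iff_mem _).2 hv)
  obtain ⟨J, hJ⟩ := hle
  have hN := congrArg Ideal.absNorm hJ
  rw [Q.absNorm_span_natCast, map_mul] at hN
  have hv1 : Ideal.absNorm v.asIdeal ≠ 1 := fun h =>
    v.isPrime.ne_top (Ideal.absNorm_eq_one_iff.1 h)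
  have hp0 : p ^ 2 ≠ 0 := pow_ne_zero _ hp.ne_zero
  obtain ⟨k, hk, hvk⟩ := (Nat.dvd_prime_pow hp).1 (Dvd.intro _ hN.symm)
  have hconj : Ideal.span {(p : 𝓞 K)} = v.asIdeal → conjPlace Q.c v = v := fun h => by
    refine (eq_of_asIdeal_le ?_).symm
    rw [← h, Ideal.span_singleton_le_iff_mem]
    exact Q.above_conjPlace hv
  interval_cases k
  · exact absurd (by rw [hvk, pow_zero]) hv1
  · rw [pow_one] at hvk
    have hJp : Ideal.absNorm J = p := by
      rw [hvk, sq] at hN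
      exact (Nat.eq_of_mul_eq_mul_left hp.pos hN).symm
    -- The cofactor of `v` in `(p)` has norm `p` here, so it is itself a prime above `p`: either `v`
    -- or its conjugate.
    have hJprime : J.IsPrime := Ideal.isPrime_of_irreducible_absNorm (by rw [hJp]; exact hp)
    have hJ0 : J ≠ ⊥ := fun h => hp.ne_zero (by rw [← hJp, h, Ideal.absNorm_bot])
    set w : HeightOneSpectrum (𝓞 K) := ⟨J, hJprime, hJ0⟩
    have hw : Above w p := by
      have : J ∣ Ideal.span {(p : 𝓞 K)} := Dvd.intro_left _ hJ.symm
      exact (Ideal.span_singleton_le_iff_mem _).1 (Ideal.dvd_iff_le.1 this)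
    by_cases hc : conjPlace Q.c v = v
    · have hwv : w = v := by
        rcases Q.eq_or_eq_conjPlace hp hv hw with h | h
        · exact h
        · rw [h, hc]
      refine Or.inr (Or.inr ⟨hc, ?_, hvk⟩)
      rw [hJ, sq, show J = v.asIdeal from congrArg HeightOneSpectrum.asIdeal hwv]
    · refine Or.inl ⟨hc, ?_, hvk⟩
      rcases Q.eq_or_eq_conjPlace hp hv hw with h | h
      · exfalso
        -- If the cofactor were `v`, then `(p) = v ^ 2` would lie in the conjugate of `v` and force
        -- the two places to coincide.
        have hsq : Ideal.span {(p : 𝓞 K)} = v.asIdeal ^ 2 := by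
          rw [hJ, sq, show J = v.asIdeal from congrArg HeightOneSpectrum.asIdeal h]
        have h1 : v.asIdeal ^ 2 ≤ (conjPlace Q.c v).asIdeal := by
          rw [← hsq, Ideal.span_singleton_le_iff_mem]
          exact Q.above_conjPlace hv
        have h2 := (conjPlace Q.c v).isPrime.le_of_pow_le h1
        exact hc (eq_of_asIdeal_le h2).symm
      · rw [hJ, show J = (conjPlace Q.c v).asIdeal from congrArg HeightOneSpectrum.asIdeal h]
  · have hJ1 : J = ⊤ := by
      rw [hvk] at hN
      have := Nat.eq_of_mul_eq_mul_left (Nat.pos_of_ne_zero hp0) ((mul_one _).trans hN)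
      exact Ideal.absNorm_eq_one_iff.1 this.symm
    rw [hJ1, Ideal.mul_top] at hJ
    exact Or.inr (Or.inl ⟨hconj hJ, hJ, hvk⟩)

/-- Since the residue field is prime and `v` is stable, conjugation acts trivially modulo `v`, so
every `x - conj x` lies in `v`. For `d = 2` take `x = √2`, where the difference is `2√2 = (√2) ^ 3`;
otherwise take `x = (1 + √d) / 2`, where it is `√d`. -/
theorem sInt_mem_of_ramified {v : HeightOneSpectrum (𝓞 K)} {p : ℕ} (hp : p.Prime)
    (hc : conjPlace Q.c v = v) (hN : Ideal.absNorm v.asIdeal = p) : Q.sInt ∈ v.asIdeal := by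
  have key : ∀ x, x - Q.conj x ∈ v.asIdeal := by
    intro x
    obtain ⟨n, hn⟩ := Above.exists_int_sub_mem hp hN x
    have h2 : Q.conj (x - n) ∈ v.asIdeal := by
      rw [← mem_conjPlace, hc]
      exact hn
    rw [map_sub, map_intCast] at h2
    convert v.asIdeal.sub_mem hn h2 using 1
    ring
  rcases Q.d_cases with hd | ⟨hdp, hd⟩
  · have h1 := key Q.sInt
    have h2 : Q.sInt - Q.conj Q.sInt = Q.sInt ^ 3 := by
      rw [conj_sInt, pow_succ, sInt_sq, hd]
      push_cast
      ring
    rw [h2] at h1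
    exact v.isPrime.mem_of_pow_mem _ h1
  · obtain ⟨k, hk⟩ : ∃ k : ℕ, Q.d = 4 * k + 1 := ⟨Q.d / 4, by omega⟩
    have hint : IsIntegral ℤ ((1 + Q.s) / 2) := by
      refine ⟨Polynomial.X ^ 2 - Polynomial.X - Polynomial.C (k : ℤ), by monicity!, ?_⟩
      have h := Q.s_sq
      rw [hk] at h
      push_cast at h
      rw [Polynomial.eval₂_sub, Polynomial.eval₂_sub, Polynomial.eval₂_pow, Polynomial.eval₂_X,
        Polynomial.eval₂_C, eq_intCast, Int.cast_natCast]
      linear_combination h / 4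
    have h1 := key ⟨_, hint⟩
    convert h1 using 1
    apply RingOfIntegers.ext
    change Q.s = (1 + Q.s) / 2 - Q.c ((1 + Q.s) / 2)
    rw [map_div₀, map_add, map_one, Q.c_s, map_ofNat]
    ring

theorem eq_d_of_ramified {v : HeightOneSpectrum (𝓞 K)} {p : ℕ} (hp : p.Prime) (hv : Above v p)
    (hc : conjPlace Q.c v = v) (hN : Ideal.absNorm v.asIdeal = p) : p = Q.d := by
  refine hv.unique hp Q.prime_d ?_
  rw [Above, ← Q.sInt_sq]
  exact v.asIdeal.pow_mem_of_mem (Q.sInt_mem_of_ramified hp hc hN) 2 (by norm_num)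

/-- Here `v ^ 2 = (p) = (d) = (√d) ^ 2`, and squaring is injective on ideals. The ramified prime is
thus principal with a generator that conjugation negates. -/
theorem asIdeal_eq_of_ramified {v : HeightOneSpectrum (𝓞 K)} {p : ℕ} (hp : p.Prime)
    (hv : Above v p) (hc : conjPlace Q.c v = v) (hN : Ideal.absNorm v.asIdeal = p)
    (h : Ideal.span {(p : 𝓞 K)} = v.asIdeal ^ 2) : v.asIdeal = Ideal.span {Q.sInt} := by
  rw [Q.eq_d_of_ramified hp hv hc hN, ← Q.sInt_sq, ← Ideal.span_singleton_pow] at h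
  exact (pow_left_injective two_ne_zero h).symm

end RealQuad

end QuadIdele

namespace QuadIdele

namespace RealQuad

variable {K : Type*} [Field K] [NumberField K] (Q : RealQuad K)

/-! ### Invariant ideals and units -/

theorem map_conj_span (x : 𝓞 K) :
    (Ideal.span {x}).map Q.conj = Ideal.span {Q.conj x} := by
  rw [Ideal.map_span, Set.image_singleton]

theorem map_conj_map_conj (I : Ideal (𝓞 K)) : (I.map Q.conj).map Q.conj = I := by
  ext x
  simp only [Ideal.mem_map_of_equiv]
  constructor
  · rintro ⟨_, ⟨y, hy, rfl⟩, rfl⟩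
    rwa [conj_conj]
  · exact fun h => ⟨_, ⟨x, h, rfl⟩, Q.conj_conj x⟩

theorem map_conj_ne_bot {I : Ideal (𝓞 K)} (hI : I ≠ ⊥) : I.map Q.conj ≠ ⊥ := fun h =>
  hI (by rw [← Q.map_conj_map_conj I, h, Ideal.map_bot])

/-- A prime divisor `v` of an invariant ideal has its conjugate as a divisor too. In the split case
the product of the two is `(p)`, in the inert case `v = (p)`, in the ramified case `v = (√d)`. -/
theorem exists_dvd_of_invariant {I : Ideal (𝓞 K)} (hI : I ≠ ⊥) (hI1 : I ≠ ⊤)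
    (h : I.map Q.conj = I) : ∃ t : 𝓞 K, (Q.conj t = t ∨ Q.conj t = -t) ∧
      Ideal.span {t} ≠ ⊤ ∧ Ideal.span {t} ∣ I := by
  obtain ⟨M, hM, hIM⟩ := Ideal.exists_le_maximal I hI1
  have hM0 : M ≠ ⊥ := fun h0 => hI (le_bot_iff.1 (h0 ▸ hIM))
  let v : HeightOneSpectrum (𝓞 K) := ⟨M, hM.isPrime, hM0⟩
  have hvI : v.asIdeal ∣ I := Ideal.dvd_iff_le.2 hIM
  have hcI : (conjPlace Q.c v).asIdeal ∣ I := by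
    rw [Ideal.dvd_iff_le, ← Q.map_conj_asIdeal, ← h]
    exact Ideal.map_mono hIM
  obtain ⟨p, hp, hv⟩ := exists_prime_mem v
  have htop : Ideal.span {(p : 𝓞 K)} ≠ ⊤ := fun h0 => by
    refine v.isPrime.ne_top (top_le_iff.1 ?_)
    rw [← h0, Ideal.span_singleton_le_iff_mem]
    exact hv
  rcases Q.trichotomy hp hv with ⟨hc, hs, -⟩ | ⟨hc, hs, -⟩ | ⟨hc, hs, hN⟩
  · refine ⟨p, Or.inl (map_natCast _ _), htop, ?_⟩
    rw [hs]
    have := v.isMaximal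
    have := (conjPlace Q.c v).isMaximal
    refine IsCoprime.mul_dvd (Ideal.isCoprime_of_isMaximal fun e => hc ?_) hvI hcI
    exact (HeightOneSpectrum.ext e).symm
  · exact ⟨p, Or.inl (map_natCast _ _), htop, hs ▸ hvI⟩
  · have e := Q.asIdeal_eq_of_ramified hp hv hc hN hs
    exact ⟨Q.sInt, Or.inr Q.conj_sInt, e ▸ v.isPrime.ne_top, e ▸ hvI⟩

/-- Ideals stable under conjugation are principal, with a generator that is stable up to sign. -/
theorem exists_generator_of_invariant {I : Ideal (𝓞 K)} (hI : I ≠ ⊥) (h : I.map Q.conj = I) :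
    ∃ a : 𝓞 K, I = Ideal.span {a} ∧ (Q.conj a = a ∨ Q.conj a = -a) := by
  induction hn : Ideal.absNorm I using Nat.strong_induction_on generalizing I with
  | _ n ih =>
    by_cases hI1 : I = ⊤
    · exact ⟨1, by rw [hI1, Ideal.span_singleton_one], Or.inl (map_one _)⟩
    · obtain ⟨t, ht, htop, J, hJ⟩ := Q.exists_dvd_of_invariant hI hI1 h
      have ht0 : Ideal.span {t} ≠ ⊥ := fun h0 => hI (by rw [hJ, h0, Ideal.bot_mul])
      have hJ0 : J ≠ ⊥ := fun h0 => hI (by rw [hJ, h0, Ideal.mul_bot])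
      have htc : (Ideal.span {t}).map Q.conj = Ideal.span {t} := by
        rw [map_conj_span]
        rcases ht with ht | ht
        · rw [ht]
        · rw [ht, Ideal.span_singleton_neg]
      have hJc : J.map Q.conj = J := by
        have h1 := h
        rw [hJ, Ideal.map_mul, htc] at h1
        exact mul_left_cancel₀ ht0 h1
      have hlt : Ideal.absNorm J < n := by
        rw [← hn, hJ, map_mul]
        have h1 : Ideal.absNorm J ≠ 0 := fun h0 => hJ0 (Ideal.absNorm_eq_zero_iff.1 h0)
        have h2 : Ideal.absNorm (Ideal.span {t}) ≠ 0 := fun h0 =>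
          ht0 (Ideal.absNorm_eq_zero_iff.1 h0)
        have h3 : Ideal.absNorm (Ideal.span {t}) ≠ 1 := fun h0 =>
          htop (Ideal.absNorm_eq_one_iff.1 h0)
        have : 2 ≤ Ideal.absNorm (Ideal.span {t}) := by omega
        nlinarith [Nat.pos_of_ne_zero h1]
      obtain ⟨b, hb, hbc⟩ := ih _ hlt hJ0 hJc rfl
      refine ⟨t * b, by rw [hJ, hb, Ideal.span_singleton_mul_span_singleton], ?_⟩
      rw [map_mul]
      rcases ht with ht | ht <;> rcases hbc with hb | hb <;> rw [ht, hb]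
      · exact Or.inl rfl
      · exact Or.inr (by ring)
      · exact Or.inr (by ring)
      · exact Or.inl (by ring)

include Q in
theorem isUnit_intCast {n : ℤ} (h : IsUnit (n : 𝓞 K)) : n = 1 ∨ n = -1 := by
  obtain ⟨k, hk⟩ := n.eq_nat_or_neg
  have hk' : IsUnit (k : 𝓞 K) := by
    rcases hk with rfl | rfl
    · exact_mod_cast h
    · push_cast at h
      exact (IsUnit.neg_iff _).1 h
  have h2 := Q.absNorm_span_natCast k
  rw [Ideal.span_singleton_eq_top.2 hk', Ideal.absNorm_top] at h2
  have : k = 1 := by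
    rcases Nat.eq_zero_or_pos k with h | h
    · rw [h] at h2; norm_num at h2
    · nlinarith
  omega

theorem isUnit_of_fixed {x : 𝓞 K} (hx : IsUnit x) (h : Q.conj x = x) : x = 1 ∨ x = -1 := by
  obtain ⟨n, rfl⟩ := Q.exists_int_of_fixed h
  rcases Q.isUnit_intCast hx with h | h
  · exact Or.inl (by rw [h, Int.cast_one])
  · exact Or.inr (by rw [h, Int.cast_neg, Int.cast_one])

theorem conj_mul_conj (x : 𝓞 K) : Q.conj (x * Q.conj x) = x * Q.conj x := by
  rw [map_mul, conj_conj, mul_comm]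

theorem norm_unit {x : 𝓞 K} (hx : IsUnit x) : x * Q.conj x = 1 ∨ x * Q.conj x = -1 :=
  Q.isUnit_of_fixed (hx.mul (hx.map Q.conj)) (Q.conj_mul_conj x)

/-- Hilbert 90 for units of norm one, up to sign. -/
theorem exists_sq_of_norm_one {u : 𝓞 K} (hu : u * Q.conj u = 1) :
    ∃ η : 𝓞 K, IsUnit η ∧ (u = η ^ 2 ∨ u = -η ^ 2) := by
  by_cases hu1 : 1 + u = 0
  · exact ⟨1, isUnit_one, Or.inr (by linear_combination hu1)⟩
  · have huu : IsUnit u := IsUnit.of_mul_eq_one _ hu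
    -- This identity makes the ideal `(1 + u)` invariant, hence generated by some `a` with `conj a =
    -- ±a`. The unit `η = (1 + u) / a` then satisfies `u * conj η = ±η`; multiplying by `η`, of norm
    -- `±1`, gives `u = ±η ^ 2`.
    have hcu : u * Q.conj (1 + u) = 1 + u := by rw [map_add, map_one]; linear_combination hu
    obtain ⟨a, ha, hac⟩ := Q.exists_generator_of_invariant (I := Ideal.span {1 + u})
      (by rwa [Ne, Ideal.span_singleton_eq_bot]) (by
        rw [map_conj_span, Ideal.span_singleton_eq_span_singleton]
        refine ⟨huu.unit, ?_⟩
        rw [IsUnit.unit_spec, mul_comm, hcu])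
    obtain ⟨η, hη⟩ := (Ideal.span_singleton_eq_span_singleton.1 ha).symm
    have ha0 : a ≠ 0 := fun h0 => hu1 (by rw [← hη, h0, zero_mul])
    refine ⟨η, η.isUnit, ?_⟩
    rw [← hη, map_mul] at hcu
    rcases hac with hac | hac <;> rw [hac] at hcu <;>
      rcases Q.norm_unit η.isUnit with hn | hn
    · have : u * Q.conj η = η := mul_left_cancel₀ ha0 (by linear_combination hcu)
      exact Or.inl (by linear_combination (η : 𝓞 K) * this - u * hn)
    · have : u * Q.conj η = η := mul_left_cancel₀ ha0 (by linear_combination hcu)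
      exact Or.inr (by linear_combination -(η : 𝓞 K) * this + u * hn)
    · have : u * Q.conj η = -η := mul_left_cancel₀ ha0 (by linear_combination -hcu)
      exact Or.inr (by linear_combination (η : 𝓞 K) * this - u * hn)
    · have : u * Q.conj η = -η := mul_left_cancel₀ ha0 (by linear_combination -hcu)
      exact Or.inl (by linear_combination -(η : 𝓞 K) * this + u * hn)

/-- The negative Pell equation for primes congruent to `1` modulo `4`. -/
theorem exists_neg_pell {d : ℕ} (hd : d.Prime) (hd4 : d % 4 = 1) :
    ∃ a b : ℤ, a ^ 2 - d * b ^ 2 = -1 := by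
  have hdZ := Nat.prime_iff_prime_int.1 hd
  obtain ⟨e, he⟩ : ∃ e : ℤ, (d : ℤ) = 4 * e + 1 := ⟨(d : ℤ) / 4, by omega⟩
  have hsq : ¬ IsSquare (d : ℤ) := fun h => hdZ.irreducible.not_isSquare h
  have hd0 : (0 : ℤ) < d := by exact_mod_cast hd.pos
  obtain ⟨P, hP⟩ := Pell.IsFundamental.exists_of_not_isSquare hd0 hsq
  have h1 := P.prop
  have hx1 : 1 < P.x := hP.1
  -- Modulo `4`: with `y` odd and `d ≡ 1`, the square `x ^ 2 = 1 + d * y ^ 2` would be `2`.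
  have hy : Even P.y := by
    by_contra hy
    obtain ⟨j, hj⟩ := Int.not_even_iff_odd.1 hy
    rw [hj] at h1
    generalize P.x = X at h1 hx1
    rw [he] at h1
    rcases Int.even_or_odd' X with ⟨k, hk | hk⟩
    · rw [hk] at h1
      have h4 := congrArg (· % 4) h1
      ring_nf at h4
      omega
    · rw [hk] at h1
      have h4 := congrArg (· % 4) h1
      ring_nf at h4
      omega
  obtain ⟨m, hm⟩ := hy
  obtain ⟨k, hk⟩ : ∃ k, P.x = 2 * k + 1 := by
    rcases Int.even_or_odd' P.x with ⟨k, hk | hk⟩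
    · exfalso
      rw [hk, hm] at h1
      have h4 := congrArg (· % 2) h1
      ring_nf at h4
      omega
    · exact ⟨k, hk⟩
  -- Writing `x = 2k + 1` and `y = 2m` in the Pell equation leaves two coprime consecutive factors
  -- whose product is `d` times a square.
  have hkm : k * (k + 1) = d * m ^ 2 := by
    rw [hk, hm] at h1
    linarith [h1]
  have hk0 : 0 < k := by omega
  have hcop : IsCoprime k (k + 1) := ⟨-1, 1, by ring⟩
  -- If `d` divides `k`, then `k = d * b ^ 2` and `k + 1 = a ^ 2`, a positive solution that will be
  -- too small. If `d` divides `k + 1`, then `k = a ^ 2` and `k + 1 = d * b ^ 2`, which is the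
  -- negative equation.
  rcases hdZ.dvd_or_dvd (Dvd.intro _ hkm.symm) with ⟨l, hl⟩ | ⟨l, hl⟩
  · have hlpos : 0 < l := by
      rw [hl] at hk0
      exact pos_of_mul_pos_right hk0 hd0.le
    have hlm : l * (k + 1) = m ^ 2 := by
      refine mul_left_cancel₀ hd0.ne' ?_
      rw [← hkm, hl]
      ring
    have hc' : IsCoprime l (k + 1) := IsCoprime.of_mul_left_right (hl ▸ hcop : IsCoprime (d * l) _)
    obtain ⟨b, hb⟩ := Int.sq_of_isCoprime hc' hlm
    obtain ⟨a, ha⟩ := Int.sq_of_isCoprime hc'.symm (by rw [mul_comm]; exact hlm)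
    have hb' : l = b ^ 2 := hb.resolve_right (by nlinarith [sq_nonneg b])
    have ha' : k + 1 = a ^ 2 := ha.resolve_right (by nlinarith [sq_nonneg a])
    have hsol : |a| ^ 2 - d * b ^ 2 = 1 := by rw [sq_abs, ← ha', ← hb', hl]; ring
    have ha1 : 1 < |a| := by
      rw [← sq_abs] at ha'
      by_contra hle
      have h0 := abs_nonneg a
      nlinarith
    -- The fundamental solution has `x = 2 * a ^ 2 - 1`, which exceeds `|a|`, contradicting
    -- minimality.
    have hle := hP.x_le_x (a := Pell.Solution₁.mk |a| b hsol) (by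
      rw [Pell.Solution₁.x_mk]; exact ha1)
    rw [Pell.Solution₁.x_mk] at hle
    rw [← sq_abs] at ha'
    nlinarith
  · have hlpos : 0 < l := by
      have : 0 < (d : ℤ) * l := by rw [← hl]; omega
      exact pos_of_mul_pos_right this hd0.le
    have hlm : k * l = m ^ 2 := by
      refine mul_left_cancel₀ hd0.ne' ?_
      rw [← hkm, hl]
      ring
    have hc' : IsCoprime k l := IsCoprime.of_mul_right_right (hl ▸ hcop : IsCoprime k (d * l))
    obtain ⟨a, ha⟩ := Int.sq_of_isCoprime hc' hlm
    obtain ⟨b, hb⟩ := Int.sq_of_isCoprime hc'.symm (by rw [mul_comm]; exact hlm)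
    have ha' : k = a ^ 2 := ha.resolve_right (by nlinarith [sq_nonneg a])
    have hb' : l = b ^ 2 := hb.resolve_right (by nlinarith [sq_nonneg b])
    exact ⟨a, b, by rw [← ha', ← hb', ← hl]; ring⟩

/-- There is a unit of norm `-1`. -/
theorem exists_unit_norm_neg_one : ∃ ε : 𝓞 K, ε * Q.conj ε = -1 := by
  obtain ⟨a, b, h⟩ : ∃ a b : ℤ, a ^ 2 - Q.d * b ^ 2 = -1 := by
    rcases Q.d_cases with hd | ⟨hd, hd4⟩
    · exact ⟨1, 1, by rw [hd]; norm_num⟩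
    · exact exists_neg_pell hd hd4
  refine ⟨a + b * Q.sInt, ?_⟩
  rw [map_add, map_mul, conj_sInt, map_intCast, map_intCast]
  have h' : (a : 𝓞 K) ^ 2 - Q.d * b ^ 2 = -1 := by exact_mod_cast congrArg (Int.cast : ℤ → 𝓞 K) h
  linear_combination h' - (b : 𝓞 K) ^ 2 * Q.sInt_sq

/-- Modulo squares, the units are generated by `-1` and a unit of norm `-1`. -/
theorem exists_unit_eq {ε : 𝓞 K} (hε : ε * Q.conj ε = -1) {u : 𝓞 K} (hu : IsUnit u) :
    ∃ η : 𝓞 K, IsUnit η ∧ (u = η ^ 2 ∨ u = -η ^ 2 ∨ u = ε * η ^ 2 ∨ u = -(ε * η ^ 2)) := by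
  rcases Q.norm_unit hu with h | h
  · obtain ⟨η, hη, h | h⟩ := Q.exists_sq_of_norm_one h
    · exact ⟨η, hη, Or.inl h⟩
    · exact ⟨η, hη, Or.inr (Or.inl h)⟩
  -- Both `u` and `ε` have norm `-1`, so `-(u * conj ε)`, which is `u / ε`, has norm one.
  · obtain ⟨η, hη, h1⟩ := Q.exists_sq_of_norm_one (u := -(u * Q.conj ε)) (by
      rw [map_neg, map_mul, conj_conj]
      linear_combination (ε * Q.conj ε) * h - hε)
    refine ⟨η, hη, ?_⟩
    rcases h1 with h1 | h1
    · exact Or.inr (Or.inr (Or.inl (by linear_combination ε * h1 + u * hε)))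
    · exact Or.inr (Or.inr (Or.inr (by linear_combination ε * h1 + u * hε)))

/-! ### The class number is odd -/

include Q in
-- An ideal class killed by `2` contains an ideal stable under conjugation, and such ideals are
-- principal. The multiplier is `(α + m) * conj α`, where `I ^ 2 = (α)`, `I * conj I = (m)` and `α`,
-- `m` have equal norms. Should `α + m` vanish, `I` itself is stable.
theorem isPrincipal_of_sq_isPrincipal {I : Ideal (𝓞 K)} (hI : I ≠ ⊥) {α : 𝓞 K}
    (hα : I ^ 2 = Ideal.span {α}) : ∃ x y : 𝓞 K, x ≠ 0 ∧ y ≠ 0 ∧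
      Ideal.span {x} * I = Ideal.span {y} := by
  obtain ⟨ε, hε⟩ := Q.exists_unit_norm_neg_one
  have hεu : IsUnit ε := IsUnit.of_mul_eq_one (-Q.conj ε) (by linear_combination -hε)
  have hinv : (I * I.map Q.conj).map Q.conj = I * I.map Q.conj := by
    rw [Ideal.map_mul, map_conj_map_conj, mul_comm]
  have hcI := Q.map_conj_ne_bot hI
  obtain ⟨m, hm, hmc⟩ := Q.exists_generator_of_invariant (mul_ne_zero hI hcI) hinv
  have hm0 : m ≠ 0 := fun h0 => mul_ne_zero hI hcI (by rw [hm, h0]; simp)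
  have hmm : Ideal.span {m * Q.conj m} = Ideal.span {m ^ 2} := by
    rcases hmc with h | h <;> rw [h]
    · rw [sq]
    · rw [mul_neg, Ideal.span_singleton_neg, sq]
  -- The norms of `α` and `m` generate the same ideal and are fixed by conjugation, so they differ
  -- by a sign. Replacing `α` by `α * ε` corrects it; this is where a unit of norm `-1` is
  -- indispensable.
  obtain ⟨α, hα, hN⟩ : ∃ α : 𝓞 K, I ^ 2 = Ideal.span {α} ∧ α * Q.conj α = m * Q.conj m := by
    have h1 : Ideal.span {α * Q.conj α} = Ideal.span {m * Q.conj m} := by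
      rw [hmm, ← Ideal.span_singleton_mul_span_singleton, ← map_conj_span, ← hα,
        ← Ideal.span_singleton_pow, ← hm, Ideal.map_pow, mul_pow]
    obtain ⟨w, hw⟩ := (Ideal.span_singleton_eq_span_singleton.1 h1).symm
    have hmm0 : m * Q.conj m ≠ 0 := mul_ne_zero hm0 ((map_ne_zero_iff _ Q.conj.injective).2 hm0)
    have hwc : Q.conj w = w := by
      have h2 := congrArg Q.conj hw
      rw [map_mul, conj_mul_conj, conj_mul_conj, ← hw] at h2
      exact mul_left_cancel₀ hmm0 h2
    rcases Q.isUnit_of_fixed w.isUnit hwc with h | h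
    · exact ⟨α, hα, by rw [← hw, h, mul_one]⟩
    · refine ⟨α * ε, ?_, ?_⟩
      · rw [hα, Ideal.span_singleton_eq_span_singleton]
        exact ⟨hεu.unit, rfl⟩
      · rw [h] at hw
        rw [map_mul]
        linear_combination (α * Q.conj α) * hε + hw
  have hα0 : α ≠ 0 := fun h0 => pow_ne_zero 2 hI (by rw [hα, h0]; simp)
  have hcα0 : Q.conj α ≠ 0 := (map_ne_zero_iff _ Q.conj.injective).2 hα0
  have hgen : ∀ {x : 𝓞 K}, x ≠ 0 → (Ideal.span {x} * I).map Q.conj = Ideal.span {x} * I →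
      ∃ x y : 𝓞 K, x ≠ 0 ∧ y ≠ 0 ∧ Ideal.span {x} * I = Ideal.span {y} := by
    intro x hx h
    have h0 : Ideal.span {x} * I ≠ ⊥ :=
      mul_ne_zero (by rwa [Ne, Ideal.zero_eq_bot, Ideal.span_singleton_eq_bot]) hI
    obtain ⟨y, hy, -⟩ := Q.exists_generator_of_invariant h0 h
    exact ⟨x, y, hx, fun hy0 => h0 (by rw [hy, hy0]; simp), hy⟩
  have hkey : Ideal.span {α} * I.map Q.conj = Ideal.span {m} * I := by
    rw [← hα, ← hm]
    ring
  by_cases hαm : α + m = 0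
  · refine hgen one_ne_zero ?_
    rw [Ideal.span_singleton_one, Ideal.top_mul]
    refine mul_left_cancel₀ hI ?_
    rw [hm, ← sq, hα, eq_neg_of_add_eq_zero_left hαm, Ideal.span_singleton_neg]
  · refine hgen (mul_ne_zero hαm hcα0) ?_
    -- Together with `hkey`, this shows that conjugation carries `(α + m) * conj α * I` to itself.
    have e : Q.conj α * (α + m) = (Q.conj α + Q.conj m) * m := by linear_combination hN
    rw [Ideal.map_mul, map_conj_span, map_mul, conj_conj, map_add,
      ← Ideal.span_singleton_mul_span_singleton, mul_assoc, hkey, ← mul_assoc,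
      Ideal.span_singleton_mul_span_singleton, ← e, mul_comm (Q.conj α)]

include Q in
theorem odd_classNumber : Odd (classNumber K) := by
  rw [← Nat.not_even_iff_odd]
  intro h
  have := Fact.mk Nat.prime_two
  obtain ⟨g, hg⟩ := exists_prime_orderOf_dvd_card 2 (even_iff_two_dvd.1 h : 2 ∣ Fintype.card (ClassGroup (𝓞 K)))
  obtain ⟨⟨I, hI⟩, rfl⟩ := ClassGroup.mk0_surjective g
  have hI0 : I ≠ ⊥ := nonZeroDivisors.ne_zero hI
  have h2 : (ClassGroup.mk0 ⟨I, hI⟩) ^ 2 = 1 := by rw [← hg, pow_orderOf_eq_one]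
  rw [← map_pow] at h2
  have hp : Submodule.IsPrincipal (I ^ 2) := (ClassGroup.mk0_eq_one_iff (I := I ^ 2) (pow_mem hI 2)).1 h2
  obtain ⟨α, hα⟩ := hp
  obtain ⟨x, y, hx, hy, hxy⟩ := Q.isPrincipal_of_sq_isPrincipal hI0 (α := α) hα
  have h1 : ClassGroup.mk0 ⟨I, hI⟩ = 1 := by
    rw [← map_one ClassGroup.mk0, ClassGroup.mk0_eq_mk0_iff]
    exact ⟨x, y, hx, hy, by simpa using hxy⟩
  rw [h1, orderOf_one] at hg
  norm_num at hg

end RealQuad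

end QuadIdele

namespace QuadIdele

/-! ### Signs at real places -/

section Signs

variable {F : Type*} [Field F]

open Classical in
/-- The sign character of the completion at a real place. -/
def signChar {w : InfinitePlace F} (hw : w.IsReal) : (w.Completion)ˣ →* Circle where
  toFun y := if 0 < InfinitePlace.Completion.extensionEmbeddingOfIsReal hw y then 1 else -1
  map_one' := by simp
  map_mul' x y := by
    set e := InfinitePlace.Completion.extensionEmbeddingOfIsReal hw
    have hx : e x ≠ 0 := (map_ne_zero e).2 x.ne_zero
    have hy : e y ≠ 0 := (map_ne_zero e).2 y.ne_zero
    rw [Units.val_mul, map_mul]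
    rcases hx.lt_or_gt with hx | hx <;> rcases hy.lt_or_gt with hy | hy
    · rw [if_pos (mul_pos_of_neg_of_neg hx hy), if_neg hx.not_gt, if_neg hy.not_gt, neg_mul_neg,
        one_mul]
    · rw [if_neg (mul_neg_of_neg_of_pos hx hy).not_gt, if_neg hx.not_gt, if_pos hy, mul_one]
    · rw [if_neg (mul_neg_of_pos_of_neg hx hy).not_gt, if_neg hy.not_gt, if_pos hx, one_mul]
    · rw [if_pos (mul_pos hx hy), if_pos hx, if_pos hy, one_mul]

variable {w : InfinitePlace F} (hw : w.IsReal)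

theorem signChar_of_pos {y : (w.Completion)ˣ}
    (h : 0 < InfinitePlace.Completion.extensionEmbeddingOfIsReal hw y) : signChar hw y = 1 :=
  if_pos h

theorem signChar_of_neg {y : (w.Completion)ˣ}
    (h : InfinitePlace.Completion.extensionEmbeddingOfIsReal hw y < 0) : signChar hw y = -1 :=
  if_neg h.not_gt

theorem signChar_sq (y : (w.Completion)ˣ) : signChar hw y ^ 2 = 1 := by
  have hy := (map_ne_zero (InfinitePlace.Completion.extensionEmbeddingOfIsReal hw)).2 y.ne_zero
  rcases hy.lt_or_gt with hy | hy
  · rw [signChar_of_neg hw hy, neg_sq, one_pow]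
  · rw [signChar_of_pos hw hy, one_pow]

theorem signChar_of_isSquare {y : (w.Completion)ˣ} (h : IsSquare (y : w.Completion)) :
    signChar hw y = 1 := by
  refine signChar_of_pos hw ?_
  obtain ⟨z, hz⟩ := h
  rw [hz, map_mul]
  refine mul_self_pos.2 ((map_ne_zero _).2 ?_)
  rintro rfl
  exact y.ne_zero (by rw [hz, mul_zero])

theorem isSquare_of_pos {y : w.Completion}
    (h : 0 < InfinitePlace.Completion.extensionEmbeddingOfIsReal hw y) : IsSquare y := by
  set e := InfinitePlace.Completion.ringEquivRealOfIsReal hw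
  refine ⟨e.symm (Real.sqrt (e y)), ?_⟩
  rw [← map_mul, Real.mul_self_sqrt (show 0 ≤ e y from le_of_lt h), RingEquiv.symm_apply_apply]

theorem extensionEmbedding_infComp [NumberField F] (k : Fˣ) :
    InfinitePlace.Completion.extensionEmbeddingOfIsReal hw (infComp w (principalIdele F k)) =
      InfinitePlace.embedding_of_isReal hw k := by
  rw [infComp_principal]
  exact InfinitePlace.Completion.extensionEmbeddingOfIsReal_coe hw _

end Signs

/-! ### Characters of the ideles of `ℚ` with prescribed ramification -/

theorem rat_globalUnit (η : (𝓞 ℚ)ˣ) : η = 1 ∨ η = -1 := by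
  rcases Int.units_eq_one_or (Units.map Rat.ringOfIntegersEquiv.toMonoidHom η) with h | h
  · refine Or.inl (Units.ext (Rat.ringOfIntegersEquiv.injective ?_))
    rw [Units.val_one, map_one]
    exact congrArg Units.val h
  · refine Or.inr (Units.ext (Rat.ringOfIntegersEquiv.injective ?_))
    rw [Units.val_neg, Units.val_one, map_neg, map_one]
    exact congrArg Units.val h

theorem circle_eq_or_of_sq {z : Circle} (h : z ^ 2 = 1) : z = 1 ∨ z = -1 := by
  have h1 : (z : ℂ) ^ 2 = 1 := by rw [← Circle.coe_pow, h, Circle.coe_one]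
  rcases sq_eq_one_iff.1 h1 with h | h
  · exact Or.inl (Circle.ext h)
  · exact Or.inr (Circle.ext (by rw [h, Circle.coe_neg, Circle.coe_one]))

/-- The only obstruction to extending `ψ` from local units is its value at the global unit `-1`.
When this is `-1`, the sign character at infinity compensates, and it has exponent `m` because `m`
is even. -/
theorem exists_rat_character (P : HeightOneSpectrum (𝓞 ℚ)) (ψ : (P.adicCompletion ℚ)ˣ →* Circle)
    (n : ℕ) (hn : ∀ u : (P.adicCompletion ℚ)ˣ, Valued.v (u : P.adicCompletion ℚ) = 1 →
      Lev Valued.v n ((u : P.adicCompletion ℚ) - 1) → ψ u = 1)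
    (m : ℕ) (hm : Even m) (hψ : ∀ u, ψ u ^ m = 1) :
    ∃ ν ∈ IdeleClassCharacter ℚ, (∀ x, ν x ^ m = 1) ∧ ∀ x ∈ unitIdeles ℚ,
      (∀ w, IsSquare (x.val.1 w)) → ν x = ψ (finComp P x) := by
  have hneg : ψ (-1) = 1 ∨ ψ (-1) = -1 := circle_eq_or_of_sq (by
    rw [← map_pow, neg_one_sq, map_one])
  have hs : ∃ φ : ∀ w : InfinitePlace ℚ, (w.Completion)ˣ →* Circle,
      (∀ (w : InfinitePlace ℚ) (y : (w.Completion)ˣ), IsSquare (y : w.Completion) → φ w y = 1) ∧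
      (∀ w y, φ w y ^ m = 1) ∧ ∀ w, φ w (-1) = ψ (-1) := by
    rcases hneg with h | h
    · exact ⟨fun _ => 1, fun _ _ _ => rfl, fun _ _ => one_pow _, fun _ => h.symm⟩
    · refine ⟨fun w => signChar (IsTotallyReal.isReal w), fun w y => signChar_of_isSquare _,
        fun w y => ?_, fun w => ?_⟩
      · obtain ⟨k, rfl⟩ := hm
        rw [← two_mul, pow_mul, signChar_sq, one_pow]
      · rw [h]
        refine signChar_of_neg _ ?_
        rw [Units.val_neg, Units.val_one, map_neg, map_one]
        norm_num
  obtain ⟨φ, hφsq, hφm, hφ⟩ := hs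
  obtain ⟨χ, hχ, hχm, hχu⟩ := exists_ideleClassCharacter P ψ n hn φ hφsq (by
    intro η
    rcases rat_globalUnit η with rfl | rfl
    · simp
    · rw [show globalUnit (-1 : (𝓞 ℚ)ˣ) = -1 from ?_]
      · rw [Fintype.prod_subsingleton _ Rat.infinitePlace,
          show infComp Rat.infinitePlace (-1 : Idele ℚ) = -1 from Units.ext rfl, hφ,
          show finComp P (-1 : Idele ℚ) = -1 from Units.ext rfl, ← sq, ← map_pow, neg_one_sq,
          map_one]
      · apply Units.ext
        change algebraMap ℚ (AdeleRing (𝓞 ℚ) ℚ) (algebraMap (𝓞 ℚ) ℚ (-1)) = -1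
        rw [map_neg, map_neg, map_one, map_one]) m hψ hφm (by rw [Rat.classNumber_eq])
  refine ⟨χ, hχ, hχm, fun x hx hsq => ?_⟩
  rw [hχu x hx, Finset.prod_eq_one fun w _ => hφsq w _ (hsq w), mul_one]

namespace RealQuad

variable {K : Type*} [Field K] [NumberField K] (Q : RealQuad K)

/-! ### Infinite places -/

include Q in
theorem conj_embedding (φ : K →+* ℂ) (x : K) : (starRingEnd ℂ) (φ x) = φ x := by
  have hs : (starRingEnd ℂ) (φ Q.s) = φ Q.s := by
    have h : φ Q.s ^ 2 = ((Real.sqrt Q.d : ℝ) : ℂ) ^ 2 := by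
      rw [← map_pow, Q.s_sq, map_natCast, ← Complex.ofReal_pow, Real.sq_sqrt (Nat.cast_nonneg _),
        Complex.ofReal_natCast]
    rcases sq_eq_sq_iff_eq_or_eq_neg.1 h with h | h
    · rw [h, Complex.conj_ofReal]
    · rw [h, map_neg, Complex.conj_ofReal]
  obtain ⟨a, b, rfl⟩ := Q.exists_eq x
  rw [map_add, map_mul, map_add, map_mul, hs, map_ratCast, map_ratCast, map_ratCast, map_ratCast]

include Q in
theorem isReal (w : InfinitePlace K) : w.IsReal := by
  rw [InfinitePlace.isReal_iff, ComplexEmbedding.isReal_iff]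
  ext x
  exact Q.conj_embedding _ x

/-- The real embedding attached to an infinite place. -/
def realEmb (w : InfinitePlace K) : K →+* ℝ := InfinitePlace.embedding_of_isReal (Q.isReal w)

theorem realEmb_injective {w w' : InfinitePlace K} (h : Q.realEmb w Q.s = Q.realEmb w' Q.s) :
    w = w' := by
  rw [← InfinitePlace.mk_embedding w, ← InfinitePlace.mk_embedding w']
  congr 1
  ext x
  rw [← InfinitePlace.embedding_of_isReal_apply (Q.isReal w),
    ← InfinitePlace.embedding_of_isReal_apply (Q.isReal w')]
  change ((Q.realEmb w x : ℝ) : ℂ) = (Q.realEmb w' x : ℝ)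
  congr 1
  obtain ⟨a, b, rfl⟩ := Q.exists_eq x
  rw [map_add, map_mul, map_add, map_mul, h, map_ratCast, map_ratCast, map_ratCast, map_ratCast]

theorem realEmb_of_ne {w w' : InfinitePlace K} (h : w ≠ w') (x : K) :
    Q.realEmb w' x = Q.realEmb w (Q.c x) := by
  have hs : Q.realEmb w' Q.s = -Q.realEmb w Q.s := by
    have : Q.realEmb w' Q.s ^ 2 = Q.realEmb w Q.s ^ 2 := by
      rw [← map_pow, ← map_pow, Q.s_sq, map_natCast, map_natCast]
    exact (sq_eq_sq_iff_eq_or_eq_neg.1 this).resolve_left fun e => h (Q.realEmb_injective e.symm)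
  obtain ⟨a, b, rfl⟩ := Q.exists_eq x
  rw [c_add_mul, map_add, map_mul, map_sub, map_mul, hs, map_ratCast, map_ratCast, map_ratCast,
    map_ratCast]
  ring

include Q in
theorem exists_infinitePlaces : ∃ w₀ w₁ : InfinitePlace K, w₀ ≠ w₁ ∧ ∀ w, w = w₀ ∨ w = w₁ := by
  classical
  have hR : IsTotallyReal K := ⟨Q.isReal⟩
  have h1 := IsTotallyReal.finrank K
  rw [Q.finrank_eq_two, InfinitePlace.nrRealPlaces] at h1
  have h2 : (Finset.univ : Finset {w : InfinitePlace K // w.IsReal}).card = 2 := by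
    rw [Finset.card_univ, h1]
  obtain ⟨x, y, hxy, h⟩ := Finset.card_eq_two.1 h2
  refine ⟨x, y, fun e => hxy (Subtype.ext e), fun w => ?_⟩
  have := h ▸ Finset.mem_univ (⟨w, Q.isReal w⟩ : {w : InfinitePlace K // w.IsReal})
  rw [Finset.mem_insert, Finset.mem_singleton] at this
  exact this.imp (congrArg Subtype.val) (congrArg Subtype.val)

/-- Two ordered infinite places together with a unit that is positive at the first one and negative
at the second one. -/
theorem exists_signed_unit : ∃ (w₀ w₁ : InfinitePlace K) (ε : (𝓞 K)ˣ), w₀ ≠ w₁ ∧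
    (∀ w, w = w₀ ∨ w = w₁) ∧ 0 < Q.realEmb w₀ (ε : 𝓞 K) ∧ Q.realEmb w₁ (ε : 𝓞 K) < 0 ∧
    (ε : 𝓞 K) * Q.conj ε = -1 := by
  obtain ⟨w₀, w₁, hne, hw⟩ := Q.exists_infinitePlaces
  obtain ⟨ε, hε⟩ := Q.exists_unit_norm_neg_one
  have hεu : IsUnit ε := IsUnit.of_mul_eq_one (-Q.conj ε) (by linear_combination -hε)
  have h1 : Q.realEmb w₀ ε * Q.realEmb w₁ ε = -1 := by
    rw [Q.realEmb_of_ne hne, ← map_mul]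
    have : ((ε : 𝓞 K) : K) * Q.c ε = -1 := by
      have := congrArg (algebraMap (𝓞 K) K) hε
      rwa [map_mul, map_neg, map_one] at this
    rw [this, map_neg, map_one]
  rcases lt_trichotomy 0 (Q.realEmb w₀ ε) with h | h | h
  · exact ⟨w₀, w₁, hεu.unit, hne, hw, h, by rw [IsUnit.unit_spec]; nlinarith, hε⟩
  · rw [← h, zero_mul] at h1
    norm_num at h1
  · exact ⟨w₁, w₀, hεu.unit, hne.symm, fun w => (hw w).symm,
      by rw [IsUnit.unit_spec]; nlinarith, h, hε⟩

theorem extensionEmbedding_globalUnit (w : InfinitePlace K) (η : (𝓞 K)ˣ) :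
    InfinitePlace.Completion.extensionEmbeddingOfIsReal (Q.isReal w) (infComp w (globalUnit η)) =
      Q.realEmb w (η : 𝓞 K) :=
  extensionEmbedding_infComp _ _

include Q in
-- The units `±1` and `±ε` realise all four sign patterns at the two real places, so signs can
-- always be absorbed by a global unit.
theorem exists_globalUnit_isSquare (x : Idele K) :
    ∃ η : (𝓞 K)ˣ, ∀ w, IsSquare ((x * globalUnit η).val.1 w) := by
  obtain ⟨w₀, w₁, ε, hne, hw, h0, h1, -⟩ := Q.exists_signed_unit
  set e := fun w => InfinitePlace.Completion.extensionEmbeddingOfIsReal (Q.isReal w)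
  have hx : ∀ w, e w (infComp w x) ≠ 0 := fun w => (map_ne_zero (e w)).2 (infComp w x).ne_zero
  suffices h : ∃ η : (𝓞 K)ˣ, 0 < e w₀ (infComp w₀ x) * Q.realEmb w₀ (η : 𝓞 K) ∧
      0 < e w₁ (infComp w₁ x) * Q.realEmb w₁ (η : 𝓞 K) by
    obtain ⟨η, hη0, hη1⟩ := h
    refine ⟨η, fun w => isSquare_of_pos (Q.isReal w) ?_⟩
    rw [← infComp_val, map_mul, Units.val_mul, map_mul, extensionEmbedding_globalUnit]
    rcases hw w with rfl | rfl
    · exact hη0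
    · exact hη1
  rcases (hx w₀).lt_or_gt with a | a <;> rcases (hx w₁).lt_or_gt with b | b
  · exact ⟨-1, by simpa using a, by simpa using b⟩
  · refine ⟨-ε, ?_, ?_⟩ <;>
      rw [Units.val_neg, show ((-(ε : 𝓞 K) : 𝓞 K) : K) = -((ε : 𝓞 K) : K) from rfl, map_neg,
        mul_neg, neg_pos]
    · exact mul_neg_of_neg_of_pos a h0
    · exact mul_neg_of_pos_of_neg b h1
  · exact ⟨ε, mul_pos a h0, mul_pos_of_neg_of_neg b h1⟩
  · exact ⟨1, by simpa using a, by simpa using b⟩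

/-- Sign characters with prescribed values on `-1` and on a unit of norm `-1`. -/
theorem exists_sign_characters {a b : Circle} (ha : a ^ 2 = 1) (hb : b ^ 2 = 1)
    {w₀ w₁ : InfinitePlace K} {ε : (𝓞 K)ˣ} (hne : w₀ ≠ w₁) (hw : ∀ w, w = w₀ ∨ w = w₁)
    (h0 : 0 < Q.realEmb w₀ (ε : 𝓞 K)) (h1 : Q.realEmb w₁ (ε : 𝓞 K) < 0) :
    ∃ φ : ∀ w : InfinitePlace K, (w.Completion)ˣ →* Circle,
      (∀ w (y : (w.Completion)ˣ), IsSquare (y : w.Completion) → φ w y = 1) ∧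
      (∀ w y, φ w y ^ 2 = 1) ∧ ∏ w, φ w (infComp w (globalUnit (-1))) = a ∧
      ∏ w, φ w (infComp w (globalUnit ε)) = b := by
  classical
  set f : Prop → ∀ w : InfinitePlace K, (w.Completion)ˣ →* Circle :=
    fun p w => if p then signChar (Q.isReal w) else 1 with hf
  have hf1 : ∀ p w (y : (w.Completion)ˣ), IsSquare (y : w.Completion) → f p w y = 1 := by
    intro p w y hy
    by_cases hp : p
    · rw [hf]; dsimp only; rw [if_pos hp]; exact signChar_of_isSquare _ hy
    · rw [hf]; dsimp only; rw [if_neg hp]; rfl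
  have hf2 : ∀ p w y, f p w y ^ 2 = 1 := by
    intro p w y
    by_cases hp : p
    · rw [hf]; dsimp only; rw [if_pos hp]; exact signChar_sq _ y
    · rw [hf]; dsimp only; rw [if_neg hp]; exact one_pow _
  have hneg : ∀ w, signChar (Q.isReal w) (infComp w (globalUnit (-1))) = -1 := fun w =>
    signChar_of_neg _ (by
      rw [Q.extensionEmbedding_globalUnit, Units.val_neg, Units.val_one,
        show ((-1 : 𝓞 K) : K) = -1 from rfl, map_neg, map_one]
      norm_num)
  have he0 : signChar (Q.isReal w₀) (infComp w₀ (globalUnit ε)) = 1 :=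
    signChar_of_pos _ (by rwa [extensionEmbedding_globalUnit])
  have he1 : signChar (Q.isReal w₁) (infComp w₁ (globalUnit ε)) = -1 :=
    signChar_of_neg _ (by rwa [extensionEmbedding_globalUnit])
  have hprod : ∀ (g : InfinitePlace K → Circle), ∏ w, g w = g w₀ * g w₁ := fun g =>
    Fintype.prod_eq_mul w₀ w₁ hne fun w h => ((hw w).elim h.1 h.2).elim
  -- The propositions `p` and `q` say whether the sign at `w₀` and at `w₁` is used. Since `ε` is
  -- negative only at `w₁`, its value depends on `q` alone, while `-1` sees both; so every pair of
  -- values is reached.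
  have key : ∀ p q : Prop, ∃ φ : ∀ w : InfinitePlace K, (w.Completion)ˣ →* Circle,
      (∀ w (y : (w.Completion)ˣ), IsSquare (y : w.Completion) → φ w y = 1) ∧
      (∀ w y, φ w y ^ 2 = 1) ∧ ∏ w, φ w (infComp w (globalUnit (-1))) =
        (if p then -1 else 1) * (if q then -1 else 1) ∧
      ∏ w, φ w (infComp w (globalUnit ε)) = if q then -1 else 1 := by
    intro p q
    refine ⟨fun w => f (w = w₀ ∧ p ∨ w = w₁ ∧ q) w, fun w => hf1 _ w, fun w => hf2 _ w, ?_, ?_⟩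
    · rw [hprod]
      by_cases hp : p <;> by_cases hq : q <;> simp [hf, hp, hq, hne, hne.symm, hneg]
    · rw [hprod]
      by_cases hp : p <;> by_cases hq : q <;> simp [hf, hp, hq, hne, hne.symm, he0, he1]
  rcases circle_eq_or_of_sq ha with rfl | rfl <;> rcases circle_eq_or_of_sq hb with rfl | rfl
  · simpa using key False False
  · simpa using key True True
  · simpa using key True False
  · simpa using key False True

include Q in
/-- Existence of quadratic characters with prescribed ramification at a single finite place. -/
theorem exists_quadratic_character (v : HeightOneSpectrum (𝓞 K))
    (ψ : (v.adicCompletion K)ˣ →* Circle) (n : ℕ)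
    (hn : ∀ u : (v.adicCompletion K)ˣ, Valued.v (u : v.adicCompletion K) = 1 →
      Lev Valued.v n ((u : v.adicCompletion K) - 1) → ψ u = 1) (hψ : ∀ u, ψ u ^ 2 = 1) :
    ∃ χ ∈ IdeleClassCharacter K, (∀ x, χ x ^ 2 = 1) ∧ ∀ x ∈ unitIdeles K,
      (∀ w, IsSquare (x.val.1 w)) → χ x = ψ (finComp v x) := by
  obtain ⟨w₀, w₁, ε, hne, hw, h0, h1, hε⟩ := Q.exists_signed_unit
  have hinv : ∀ u, ψ u * ψ u = 1 := fun u => by rw [← sq, hψ]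
  -- The sign characters copy the values of `ψ` at `-1` and `ε`; since these are `±1`, the products
  -- cancel.
  obtain ⟨φ, hφsq, hφ2, ha, hb⟩ := Q.exists_sign_characters
    (hψ (finComp v (globalUnit (-1)))) (hψ (finComp v (globalUnit ε))) hne hw h0 h1
  obtain ⟨χ, hχ, hχ2, hχu⟩ := exists_ideleClassCharacter v ψ n hn φ hφsq (by
    set Φ : (𝓞 K)ˣ → Circle := fun η => ψ (finComp v (globalUnit η)) *
      ∏ w, φ w (infComp w (globalUnit η)) with hΦ
    have hmul : ∀ η η', Φ (η * η') = Φ η * Φ η' := fun η η' => by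
      simp only [hΦ, map_mul, Finset.prod_mul_distrib]
      exact mul_mul_mul_comm _ _ _ _
    have hΦ1 : Φ (-1) = 1 := by rw [hΦ]; dsimp only; rw [ha, hinv]
    have hΦε : Φ ε = 1 := by rw [hΦ]; dsimp only; rw [hb, hinv]
    have hΦsq : ∀ η, Φ (η ^ 2) = 1 := fun η => by
      simp only [hΦ, map_pow, hψ, hφ2, Finset.prod_const_one, mul_one]
    intro u
    change Φ u = 1
    obtain ⟨η, hη, h⟩ := Q.exists_unit_eq hε u.isUnit
    rcases h with h | h | h | h
    · rw [show u = hη.unit ^ 2 from Units.ext h, hΦsq]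
    · rw [show u = -1 * hη.unit ^ 2 from Units.ext (by rw [h]; simp), hmul, hΦsq, hΦ1, one_mul]
    · rw [show u = ε * hη.unit ^ 2 from Units.ext (by rw [h]; simp), hmul, hΦsq, hΦε, one_mul]
    · rw [show u = -1 * (ε * hη.unit ^ 2) from Units.ext (by rw [h]; simp), hmul, hmul, hΦsq, hΦε,
        hΦ1, one_mul, one_mul]) 2 hψ hφ2 (Nat.odd_iff.1 Q.odd_classNumber)
  refine ⟨χ, hχ, hχ2, fun x hx hsq => ?_⟩
  rw [hχu x hx, Finset.prod_eq_one fun w _ => hφsq w _ (hsq w), mul_one]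

include Q in
/-- A quadratic character that is unramified at all finite places is trivial. -/
theorem eq_one_of_unramified {χ : Idele K →ₜ* Circle} (hχ : χ ∈ IdeleClassCharacter K)
    (h2 : ∀ x, χ x ^ 2 = 1)
    (h : ∀ v (u : (v.adicCompletion K)ˣ), Valued.v (u : v.adicCompletion K) = 1 →
      χ (localIdele v u) = 1) : χ = 1 := by
  classical
  obtain ⟨T, n, hT⟩ := exists_trivial_box two_pos χ h2
  -- Strip off the components at the finitely many places of `T`, where `χ` is unramified; the
  -- remainder is `1` there and lies in the box on which `χ` is trivial.
  have hA : ∀ x ∈ unitIdeles K, (∀ w, x.val.1 w = 1) → χ x = 1 := by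
    intro x hx hx1
    have hprod : ∀ v, finComp v (∏ t ∈ T, localIdele t (finComp t x)) =
        if v ∈ T then finComp v x else 1 := by
      intro v
      rw [map_prod]
      split_ifs with hv
      · rw [Finset.prod_eq_single v (fun t _ ht => finComp_localIdele_ne ht.symm _)
          fun h => absurd hv h, finComp_localIdele]
      · exact Finset.prod_eq_one fun t ht =>
          finComp_localIdele_ne (fun e => hv (by rwa [e])) _
    have hinf : ∀ w, infComp w (∏ t ∈ T, localIdele t (finComp t x)) = 1 := fun w => by
      rw [map_prod]
      exact Finset.prod_eq_one fun t _ => infComp_localIdele t _ w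
    set y := (∏ t ∈ T, localIdele t (finComp t x))⁻¹ * x with hy
    have hχP : χ (∏ t ∈ T, localIdele t (finComp t x)) = 1 := by
      rw [map_prod]
      exact Finset.prod_eq_one fun t _ => h t _ (hx t)
    have hyv : ∀ v, finComp v y = if v ∈ T then 1 else finComp v x := fun v => by
      rw [hy, map_mul, map_inv, hprod]
      split_ifs
      · exact inv_mul_cancel _
      · rw [inv_one, one_mul]
    have : χ y = 1 := by
      refine hT y (fun v => ?_) (fun w => ?_) fun v hv => ?_
      · rw [← finComp_val, hyv]
        split_ifs
        · exact map_one _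
        · exact hx v
      · rw [← infComp_val, hy, map_mul, map_inv, hinf, inv_one, one_mul]
        exact hx1 w
      · rw [← finComp_val, hyv, if_pos hv, Units.val_one, sub_self]
        exact Lev.zero n
    rwa [hy, map_mul, map_inv, hχP, inv_one, one_mul] at this
  -- A totally positive infinite part is the square of an idele, which a quadratic character does
  -- not see.
  have hB : ∀ x ∈ unitIdeles K, (∀ w, IsSquare (x.val.1 w)) → χ x = 1 := by
    intro x hx hsq
    choose r hr using hsq
    obtain ⟨y, hy1, hy2⟩ := exists_idele (F := K) r (fun _ => 1) (fun w h0 => by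
      have := hr w
      rw [h0, mul_zero] at this
      exact (infComp w x).ne_zero this) (fun _ => one_ne_zero)
      (Filter.Eventually.of_forall fun v => map_one _)
    have hfin : ∀ v, finComp v y = 1 := fun v => Units.ext (hy2 v)
    have hinf : ∀ w, infComp w y ^ 2 = infComp w x := fun w => Units.ext (by
      rw [sq, Units.val_mul, infComp_val, hy1, infComp_val, hr])
    have h1 : χ ((y ^ 2)⁻¹ * x) = 1 := by
      refine hA _ (fun v => ?_) fun w => ?_
      · rw [← finComp_val, map_mul, map_inv, map_pow, hfin, one_pow, inv_one, one_mul]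
        exact hx v
      · rw [← infComp_val, map_mul, map_inv, map_pow, hinf, inv_mul_cancel, Units.val_one]
    rwa [map_mul, map_inv, map_pow, h2, inv_one, one_mul] at h1
  have hC : ∀ x ∈ unitIdeles K, χ x = 1 := by
    intro x hx
    obtain ⟨η, hη⟩ := Q.exists_globalUnit_isSquare x
    have := hB _ (mul_mem hx (globalUnit_mem η)) hη
    rwa [map_mul, show χ (globalUnit η) = 1 from hχ _, mul_one] at this
  refine DFunLike.ext _ _ fun x => ?_
  -- The odd power `x ^ h` is principal times a unit idele, so `χ x ^ h = 1`, which together with `χ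
  -- x ^ 2 = 1` gives `χ x = 1`.
  obtain ⟨k, u, hu, hku⟩ := exists_pow_eq_principal_mul_unit x
  have h3 : χ x ^ classNumber K = 1 := by
    rw [← map_pow, hku, map_mul, hχ, hC u hu, one_mul]
  obtain ⟨j, hj⟩ := Q.odd_classNumber
  rw [hj, pow_add, pow_mul, h2, one_pow, one_mul, pow_one] at h3
  exact h3

end RealQuad

end QuadIdele

namespace QuadIdele

/-! ### Extensions of embeddings to completions -/

section CompletionHom

variable {F L M : Type*} [Field F] [NumberField F] [Field L] [NumberField L] [Field M]
  [NumberField M]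

/-- The embedding of a number field into a completion. -/
def emb (v : HeightOneSpectrum (𝓞 F)) : F →+* v.adicCompletion F :=
  algebraMap F (v.adicCompletion F)

theorem valued_emb (v : HeightOneSpectrum (𝓞 F)) (x : F) :
    Valued.v (emb v x) = v.valuation F x := valuedAdicCompletion_eq_valuation' v x

theorem finiteCompletionHom_emb (j : F →+* L) (v : HeightOneSpectrum (𝓞 F))
    (w : HeightOneSpectrum (𝓞 L)) (h : w.asIdeal.comap (RingOfIntegers.mapRingHom j) = v.asIdeal)
    (x : F) : finiteCompletionHom j v w h (emb v x) = emb w (j x) :=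
  finiteCompletionHom_coe j v w h x

theorem eq_of_eq_on_emb {v : HeightOneSpectrum (𝓞 F)} {T : Type*} [TopologicalSpace T] [T2Space T]
    {f g : v.adicCompletion F → T} (hf : Continuous f) (hg : Continuous g)
    (h : ∀ x : F, f (emb v x) = g (emb v x)) (x : v.adicCompletion F) : f x = g x :=
  congrFun ((denseRange_algebraMap F v).equalizer hf hg (funext h)) x

theorem finiteCompletionHom_comp (j : F →+* L) (j' : L →+* M) (j'' : F →+* M)
    (hj : ∀ x, j' (j x) = j'' x)
    (v : HeightOneSpectrum (𝓞 F)) (w : HeightOneSpectrum (𝓞 L)) (u : HeightOneSpectrum (𝓞 M))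
    (h : w.asIdeal.comap (RingOfIntegers.mapRingHom j) = v.asIdeal)
    (h' : u.asIdeal.comap (RingOfIntegers.mapRingHom j') = w.asIdeal)
    (h'' : u.asIdeal.comap (RingOfIntegers.mapRingHom j'') = v.asIdeal) (x : v.adicCompletion F) :
    finiteCompletionHom j' w u h' (finiteCompletionHom j v w h x) =
      finiteCompletionHom j'' v u h'' x := by
  refine eq_of_eq_on_emb (f := fun x => finiteCompletionHom j' w u h'
    (finiteCompletionHom j v w h x)) ((continuous_finiteCompletionHom _ _ _ _).comp
      (continuous_finiteCompletionHom _ _ _ _)) (continuous_finiteCompletionHom _ _ _ _)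
      (fun x => ?_) x
  rw [finiteCompletionHom_emb, finiteCompletionHom_emb, finiteCompletionHom_emb, hj]

/-- On the dense subfield this is the ramification index formula, and valuations are locally
constant away from `0`. -/
theorem exists_valued_finiteCompletionHom (j : F →+* L) (v : HeightOneSpectrum (𝓞 F))
    (w : HeightOneSpectrum (𝓞 L)) (h : w.asIdeal.comap (RingOfIntegers.mapRingHom j) = v.asIdeal) :
    ∃ e : ℕ, e ≠ 0 ∧ ∀ x, Valued.v (finiteCompletionHom j v w h x) = Valued.v x ^ e := by
  let _ : Algebra F L := j.toAlgebra
  have hlo : w.asIdeal.LiesOver v.asIdeal := ⟨h.symm⟩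
  refine ⟨v.asIdeal.ramificationIdx' w.asIdeal,
    Ideal.IsDedekindDomain.ramificationIdx'_ne_zero_of_liesOver w.asIdeal v.ne_bot, fun x => ?_⟩
  by_cases hx : x = 0
  · rw [hx, map_zero, map_zero, map_zero,
      zero_pow (Ideal.IsDedekindDomain.ramificationIdx'_ne_zero_of_liesOver w.asIdeal v.ne_bot)]
  have h1 : {y | Valued.v y = Valued.v x} ∈ nhds x :=
    Valued.locally_const ((Valuation.ne_zero_iff _).2 hx)
  have h2 : {y | Valued.v (finiteCompletionHom j v w h y) =
      Valued.v (finiteCompletionHom j v w h x)} ∈ nhds x :=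
    (continuous_finiteCompletionHom j v w h).continuousAt.preimage_mem_nhds
      (Valued.locally_const ((Valuation.ne_zero_iff _).2 ((map_ne_zero _).2 hx)))
  obtain ⟨a, ha1, ha2⟩ := (denseRange_algebraMap F v).mem_nhds (Filter.inter_mem h1 h2)
  rw [← show _ = _ from ha1, ← show _ = _ from ha2]
  change Valued.v (finiteCompletionHom j v w h (emb v a)) = Valued.v (emb v a) ^ _
  rw [finiteCompletionHom_emb, valued_emb, valued_emb]
  exact (valuation_liesOver L v w a).symm

end CompletionHom

theorem le_exp_neg_of_pow_le {e n : ℕ} (he : e ≠ 0) {a : WithZero (Multiplicative ℤ)}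
    (h : a ^ e ≤ WithZero.exp (-((e * n : ℕ) : ℤ))) : a ≤ WithZero.exp (-(n : ℤ)) := by
  refine (pow_le_pow_iff_left₀ zero_le zero_le he).1 (h.trans_eq ?_)
  rw [← WithZero.exp_nsmul]
  congr 1
  push_cast
  rw [nsmul_eq_mul]
  ring

/-! ### Places of `ℚ` -/

theorem rat_eq_intCast (x : 𝓞 ℚ) : ∃ n : ℤ, x = n :=
  ⟨Rat.ringOfIntegersEquiv x, Rat.ringOfIntegersEquiv.injective (by simp)⟩

theorem comap_eq_of_above {F : Type*} [Field F] [NumberField F] {v : HeightOneSpectrum (𝓞 F)}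
    {P : HeightOneSpectrum (𝓞 ℚ)} {p : ℕ} (hp : p.Prime) (hv : Above v p) (hP : Above P p) :
    v.asIdeal.comap (RingOfIntegers.mapRingHom (algebraMap ℚ F)) = P.asIdeal := by
  ext x
  obtain ⟨n, rfl⟩ := rat_eq_intCast x
  rw [Ideal.mem_comap, map_intCast, hv.intCast_mem_iff hp, hP.intCast_mem_iff hp]

theorem exists_above {F : Type*} [Field F] [NumberField F] {p : ℕ} (hp : p.Prime) :
    ∃ v : HeightOneSpectrum (𝓞 F), Above v p := by
  have htop : Ideal.span {(p : 𝓞 F)} ≠ ⊤ := by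
    intro h
    have h1 := Algebra.norm_algebraMap_of_basis (RingOfIntegers.basis F) (p : ℤ)
    have h2 := congrArg Ideal.absNorm h
    rw [Ideal.absNorm_span_singleton, show (p : 𝓞 F) = algebraMap ℤ (𝓞 F) (p : ℤ) by simp, h1,
      ← Module.finrank_eq_card_chooseBasisIndex, RingOfIntegers.rank, Int.natAbs_pow,
      Int.natAbs_natCast, Ideal.absNorm_top] at h2
    rcases Nat.pow_eq_one.1 h2 with h3 | h3
    · exact hp.ne_one h3
    · exact Module.finrank_pos.ne' h3
  obtain ⟨M, hM, hle⟩ := Ideal.exists_le_maximal _ htop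
  have hpM : (p : 𝓞 F) ∈ M := hle (Ideal.mem_span_singleton_self _)
  refine ⟨⟨M, hM.isPrime, fun h => ?_⟩, hpM⟩
  rw [h, Ideal.mem_bot] at hpM
  exact hp.ne_zero (by exact_mod_cast hpM)

theorem exists_comap_eq {F : Type*} [Field F] [NumberField F] (P : HeightOneSpectrum (𝓞 ℚ)) :
    ∃ v : HeightOneSpectrum (𝓞 F),
      v.asIdeal.comap (RingOfIntegers.mapRingHom (algebraMap ℚ F)) = P.asIdeal := by
  obtain ⟨p, hp, hP⟩ := exists_prime_mem P
  obtain ⟨v, hv⟩ := exists_above (F := F) hp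
  exact ⟨v, comap_eq_of_above hp hv hP⟩

theorem exists_below {F : Type*} [Field F] [NumberField F] (v : HeightOneSpectrum (𝓞 F)) :
    ∃ P : HeightOneSpectrum (𝓞 ℚ),
      v.asIdeal.comap (RingOfIntegers.mapRingHom (algebraMap ℚ F)) = P.asIdeal := by
  obtain ⟨p, hp, hv⟩ := exists_prime_mem v
  obtain ⟨P, hP⟩ := exists_above (F := ℚ) hp
  exact ⟨P, comap_eq_of_above hp hv hP⟩

theorem above_of_comap_eq {F : Type*} [Field F] [NumberField F] {v : HeightOneSpectrum (𝓞 F)}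
    {P : HeightOneSpectrum (𝓞 ℚ)} {p : ℕ}
    (h : v.asIdeal.comap (RingOfIntegers.mapRingHom (algebraMap ℚ F)) = P.asIdeal) :
    Above v p ↔ Above P p := by
  rw [Above, Above, ← h, Ideal.mem_comap, map_natCast]

namespace RealQuad

variable {K : Type*} [Field K] [NumberField K] (Q : RealQuad K)

/-! ### Local norms -/

section LocalNorm

variable {P : HeightOneSpectrum (𝓞 ℚ)} {v w : HeightOneSpectrum (𝓞 K)}
  (h : v.asIdeal.comap (RingOfIntegers.mapRingHom (algebraMap ℚ K)) = P.asIdeal)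
  (h' : w.asIdeal.comap (RingOfIntegers.mapRingHom (algebraMap ℚ K)) = P.asIdeal)
  (hw : v.asIdeal.comap (RingOfIntegers.mapRingHom (Q.c : K →+* K)) = w.asIdeal)

theorem comap_conjPlace (v : HeightOneSpectrum (𝓞 K)) :
    v.asIdeal.comap (RingOfIntegers.mapRingHom (Q.c : K →+* K)) =
      (conjPlace Q.c v).asIdeal := rfl

open scoped Valued in
/-- Subspaces of a completion of `K` over a completion of `ℚ` generated by finitely many elements
of `K` are closed. -/
theorem isClosed_base_range (S : Set (v.adicCompletion K)) (hS : S.Finite) :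
    IsClosed ((letI := (finiteCompletionHom (algebraMap ℚ K) P v h).toAlgebra
      Submodule.span (P.adicCompletion ℚ) S : Set (v.adicCompletion K))) := by
  let _ := (finiteCompletionHom (algebraMap ℚ K) P v h).toAlgebra
  have : ContinuousSMul (P.adicCompletion ℚ) (v.adicCompletion K) :=
    ⟨((continuous_finiteCompletionHom _ _ _ h).comp continuous_fst).mul continuous_snd⟩
  have := FiniteDimensional.span_of_finite (P.adicCompletion ℚ) hS
  exact Submodule.closed_of_finiteDimensional _

/-- The span of `1` and `√d` over the completion of `ℚ` is closed, being finite-dimensional, and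
contains the dense field `K`. -/
theorem exists_base_add_base_mul (x : v.adicCompletion K) : ∃ a b : P.adicCompletion ℚ,
    x = finiteCompletionHom (algebraMap ℚ K) P v h a +
      finiteCompletionHom (algebraMap ℚ K) P v h b * emb v Q.s := by
  let _ := (finiteCompletionHom (algebraMap ℚ K) P v h).toAlgebra
  have hcl := isClosed_base_range h {1, emb v Q.s} (by simp)
  have hx : x ∈ Submodule.span (P.adicCompletion ℚ) {1, emb v Q.s} := by
    refine hcl.closure_subset_iff.2 ?_ (denseRange_algebraMap K v x)
    rintro _ ⟨y, rfl⟩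
    obtain ⟨a, b, rfl⟩ := Q.exists_eq y
    refine Submodule.mem_span_pair.2 ⟨emb P a, emb P b, ?_⟩
    rw [Algebra.smul_def, Algebra.smul_def, RingHom.algebraMap_toAlgebra, finiteCompletionHom_emb,
      finiteCompletionHom_emb, mul_one, ← map_mul, ← map_add]
    rfl
  obtain ⟨a, b, hab⟩ := Submodule.mem_span_pair.1 hx
  refine ⟨a, b, ?_⟩
  rw [← hab, Algebra.smul_def, Algebra.smul_def, mul_one]
  rfl

include Q in
-- At a split place `√d` is a limit of rational numbers. Choose `x` in `v` but not in its conjugate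
-- and put `y = x / c x`, so that `c y = y⁻¹` and `y` has valuation below `1`. Then `√d * (1 - y ^
-- n) / (1 + y ^ n)` is fixed by `c`, hence rational, and tends to `√d`.
theorem exists_base_eq_s (hv : conjPlace Q.c v ≠ v) : ∃ σ : P.adicCompletion ℚ,
    finiteCompletionHom (algebraMap ℚ K) P v h σ = emb v Q.s := by
  let _ := (finiteCompletionHom (algebraMap ℚ K) P v h).toAlgebra
  have hcl := isClosed_base_range h {1} (by simp)
  have hx : emb v Q.s ∈ Submodule.span (P.adicCompletion ℚ) {1} := by
    obtain ⟨x, hxv, hxc⟩ : ∃ x ∈ v.asIdeal, x ∉ (conjPlace Q.c v).asIdeal := by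
      by_contra! hcon
      exact hv (eq_of_asIdeal_le hcon).symm
    set y : K := x / Q.c x with hy
    have hx1 : v.valuation K (x : K) < 1 := (valuation_lt_one_iff_mem v x).2 hxv
    have hcx1 : v.valuation K (Q.c x) = 1 := by
      refine le_antisymm (valuation_le_one v (Q.conj x)) (not_lt.1 fun hlt => hxc ?_)
      rw [mem_conjPlace]
      exact (valuation_lt_one_iff_mem v (Q.conj x)).1 hlt
    have hcx0 : Q.c x ≠ 0 := fun h0 => by rw [h0, map_zero] at hcx1; exact zero_ne_one hcx1
    have hx0 : (x : K) ≠ 0 := fun h0 => hcx0 (by rw [h0, map_zero])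
    have hy1 : Lev (v.valuation K) 1 y := by
      rw [lev_one_iff, hy, map_div₀, hcx1, div_one]
      exact hx1
    have hcy : Q.c y = y⁻¹ := by rw [hy, map_div₀, c_c, inv_div]
    have hy0 : y ≠ 0 := div_ne_zero hx0 hcx0
    refine hcl.closure_subset (mem_closure_iff_nhds.2 fun t ht => ?_)
    obtain ⟨n, hn⟩ := exists_lev_of_mem_nhds ht
    have hyn : Lev (v.valuation K) (n + 1) (y ^ (n + 1)) := by
      simpa using hy1.pow (n + 1)
    have hden : v.valuation K (1 + y ^ (n + 1)) = 1 := by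
      refine (v.valuation K).map_one_add_of_lt ?_
      exact (lev_one_iff (V := v.valuation K)).1 (hyn.mono (Nat.le_add_left 1 n))
    have hden0 : 1 + y ^ (n + 1) ≠ 0 := fun h0 => by
      rw [h0, map_zero] at hden; exact zero_ne_one hden
    set z : K := Q.s * (1 - y ^ (n + 1)) / (1 + y ^ (n + 1)) with hz
    have hcz : Q.c z = z := by
      have e : 1 + (y⁻¹) ^ (n + 1) ≠ 0 := by
        rw [inv_pow]
        intro h0
        apply hden0
        field_simp at h0
        linear_combination h0
      rw [hz, map_div₀, map_mul, map_sub, map_add, map_one, map_pow, hcy, Q.c_s,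
        div_eq_div_iff e hden0, inv_pow]
      field_simp
      ring
    obtain ⟨q, hq⟩ := Q.exists_rat_of_fixed hcz
    refine ⟨emb v z, hn _ ?_, ?_⟩
    · rw [← map_sub, Lev, valued_emb]
      have e : z - Q.s = -(2 * Q.s * y ^ (n + 1)) / (1 + y ^ (n + 1)) := by
        rw [hz]
        field_simp
        ring
      rw [e, map_div₀, hden, div_one, Valuation.map_neg, map_mul]
      refine (mul_le_of_le_one_left' ?_).trans (hyn.mono (by omega))
      exact_mod_cast valuation_le_one v (2 * Q.sInt)
    · refine Submodule.mem_span_singleton.2 ⟨emb P q, ?_⟩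
      rw [Algebra.smul_def, RingHom.algebraMap_toAlgebra, finiteCompletionHom_emb, mul_one, hq]
      rfl
  obtain ⟨σ, hσ⟩ := Submodule.mem_span_singleton.1 hx
  exact ⟨σ, by rw [← hσ, Algebra.smul_def, mul_one]; rfl⟩

theorem base_surjective (hv : conjPlace Q.c v ≠ v) :
    Function.Surjective (finiteCompletionHom (algebraMap ℚ K) P v h) := by
  intro x
  obtain ⟨σ, hσ⟩ := Q.exists_base_eq_s h hv
  obtain ⟨a, b, rfl⟩ := Q.exists_base_add_base_mul h x
  exact ⟨a + b * σ, by rw [map_add, map_mul, hσ]⟩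

theorem norm_of_surjective {A B : Type*} [Field A] [Field B] (i : A →+* B)
    (hi : Function.Surjective i) (x : B) :
    i (letI := i.toAlgebra; Algebra.norm A x) = x := by
  let _ := i.toAlgebra
  obtain ⟨a, rfl⟩ := hi x
  have hf : Module.finrank A B = 1 := by
    rw [← Module.finrank_self A]
    exact ((AlgEquiv.ofBijective (Algebra.ofId A B) ⟨i.injective, hi⟩).toLinearEquiv.finrank_eq).symm
  have := Algebra.norm_algebraMap (R := A) (S := B) a
  rw [hf, pow_one] at this
  exact congrArg i this

theorem base_norm_of_split (hv : conjPlace Q.c v ≠ v) (x : v.adicCompletion K) :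
    finiteCompletionHom (algebraMap ℚ K) P v h (finiteLocalNorm ℚ K P v h x) = x :=
  norm_of_surjective _ (Q.base_surjective h hv) x

theorem conj_base (x : P.adicCompletion ℚ) :
    finiteCompletionHom (Q.c : K →+* K) w v hw (finiteCompletionHom (algebraMap ℚ K) P w h' x) =
      finiteCompletionHom (algebraMap ℚ K) P v h x :=
  finiteCompletionHom_comp _ _ _ (fun x => Q.c_ratCast x) _ _ _ _ _ _ x

/-- Conjugation extends to the completion, fixes the base and negates `√d`; therefore `1, √d`
remains independent and is a basis. The determinant of multiplication by `a + b√d` is `a ^ 2 - d * b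
^ 2`. -/
theorem base_norm_of_nonsplit
    (hv : v.asIdeal.comap (RingOfIntegers.mapRingHom (Q.c : K →+* K)) = v.asIdeal)
    (x : v.adicCompletion K) :
    finiteCompletionHom (algebraMap ℚ K) P v h (finiteLocalNorm ℚ K P v h x) =
      x * finiteCompletionHom (Q.c : K →+* K) v v hv x := by
  set i := finiteCompletionHom (algebraMap ℚ K) P v h
  set κ := finiteCompletionHom (Q.c : K →+* K) v v hv
  have hκi : ∀ a, κ (i a) = i a := Q.conj_base h h hv
  set s := emb v Q.s with hs
  have hκs : κ s = -s := by rw [hs, finiteCompletionHom_emb]; exact (congrArg _ Q.c_s).trans (map_neg _ _)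
  have hs2 : s ^ 2 = i (Q.d : P.adicCompletion ℚ) := by
    rw [hs, ← map_pow, Q.s_sq, map_natCast, map_natCast]
  have hs0 : s ≠ 0 := (map_ne_zero _).2 Q.s_ne_zero
  have h2 : (2 : v.adicCompletion K) ≠ 0 := by
    have : (2 : v.adicCompletion K) = emb v 2 := (map_ofNat _ 2).symm
    rw [this]
    exact (map_ne_zero _).2 two_ne_zero
  let _ := i.toAlgebra
  have hli : LinearIndependent (P.adicCompletion ℚ) ![(1 : v.adicCompletion K), s] := by
    rw [LinearIndependent.pair_iff]
    intro a b hab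
    have h1 : i a + i b * s = 0 := by
      rw [Algebra.smul_def, Algebra.smul_def, mul_one] at hab
      exact hab
    have h3 := congrArg κ h1
    rw [map_add, map_mul, hκi, hκi, hκs, map_zero] at h3
    have ha : 2 * i a = 0 := by linear_combination h1 + h3
    have hb : 2 * (i b * s) = 0 := by linear_combination h1 - h3
    exact ⟨(map_eq_zero i).1 ((mul_eq_zero.1 ha).resolve_left h2),
      (map_eq_zero i).1 ((mul_eq_zero.1 ((mul_eq_zero.1 hb).resolve_left h2)).resolve_right hs0)⟩
  have hsp : ⊤ ≤ Submodule.span (P.adicCompletion ℚ) (Set.range ![(1 : v.adicCompletion K), s]) := by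
    intro x _
    obtain ⟨a, b, rfl⟩ := Q.exists_base_add_base_mul h x
    rw [Matrix.range_cons_cons_empty]
    refine Submodule.mem_span_pair.2 ⟨a, b, ?_⟩
    rw [Algebra.smul_def, Algebra.smul_def, mul_one]
    rfl
  set B := Module.Basis.mk hli hsp with hB
  have hB0 : B 0 = 1 := by rw [hB, Module.Basis.mk_apply]; rfl
  have hB1 : B 1 = s := by rw [hB, Module.Basis.mk_apply]; rfl
  have hrepr : ∀ a b : P.adicCompletion ℚ, B.repr (i a + i b * s) 0 = a ∧
      B.repr (i a + i b * s) 1 = b := by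
    intro a b
    have e : i a + i b * s = a • B 0 + b • B 1 := by
      rw [hB0, hB1, Algebra.smul_def, Algebra.smul_def, mul_one]
      rfl
    rw [e]
    simp
  obtain ⟨a, b, rfl⟩ := Q.exists_base_add_base_mul h x
  have hmul0 : (i a + i b * s) * B 0 = i a + i b * s := by rw [hB0, mul_one]
  have hmul1 : (i a + i b * s) * B 1 = i (b * Q.d) + i a * s := by
    rw [hB1, map_mul, ← hs2]
    ring
  have hnorm : finiteLocalNorm ℚ K P v h (i a + i b * s) = a * a - b * Q.d * b := by
    change Algebra.norm (P.adicCompletion ℚ) (i a + i b * s) = _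
    rw [Algebra.norm_eq_matrix_det B, Matrix.det_fin_two]
    simp only [Algebra.leftMulMatrix_eq_repr_mul]
    rw [hmul0, hmul1, (hrepr _ _).1, (hrepr _ _).2, (hrepr _ _).1, (hrepr _ _).2]
  change i (finiteLocalNorm ℚ K P v h (i a + i b * s)) = (i a + i b * s) * κ (i a + i b * s)
  rw [hnorm, map_sub, map_mul, map_mul, map_mul, ← hs2, map_add, map_mul, hκi, hκi, hκs]
  ring

end LocalNorm

end RealQuad

end QuadIdele

namespace QuadIdele

namespace RealQuad

variable {K : Type*} [Field K] [NumberField K] (Q : RealQuad K)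

/-! ### The idele norm -/

theorem eq_one_of_pow_eq_one {e : ℕ} (he : e ≠ 0) {a : WithZero (Multiplicative ℤ)}
    (h : a ^ e = 1) : a = 1 :=
  (pow_left_inj₀ zero_le zero_le he).1 (h.trans (one_pow e).symm)

theorem comap_eq_iff_of_comap_eq {P : HeightOneSpectrum (𝓞 ℚ)} {v w : HeightOneSpectrum (𝓞 K)}
    (h : v.asIdeal.comap (RingOfIntegers.mapRingHom (algebraMap ℚ K)) = P.asIdeal) :
    w.asIdeal.comap (RingOfIntegers.mapRingHom (algebraMap ℚ K)) = P.asIdeal ↔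
      w = v ∨ w = conjPlace Q.c v := by
  obtain ⟨p, hp, hP⟩ := exists_prime_mem P
  have hv := (above_of_comap_eq h).2 hP
  constructor
  · intro h'
    exact Q.eq_or_eq_conjPlace hp hv ((above_of_comap_eq h').2 hP)
  · rintro (rfl | rfl)
    · exact h
    · exact comap_eq_of_above hp (Q.above_conjPlace hv) hP

/-- One formula for both splitting types: seen in `K_v`, the norm is `x_v` times the conjugate of
the component at the conjugate place. All later computations with the idele norm use it in place of
algebra norms. -/
theorem base_finprod {P : HeightOneSpectrum (𝓞 ℚ)} {v w : HeightOneSpectrum (𝓞 K)}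
    (h : v.asIdeal.comap (RingOfIntegers.mapRingHom (algebraMap ℚ K)) = P.asIdeal)
    (hw : v.asIdeal.comap (RingOfIntegers.mapRingHom (Q.c : K →+* K)) = w.asIdeal)
    (x : ∀ u : HeightOneSpectrum (𝓞 K), u.adicCompletion K) :
    finiteCompletionHom (algebraMap ℚ K) P v h
      (∏ᶠ u : {u : HeightOneSpectrum (𝓞 K) //
        u.asIdeal.comap (RingOfIntegers.mapRingHom (algebraMap ℚ K)) = P.asIdeal},
        finiteLocalNorm ℚ K P u.1 u.2 (x u.1)) =
      x v * finiteCompletionHom (Q.c : K →+* K) w v hw (x w) := by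
  classical
  have hwc : w = conjPlace Q.c v := HeightOneSpectrum.ext hw.symm
  have h' := (Q.comap_eq_iff_of_comap_eq h (w := w)).2 (Or.inr hwc)
  by_cases hvw : w = v
  · subst hvw
    rw [finprod_eq_single _ (⟨w, h⟩ : {u : HeightOneSpectrum (𝓞 K) //
      u.asIdeal.comap (RingOfIntegers.mapRingHom (algebraMap ℚ K)) = P.asIdeal})]
    · exact Q.base_norm_of_nonsplit h hw _
    · rintro ⟨u, hu⟩ hne
      refine absurd (Subtype.ext ?_) hne
      exact ((Q.comap_eq_iff_of_comap_eq h).1 hu).elim id fun e => e.trans hwc.symm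
  · rw [finprod_eq_prod_of_mulSupport_subset (s := {⟨v, h⟩, ⟨w, h'⟩})]
    · rw [Finset.prod_pair fun e => hvw (congrArg Subtype.val e).symm, map_mul]
      congr 1
      · exact Q.base_norm_of_split h (by rwa [← hwc]) _
      · rw [← Q.conj_base h h' hw]
        congr 1
        refine Q.base_norm_of_split h' ?_ _
        rw [hwc, conjPlace_conjPlace]
        exact fun e => hvw (hwc.trans e.symm)
    · rintro ⟨u, hu⟩ -
      rcases (Q.comap_eq_iff_of_comap_eq h).1 hu with e | e
      · simp [e]
      · simp [e, hwc]

theorem rat_infinite_comap (p : InfinitePlace ℚ) (w : InfinitePlace K) :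
    w.comap (algebraMap ℚ K) = p := Subsingleton.elim _ _

theorem infiniteLocalNorm_ne_zero (p : InfinitePlace ℚ) (w : InfinitePlace K)
    (h : w.comap (algebraMap ℚ K) = p) {x : w.Completion} (hx : x ≠ 0) :
    infiniteLocalNorm ℚ K p w h x ≠ 0 :=
  ((IsUnit.mk0 x hx).map (infiniteLocalNorm ℚ K p w h)).ne_zero

theorem extensionEmbedding_infiniteLocalNorm (p : InfinitePlace ℚ) (w : InfinitePlace K)
    (h : w.comap (algebraMap ℚ K) = p) (x : w.Completion) :
    InfinitePlace.Completion.extensionEmbeddingOfIsReal (IsTotallyReal.isReal p)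
      (infiniteLocalNorm ℚ K p w h x) =
      InfinitePlace.Completion.extensionEmbeddingOfIsReal (Q.isReal w) x := by
  set e := InfinitePlace.Completion.ringEquivRealOfIsReal (IsTotallyReal.isReal p)
  set f := InfinitePlace.Completion.ringEquivRealOfIsReal (Q.isReal w)
  set i := infiniteCompletionHom (algebraMap ℚ K) p w h
  have hi : ∀ a, f (i a) = e a := by
    intro a
    -- The identity is the only ring endomorphism of `ℝ`, so the identifications of the two
    -- completions with `ℝ` are compatible.
    have := DFunLike.congr_fun (Subsingleton.elim
      (((f : w.Completion →+* ℝ).comp i).comp (e.symm : ℝ →+* p.Completion)) (RingHom.id ℝ)) (e a)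
    change f (i (e.symm (e a))) = e a at this
    rwa [RingEquiv.symm_apply_apply] at this
  have hs : Function.Surjective i := fun z => ⟨e.symm (f z), f.injective (by simp [hi])⟩
  have := norm_of_surjective i hs x
  change e (infiniteLocalNorm ℚ K p w h x) = f x
  rw [← hi]
  exact congrArg f this

include Q in
theorem exists_ideleNorm (x : Idele K) : ∃ y : Idele ℚ, IsIdeleNorm ℚ K x y := by
  set b : ∀ P : HeightOneSpectrum (𝓞 ℚ), P.adicCompletion ℚ := fun P =>
    ∏ᶠ v : {v : HeightOneSpectrum (𝓞 K) //
      v.asIdeal.comap (RingOfIntegers.mapRingHom (algebraMap ℚ K)) = P.asIdeal},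
      finiteLocalNorm ℚ K P v.1 v.2 (x.val.2 v.1) with hb
  have hbase : ∀ (P) (v : HeightOneSpectrum (𝓞 K)) (h), finiteCompletionHom (algebraMap ℚ K) P v h
      (b P) = _ := fun P v h => Q.base_finprod h (Q.comap_conjPlace v) fun u => x.val.2 u
  have hx0 : ∀ v, x.val.2 v ≠ 0 := fun v => (finComp v x).ne_zero
  obtain ⟨y, hy1, hy2⟩ := exists_idele (F := ℚ) (fun p => ∏ᶠ v : {v : InfinitePlace K //
      v.comap (algebraMap ℚ K) = p}, infiniteLocalNorm ℚ K p v.1 v.2 (x.val.1 v.1)) b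
    (fun p => finprod_induction (p := (· ≠ 0)) one_ne_zero (fun _ _ => mul_ne_zero)
      fun w => infiniteLocalNorm_ne_zero _ _ _ (infComp w.1 x).ne_zero)
    (fun P h0 => by
      obtain ⟨v, h⟩ := exists_comap_eq (F := K) P
      have := hbase P v h
      rw [h0, map_zero] at this
      exact mul_ne_zero (hx0 _) ((map_ne_zero _).2 (hx0 _)) this.symm) (by
      have hfin := eventually_unit x
      rw [Filter.eventually_cofinite] at hfin ⊢
      have hinj : Function.Injective (conjPlace Q.c) := (Equiv.injective _)
      choose g hg using exists_below (F := K)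
      -- The norm can fail to be a unit only below a place `v` where the component of `x` at `v` or
      -- at its conjugate is not a unit.
      refine (((hfin.union (hfin.preimage hinj.injOn)).image g)).subset fun P hP => ?_
      obtain ⟨v, h⟩ := exists_comap_eq (F := K) P
      refine ⟨v, ?_, HeightOneSpectrum.ext ((hg v).symm.trans h)⟩
      by_contra hcon
      rw [Set.mem_union, not_or] at hcon
      have h1 : Valued.v (x.val.2 v) = 1 := not_not.1 hcon.1
      have h2 : Valued.v (x.val.2 (conjPlace Q.c v)) = 1 := not_not.1 hcon.2
      obtain ⟨e, he, hev⟩ := exists_valued_finiteCompletionHom (algebraMap ℚ K) P v h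
      obtain ⟨e', he', hev'⟩ := exists_valued_finiteCompletionHom _ _ _ (Q.comap_conjPlace v)
      have h3 := congrArg Valued.v (hbase P v h)
      rw [hev, map_mul, hev', h1, h2, one_pow, one_mul] at h3
      exact hP (eq_one_of_pow_eq_one he h3))
  exact ⟨y, hy2, hy1⟩

theorem IsIdeleNorm.unique {x : Idele K} {y y' : Idele ℚ} (h : IsIdeleNorm ℚ K x y)
    (h' : IsIdeleNorm ℚ K x y') : y = y' :=
  idele_ext (fun P => Units.ext ((h.1 P).trans (h'.1 P).symm))
    fun p => Units.ext ((h.2 p).trans (h'.2 p).symm)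

theorem base_of_isIdeleNorm {x : Idele K} {y : Idele ℚ} (hxy : IsIdeleNorm ℚ K x y)
    {P : HeightOneSpectrum (𝓞 ℚ)} {v w : HeightOneSpectrum (𝓞 K)}
    (h : v.asIdeal.comap (RingOfIntegers.mapRingHom (algebraMap ℚ K)) = P.asIdeal)
    (hw : v.asIdeal.comap (RingOfIntegers.mapRingHom (Q.c : K →+* K)) = w.asIdeal) :
    finiteCompletionHom (algebraMap ℚ K) P v h (y.val.2 P) =
      x.val.2 v * finiteCompletionHom (Q.c : K →+* K) w v hw (x.val.2 w) := by
  rw [hxy.1 P]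
  exact Q.base_finprod h hw fun u => x.val.2 u

/-- A multiplicativity criterion for ideles to be norms. -/
theorem isIdeleNorm_of_base {x : Idele K} {y : Idele ℚ}
    (hf : ∀ (P : HeightOneSpectrum (𝓞 ℚ)) (v : HeightOneSpectrum (𝓞 K)) (h),
      finiteCompletionHom (algebraMap ℚ K) P v h (y.val.2 P) =
        x.val.2 v * finiteCompletionHom (Q.c : K →+* K) _ v (Q.comap_conjPlace v)
          (x.val.2 (conjPlace Q.c v)))
    (hi : ∀ p : InfinitePlace ℚ, y.val.1 p = ∏ᶠ v : {v : InfinitePlace K //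
      v.comap (algebraMap ℚ K) = p}, infiniteLocalNorm ℚ K p v.1 v.2 (x.val.1 v.1)) :
    IsIdeleNorm ℚ K x y := by
  refine ⟨fun P => ?_, hi⟩
  obtain ⟨v, h⟩ := exists_comap_eq (F := K) P
  refine (finiteCompletionHom (algebraMap ℚ K) P v h).injective ?_
  rw [hf]
  exact (Q.base_finprod h (Q.comap_conjPlace v) fun u => x.val.2 u).symm

include Q in
theorem isIdeleNorm_one : IsIdeleNorm ℚ K 1 1 := by
  refine Q.isIdeleNorm_of_base (fun P v h => ?_) fun p => ?_
  · rw [← finComp_val, ← finComp_val, ← finComp_val, map_one, map_one, map_one, Units.val_one,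
      Units.val_one, Units.val_one, map_one, map_one, one_mul]
  · rw [← infComp_val, map_one, Units.val_one]
    refine (finprod_eq_one_of_forall_eq_one fun v => ?_).symm
    rw [← infComp_val, map_one, Units.val_one, map_one]

include Q in
theorem IsIdeleNorm.mul {x x' : Idele K} {y y' : Idele ℚ} (h : IsIdeleNorm ℚ K x y)
    (h' : IsIdeleNorm ℚ K x' y') : IsIdeleNorm ℚ K (x * x') (y * y') := by
  refine Q.isIdeleNorm_of_base (fun P v hv => ?_) fun p => ?_
  · rw [← finComp_val, ← finComp_val, ← finComp_val, map_mul, map_mul, map_mul, Units.val_mul,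
      Units.val_mul, Units.val_mul, map_mul, map_mul, finComp_val, finComp_val,
      Q.base_of_isIdeleNorm h hv (Q.comap_conjPlace v),
      Q.base_of_isIdeleNorm h' hv (Q.comap_conjPlace v)]
    exact mul_mul_mul_comm _ _ _ _
  · rw [← infComp_val, map_mul, Units.val_mul, infComp_val, infComp_val, h.2, h'.2,
      ← finprod_mul_distrib (Set.toFinite _) (Set.toFinite _)]
    refine finprod_congr fun v => ?_
    rw [← infComp_val, ← infComp_val, ← infComp_val, map_mul (infComp v.1), Units.val_mul, map_mul]

/-- The idele norm from `K` to `ℚ`. -/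
def norm : Idele K →* Idele ℚ where
  toFun x := (Q.exists_ideleNorm x).choose
  map_one' := IsIdeleNorm.unique (Q.exists_ideleNorm 1).choose_spec Q.isIdeleNorm_one
  map_mul' x y := IsIdeleNorm.unique (Q.exists_ideleNorm (x * y)).choose_spec
    (IsIdeleNorm.mul Q (Q.exists_ideleNorm x).choose_spec (Q.exists_ideleNorm y).choose_spec)

theorem isIdeleNorm_norm (x : Idele K) : IsIdeleNorm ℚ K x (Q.norm x) :=
  (Q.exists_ideleNorm x).choose_spec

theorem base_norm (x : Idele K) {P : HeightOneSpectrum (𝓞 ℚ)} {v w : HeightOneSpectrum (𝓞 K)}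
    (h : v.asIdeal.comap (RingOfIntegers.mapRingHom (algebraMap ℚ K)) = P.asIdeal)
    (hw : v.asIdeal.comap (RingOfIntegers.mapRingHom (Q.c : K →+* K)) = w.asIdeal) :
    finiteCompletionHom (algebraMap ℚ K) P v h ((Q.norm x).val.2 P) =
      x.val.2 v * finiteCompletionHom (Q.c : K →+* K) w v hw (x.val.2 w) :=
  Q.base_of_isIdeleNorm (Q.isIdeleNorm_norm x) h hw

theorem extensionEmbedding_norm (x : Idele K) (p : InfinitePlace ℚ) {w₀ w₁ : InfinitePlace K}
    (hne : w₀ ≠ w₁) (hw : ∀ w, w = w₀ ∨ w = w₁) :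
    InfinitePlace.Completion.extensionEmbeddingOfIsReal (IsTotallyReal.isReal p)
      ((Q.norm x).val.1 p) =
      InfinitePlace.Completion.extensionEmbeddingOfIsReal (Q.isReal w₀) (x.val.1 w₀) *
      InfinitePlace.Completion.extensionEmbeddingOfIsReal (Q.isReal w₁) (x.val.1 w₁) := by
  classical
  rw [(Q.isIdeleNorm_norm x).2 p, finprod_eq_prod_of_mulSupport_subset
    (s := {⟨w₀, rat_infinite_comap p w₀⟩, ⟨w₁, rat_infinite_comap p w₁⟩}),
    Finset.prod_pair fun e => hne (congrArg Subtype.val e), map_mul]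
  · rw [Q.extensionEmbedding_infiniteLocalNorm, Q.extensionEmbedding_infiniteLocalNorm]
  · rintro ⟨u, hu⟩ -
    rcases hw u with e | e
    · simp [e]
    · simp [e]

theorem isSquare_norm {x : Idele K} (hx : ∀ w, IsSquare (x.val.1 w)) (p : InfinitePlace ℚ) :
    IsSquare ((Q.norm x).val.1 p) := by
  rw [(Q.isIdeleNorm_norm x).2 p]
  exact finprod_induction (p := IsSquare) (IsSquare.one) (fun _ _ => IsSquare.mul)
    fun w => (hx w.1).map _

theorem norm_principal (k : Kˣ) : ∃ q : ℚˣ, Q.norm (principalIdele K k) = principalIdele ℚ q := by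
  obtain ⟨q, hq⟩ := Q.exists_rat_of_fixed (x := (k : K) * Q.c k) (by
    rw [map_mul, c_c, mul_comm])
  have hq0 : q ≠ 0 := by
    rintro rfl
    rw [Rat.cast_zero] at hq
    exact mul_ne_zero k.ne_zero ((map_ne_zero _).2 k.ne_zero) hq
  refine ⟨Units.mk0 q hq0, idele_ext (fun P => Units.ext ?_) fun p => Units.ext ?_⟩
  · obtain ⟨v, h⟩ := exists_comap_eq (F := K) P
    refine (finiteCompletionHom (algebraMap ℚ K) P v h).injective ?_
    rw [finComp_val, Q.base_norm _ h (Q.comap_conjPlace v)]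
    change emb v k * finiteCompletionHom (Q.c : K →+* K) _ v (Q.comap_conjPlace v) (emb _ k) =
      finiteCompletionHom (algebraMap ℚ K) P v h (emb P q)
    rw [finiteCompletionHom_emb, finiteCompletionHom_emb, ← map_mul]
    exact congrArg _ hq
  · obtain ⟨w₀, w₁, hne, hw⟩ := Q.exists_infinitePlaces
    refine (InfinitePlace.Completion.extensionEmbeddingOfIsReal
      (IsTotallyReal.isReal p)).injective ?_
    rw [extensionEmbedding_infComp, infComp_val, Q.extensionEmbedding_norm _ p hne hw,
      ← infComp_val, ← infComp_val, extensionEmbedding_infComp, extensionEmbedding_infComp]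
    change Q.realEmb w₀ k * Q.realEmb w₁ k = _
    rw [Q.realEmb_of_ne hne, ← map_mul, hq, map_ratCast, Units.val_mk0, eq_ratCast]

theorem fromBaseChange_iff (μ : Idele K →ₜ* Circle) :
    FromBaseChange μ ↔ ∃ ν ∈ IdeleClassCharacter ℚ, ∀ x, μ x = ν (Q.norm x) := by
  constructor
  · rintro ⟨ν, hν, h⟩
    refine ⟨ν, hν, fun x => ?_⟩
    obtain ⟨y, hy, e⟩ := h x
    rw [e, IsIdeleNorm.unique hy (Q.isIdeleNorm_norm x)]
  · rintro ⟨ν, hν, h⟩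
    exact ⟨ν, hν, fun x => ⟨_, Q.isIdeleNorm_norm x, h x⟩⟩

theorem valued_norm {x : Idele K} (hx : x ∈ unitIdeles K) : Q.norm x ∈ unitIdeles ℚ := by
  intro P
  obtain ⟨v, h⟩ := exists_comap_eq (F := K) P
  obtain ⟨e, he, hev⟩ := exists_valued_finiteCompletionHom (algebraMap ℚ K) P v h
  obtain ⟨e', he', hev'⟩ := exists_valued_finiteCompletionHom _ _ _ (Q.comap_conjPlace v)
  have h3 := congrArg Valued.v (Q.base_norm x h (Q.comap_conjPlace v))
  rw [hev, map_mul, hev', hx, hx, one_pow, one_mul] at h3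
  exact eq_one_of_pow_eq_one he h3

/-- Continuity of `ν ∘ N` is the point. The norm sends the box of level `e * n` at `v` and its
conjugate into the box of level `n` at `P`, the factor `e` accounting for ramification, and it
preserves squares at infinity. -/
theorem exists_compNorm {ν : Idele ℚ →ₜ* Circle} (hν : ν ∈ IdeleClassCharacter ℚ)
    (P : HeightOneSpectrum (𝓞 ℚ)) (n : ℕ) (h1 : ∀ y ∈ idealBox {P} n, ν y = 1) :
    ∃ κ ∈ IdeleClassCharacter K, ∀ x, κ x = ν (Q.norm x) := by
  classical
  obtain ⟨v, h⟩ := exists_comap_eq (F := K) P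
  obtain ⟨e, he, hev⟩ := exists_valued_finiteCompletionHom (algebraMap ℚ K) P v h
  obtain ⟨e', he', hev'⟩ := exists_valued_finiteCompletionHom _ _ _ (Q.comap_conjPlace v)
  have hc := continuous_of_trivial_on_box (ν.toMonoidHom.comp Q.norm) {v, conjPlace Q.c v} (e * n)
    (by
      rintro x ⟨hx1, hx2, hx3⟩
      refine h1 _ ⟨Q.valued_norm hx1, fun P' hP' => ?_, Q.isSquare_norm hx3⟩
      rw [Finset.mem_singleton.1 hP']
      refine le_exp_neg_of_pow_le he ?_
      rw [← hev, map_sub, map_one, Q.base_norm x h (Q.comap_conjPlace v)]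
      set z := finiteCompletionHom (Q.c : K →+* K) _ v (Q.comap_conjPlace v)
        (x.val.2 (conjPlace Q.c v)) with hz
      have hL1 := hx2 v (by simp)
      have hL2 : Lev Valued.v (e * n) (z - 1) := by
        have := hx2 (conjPlace Q.c v) (by simp)
        rw [hz, ← map_one (finiteCompletionHom (Q.c : K →+* K) _ v (Q.comap_conjPlace v)),
          ← map_sub, Lev, hev']
        refine le_trans (pow_le_of_le_one zero_le ?_ he') this
        refine le_trans this ?_
        rw [← WithZero.exp_zero, WithZero.exp_le_exp]
        omega
      have hvx : Valued.v (x.val.2 v) = 1 := hx1 v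
      have hmul : Lev Valued.v (e * n) (x.val.2 v * (z - 1)) := by
        rw [Lev, map_mul, hvx, one_mul]
        exact hL2
      have := hmul.add hL1
      rwa [mul_sub, mul_one, sub_add_sub_cancel] at this)
  refine ⟨⟨ν.toMonoidHom.comp Q.norm, hc⟩, fun k => ?_, fun x => rfl⟩
  obtain ⟨q, hq⟩ := Q.norm_principal k
  change ν (Q.norm _) = 1
  rw [hq, hν]

/-! ### Norms of local ideles -/

theorem norm_localIdele {P : HeightOneSpectrum (𝓞 ℚ)} {v w : HeightOneSpectrum (𝓞 K)}
    (h : v.asIdeal.comap (RingOfIntegers.mapRingHom (algebraMap ℚ K)) = P.asIdeal)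
    (hw : v.asIdeal.comap (RingOfIntegers.mapRingHom (Q.c : K →+* K)) = w.asIdeal)
    {u : (v.adicCompletion K)ˣ} {y : (P.adicCompletion ℚ)ˣ}
    (hy : finiteCompletionHom (algebraMap ℚ K) P v h y =
      u * finiteCompletionHom (Q.c : K →+* K) w v hw (finComp w (localIdele v u))) :
    Q.norm (localIdele v u) = localIdele P y := by
  refine idele_ext (fun P' => Units.ext ?_) fun p => Units.ext ?_
  · by_cases hP : P' = P
    · subst hP
      refine (finiteCompletionHom (algebraMap ℚ K) P' v h).injective ?_
      rw [finComp_localIdele, hy, finComp_val, Q.base_norm _ h hw, ← finComp_val,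
        finComp_localIdele, finComp_val]
    · rw [finComp_localIdele_ne hP]
      obtain ⟨v', h'⟩ := exists_comap_eq (F := K) P'
      have hv' : v' ≠ v := by
        rintro rfl
        exact hP (HeightOneSpectrum.ext (h'.symm.trans h))
      have hcv' : conjPlace Q.c v' ≠ v := by
        rintro e
        have := (Q.comap_eq_iff_of_comap_eq h' (w := v)).2 (Or.inr e.symm)
        exact hP (HeightOneSpectrum.ext (this.symm.trans h))
      refine (finiteCompletionHom (algebraMap ℚ K) P' v' h').injective ?_
      rw [finComp_val, Q.base_norm _ h' (Q.comap_conjPlace v'), ← finComp_val, ← finComp_val,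
        finComp_localIdele_ne hv', finComp_localIdele_ne hcv', Units.val_one, Units.val_one,
        Units.val_one, map_one, map_one, one_mul]
  · rw [infComp_val, (Q.isIdeleNorm_norm _).2 p, infComp_localIdele, Units.val_one]
    refine finprod_eq_one_of_forall_eq_one fun w => ?_
    rw [← infComp_val, infComp_localIdele, Units.val_one, map_one]

theorem norm_localIdele_of_split {P : HeightOneSpectrum (𝓞 ℚ)} {v : HeightOneSpectrum (𝓞 K)}
    (h : v.asIdeal.comap (RingOfIntegers.mapRingHom (algebraMap ℚ K)) = P.asIdeal)
    (hv : conjPlace Q.c v ≠ v) {u : (v.adicCompletion K)ˣ} {y : (P.adicCompletion ℚ)ˣ}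
    (hy : finiteCompletionHom (algebraMap ℚ K) P v h y = u) :
    Q.norm (localIdele v u) = localIdele P y :=
  Q.norm_localIdele h (Q.comap_conjPlace v) (by
    rw [finComp_localIdele_ne hv, Units.val_one, map_one, mul_one, hy])

theorem norm_localIdele_of_nonsplit {P : HeightOneSpectrum (𝓞 ℚ)} {v : HeightOneSpectrum (𝓞 K)}
    (h : v.asIdeal.comap (RingOfIntegers.mapRingHom (algebraMap ℚ K)) = P.asIdeal)
    (hv : v.asIdeal.comap (RingOfIntegers.mapRingHom (Q.c : K →+* K)) = v.asIdeal)
    {u : (v.adicCompletion K)ˣ} {y : (P.adicCompletion ℚ)ˣ}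
    (hy : finiteCompletionHom (algebraMap ℚ K) P v h y =
      u * finiteCompletionHom (Q.c : K →+* K) v v hv u) :
    Q.norm (localIdele v u) = localIdele P y :=
  Q.norm_localIdele h hv (by rw [finComp_localIdele, hy])

end RealQuad

end QuadIdele

namespace QuadIdele

/-! ### Arithmetic in completions -/

section Completion

variable {F : Type*} [Field F] [NumberField F] {v : HeightOneSpectrum (𝓞 F)}

theorem lev_emb_iff (a : 𝓞 F) (n : ℕ) :
    Lev Valued.v n (emb v (a : F)) ↔ a ∈ v.asIdeal ^ n := by
  rw [Lev, valued_emb, valuation_of_algebraMap, intValuation_le_pow_iff_mem]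

theorem valued_emb_le_one (a : 𝓞 F) : Valued.v (emb v (a : F)) ≤ 1 := by
  rw [valued_emb]
  exact valuation_le_one v a

theorem valued_eq_of_lev {x : v.adicCompletion F} {n : ℕ} (h : Lev Valued.v n x)
    (h' : ¬ Lev Valued.v (n + 1) x) : Valued.v x = WithZero.exp (-(n : ℤ)) := by
  have h0 : Valued.v x ≠ 0 := fun h0 => h' (by rw [Lev, h0]; exact zero_le)
  rw [Lev, ← WithZero.exp_log h0, WithZero.exp_le_exp] at h h'
  rw [← WithZero.exp_log h0]
  congr 1
  push_cast at h'
  omega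

theorem valued_emb_eq {a : 𝓞 F} {n : ℕ} (h : a ∈ v.asIdeal ^ n) (h' : a ∉ v.asIdeal ^ (n + 1)) :
    Valued.v (emb v (a : F)) = WithZero.exp (-(n : ℤ)) :=
  valued_eq_of_lev ((lev_emb_iff a n).2 h) fun h1 => h' ((lev_emb_iff a _).1 h1)

theorem valued_emb_eq_one {a : 𝓞 F} (h : a ∉ v.asIdeal) : Valued.v (emb v (a : F)) = 1 := by
  have := valued_emb_eq (v := v) (a := a) (n := 0) (by simp) (by simpa using h)
  simpa using this

theorem exists_integer_close {x : v.adicCompletion F} (hx : Valued.v x ≤ 1) :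
    ∃ a : 𝓞 F, Lev Valued.v 1 (x - emb v (a : F)) := by
  have hopen := (isOpen_lev_sub v 1 x).mem_nhds (by
    change Lev Valued.v 1 (x - x)
    rw [sub_self]
    exact Lev.zero 1)
  obtain ⟨k, hk⟩ := (denseRange_algebraMap F v).mem_nhds hopen
  have hk : Lev Valued.v 1 (emb v k - x) := hk
  have hk1 : v.valuation F k ≤ 1 := by
    rw [← valued_emb, ← lev_zero_iff]
    have := (hk.mono zero_le_one).add (lev_zero_iff.2 hx)
    rwa [sub_add_cancel] at this
  obtain ⟨a, ha⟩ := exists_valuation_sub_lt_of_integer v hk1 1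
  refine ⟨a, ?_⟩
  have h1 : Lev Valued.v 1 (emb v k - emb v (a : F)) := by
    refine Lev.symm ?_
    rw [← map_sub, lev_one_iff, valued_emb]
    simpa using ha
  have := hk.symm.add h1
  rwa [sub_add_sub_cancel] at this

theorem pow_absNorm_sub_mem (a : 𝓞 F) : a ^ Ideal.absNorm v.asIdeal - a ∈ v.asIdeal := by
  have := v.isMaximal
  let _ : Field (𝓞 F ⧸ v.asIdeal) := Ideal.Quotient.field _
  have : Finite (𝓞 F ⧸ v.asIdeal) := Ideal.finiteQuotientOfFreeOfNeBot _ v.ne_bot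
  let _ := Fintype.ofFinite (𝓞 F ⧸ v.asIdeal)
  rw [← Ideal.Quotient.eq_zero_iff_mem, map_sub, map_pow]
  have hc : Ideal.absNorm v.asIdeal = Fintype.card (𝓞 F ⧸ v.asIdeal) := by
    rw [← Nat.card_eq_fintype_card]
    rfl
  rw [hc, FiniteField.pow_card, sub_self]

theorem resTwo (h2 : Above v 2) (h : ∀ a : 𝓞 F, ∃ n : ℤ, a - n ∈ v.asIdeal) :
    ResTwo (Valued.v : Valuation (v.adicCompletion F) (WithZero (Multiplicative ℤ))) := by
  intro x hx
  obtain ⟨a, ha⟩ := exists_integer_close hx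
  obtain ⟨n, hn⟩ := h a
  have key : ∀ k : ℤ, ((n - k : ℤ) : 𝓞 F) ∈ v.asIdeal → Lev Valued.v 1 (x - emb v (k : F)) := by
    intro k hk
    have h1 : a - k ∈ v.asIdeal := by
      have := v.asIdeal.add_mem hn hk
      push_cast at this
      rwa [sub_add_sub_cancel] at this
    have h2 := (lev_emb_iff (v := v) (a - k) 1).2 (by rwa [pow_one])
    have h3 : emb v ((a - k : 𝓞 F) : F) = emb v (a : F) - emb v (k : F) := by
      rw [← map_sub]
      simp
    rw [h3] at h2
    have := ha.add h2
    rwa [sub_add_sub_cancel] at this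
  rcases Int.even_or_odd' n with ⟨k, hk | hk⟩
  · left
    have := key 0 ((h2.intCast_mem_iff Nat.prime_two _).2 (by rw [hk]; simp))
    simpa using this
  · right
    have := key 1 ((h2.intCast_mem_iff Nat.prime_two _).2 (by rw [hk]; simp))
    simpa using this

/-- Integers satisfy `a ^ 4 ≡ a` modulo `v`, and this passes to the completion by approximation. The
polynomial `x ^ 4 - x` factors as `x (x - 1) (x - z) (x - z ^ 2)`, so one factor has valuation below
`1`. -/
theorem resFour (h4 : Ideal.absNorm v.asIdeal = 4) {z : v.adicCompletion F}
    (hz : z ^ 2 + z + 1 = 0) :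
    ResFour (Valued.v : Valuation (v.adicCompletion F) (WithZero (Multiplicative ℤ))) z := by
  have hz1 : Valued.v z = 1 := cube_root_unit hz
  intro x hx
  obtain ⟨a, ha⟩ := exists_integer_close hx
  have h1 := (lev_emb_iff (v := v) _ 1).2 (by rw [pow_one]; exact pow_absNorm_sub_mem (v := v) a)
  rw [h4] at h1
  set b := emb v (a : F) with hb
  have h2 : emb v ((a ^ 4 - a : 𝓞 F) : F) = b ^ 4 - b := by
    rw [hb, ← map_pow, ← map_sub]
    simp
  rw [h2] at h1
  have hb1 : Valued.v b ≤ 1 := valued_emb_le_one a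
  have h3 : Lev Valued.v 1 (x ^ 4 - x) := by
    have e : x ^ 4 - x = (x - b) * (x ^ 3 + x ^ 2 * b + x * b ^ 2 + b ^ 3 - 1) + (b ^ 4 - b) := by
      ring
    rw [e]
    refine (ha.mul_right ?_).add h1
    have hx3 : Lev Valued.v 0 x := lev_zero_iff.2 hx
    have hb3 : Lev Valued.v 0 b := lev_zero_iff.2 hb1
    have h10 : Lev Valued.v 0 (1 : v.adicCompletion F) := lev_zero_iff.2 (map_one _).le
    exact lev_zero_iff.1 (((((hx3.pow 3).add ((hx3.pow 2).mul hb3)).add (hx3.mul (hb3.pow 2))).add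
      (hb3.pow 3)).sub h10)
  by_contra! hcon
  simp only [lev_one_iff, not_lt] at hcon
  obtain ⟨n0, n1, n2, n3⟩ := hcon
  have e : x ^ 4 - x = x * (x - 1) * (x - z) * (x - z ^ 2) := by
    linear_combination (x * (x - 1) * (x - (z - 1))) * hz
  rw [e, lev_one_iff, map_mul, map_mul, map_mul] at h3
  exact absurd h3 (not_lt.2 (one_le_mul (one_le_mul (one_le_mul n0 n1) n2) n3))

/-- Multiplicativity of the quadratic character of the finite residue field, lifted to units by
approximation. -/
theorem resCyclic :
    ResCyclic (Valued.v : Valuation (v.adicCompletion F) (WithZero (Multiplicative ℤ))) := by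
  classical
  intro x y hx hy
  obtain ⟨a, ha⟩ := exists_integer_close hx.le
  obtain ⟨b, hb⟩ := exists_integer_close hy.le
  have := v.isMaximal
  let _ : Field (𝓞 F ⧸ v.asIdeal) := Ideal.Quotient.field _
  have : Finite (𝓞 F ⧸ v.asIdeal) := Ideal.finiteQuotientOfFreeOfNeBot _ v.ne_bot
  let _ := Fintype.ofFinite (𝓞 F ⧸ v.asIdeal)
  have key : ∀ (z : v.adicCompletion F) (e : 𝓞 F), Valued.v z = 1 →
      Lev Valued.v 1 (z - emb v (e : F)) → IsSquare (Ideal.Quotient.mk v.asIdeal e) →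
      ∃ t, Valued.v t = 1 ∧ Lev Valued.v 1 (z - t ^ 2) := by
    intro z e hz hze ⟨r, hr⟩
    obtain ⟨t, rfl⟩ := Ideal.Quotient.mk_surjective r
    have h1 : e - t ^ 2 ∈ v.asIdeal := by
      rw [← Ideal.Quotient.eq_zero_iff_mem, map_sub, map_pow, hr, sq, sub_self]
    have h2 := (lev_emb_iff (v := v) _ 1).2 (by rwa [pow_one])
    have h3 : emb v ((e - t ^ 2 : 𝓞 F) : F) = emb v (e : F) - emb v (t : F) ^ 2 := by
      rw [← map_pow, ← map_sub]
      simp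
    rw [h3] at h2
    have h4 := hze.add h2
    rw [sub_add_sub_cancel] at h4
    refine ⟨emb v (t : F), ?_, h4⟩
    have := unit_of_close hz h4
    rw [map_pow] at this
    exact RealQuad.eq_one_of_pow_eq_one two_ne_zero this
  have hne : ∀ (z : v.adicCompletion F) (e : 𝓞 F), Valued.v z = 1 →
      Lev Valued.v 1 (z - emb v (e : F)) → Ideal.Quotient.mk v.asIdeal e ≠ 0 := by
    intro z e hz hze h0
    have h1 := (lev_emb_iff (v := v) e 1).2 (by
      rw [pow_one]; exact Ideal.Quotient.eq_zero_iff_mem.1 h0)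
    rw [lev_one_iff, unit_of_close hz hze] at h1
    exact lt_irrefl _ h1
  have hab : Lev Valued.v 1 (x * y - emb v ((a * b : 𝓞 F) : F)) := by
    have e : x * y - emb v ((a * b : 𝓞 F) : F) = x * (y - emb v (b : F)) +
        (x - emb v (a : F)) * emb v (b : F) := by
      rw [show ((a * b : 𝓞 F) : F) = (a : F) * b by simp, map_mul]
      ring
    rw [e]
    exact (hb.mul_left hx.le).add (ha.mul_right (valued_emb_le_one b))
  have ha0 := hne x a hx ha
  have hb0 := hne y b hy hb
  by_cases hsa : IsSquare (Ideal.Quotient.mk v.asIdeal a)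
  · obtain ⟨t, h1, h2⟩ := key x a hx ha hsa
    exact ⟨t, h1, Or.inl h2⟩
  by_cases hsb : IsSquare (Ideal.Quotient.mk v.asIdeal b)
  · obtain ⟨t, h1, h2⟩ := key y b hy hb hsb
    exact ⟨t, h1, Or.inr (Or.inl h2)⟩
  have hsab : IsSquare (Ideal.Quotient.mk v.asIdeal (a * b)) := by
    rw [map_mul]
    refine (quadraticChar_one_iff_isSquare (mul_ne_zero ha0 hb0)).1 ?_
    rw [map_mul, (quadraticChar_dichotomy ha0).resolve_left
      fun h => hsa ((quadraticChar_one_iff_isSquare ha0).1 h),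
      (quadraticChar_dichotomy hb0).resolve_left
      fun h => hsb ((quadraticChar_one_iff_isSquare hb0).1 h)]
    norm_num
  obtain ⟨t, h1, h2⟩ := key _ _ (by rw [map_mul, hx, hy, one_mul]) hab hsab
  exact ⟨t, h1, Or.inr (Or.inr h2)⟩

/-- Squares of units when the residue field has two elements and `2` is a uniformizer. -/
theorem lev_three_sq_sub_one
    (hR : ResTwo (Valued.v : Valuation (v.adicCompletion F) (WithZero (Multiplicative ℤ))))
    (h2 : Valued.v (2 : v.adicCompletion F) = WithZero.exp (-1 : ℤ)) {y : v.adicCompletion F}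
    (hy : Valued.v y = 1) : Lev Valued.v 3 (y ^ 2 - 1) := by
  have h21 : Lev Valued.v 1 (2 : v.adicCompletion F) := h2.le
  have h20 : (2 : v.adicCompletion F) ≠ 0 := fun h0 => by
    rw [h0, map_zero] at h2
    exact WithZero.exp_ne_zero h2.symm
  have hy1 : Lev Valued.v 1 (y - 1) := (hR y hy.le).resolve_left fun h => by
    rw [lev_one_iff, hy] at h
    exact lt_irrefl _ h
  set t := (y - 1) / 2 with ht
  have hyt : y = 1 + 2 * t := by rw [ht]; field_simp; ring
  have ht0 : Lev Valued.v 0 t := lev_div (n := 1) hy1 h2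
  -- Since `y ^ 2 - 1 = 4 * t * (t + 1)`, the third factor of `2` comes from one of `t`, `t + 1`
  -- being in the maximal ideal.
  have htt : Lev Valued.v 1 (t * (t + 1)) := by
    rcases hR t (lev_zero_iff.1 ht0) with h | h
    · refine h.mul_right (lev_zero_iff.1 (ht0.add (lev_zero_iff.2 (map_one _).le)))
    · refine Lev.mul_left (lev_zero_iff.1 ht0) ?_
      have := h.add h21
      rwa [show t - 1 + 2 = t + 1 by ring] at this
  have := (h21.mul h21).mul htt
  rw [hyt]
  convert this using 1
  ring

end Completion

/-! ### Integers in completions of `ℚ` -/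

section Rat

variable {P : HeightOneSpectrum (𝓞 ℚ)} {p : ℕ}

theorem rat_asIdeal_eq (hp : p.Prime) (hP : Above P p) : P.asIdeal = Ideal.span {(p : 𝓞 ℚ)} := by
  ext x
  obtain ⟨n, rfl⟩ := rat_eq_intCast x
  rw [hP.intCast_mem_iff hp, Ideal.mem_span_singleton]
  constructor
  · rintro ⟨m, rfl⟩
    exact ⟨m, by push_cast; rfl⟩
  · rintro ⟨y, hy⟩
    obtain ⟨m, rfl⟩ := rat_eq_intCast y
    exact ⟨m, by exact_mod_cast hy⟩

theorem rat_lev_iff (hp : p.Prime) (hP : Above P p) (n : ℤ) (k : ℕ) :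
    Lev Valued.v k (n : P.adicCompletion ℚ) ↔ (p : ℤ) ^ k ∣ n := by
  have e : (n : P.adicCompletion ℚ) = emb P (((n : 𝓞 ℚ) : ℚ)) := by simp
  rw [e, lev_emb_iff, rat_asIdeal_eq hp hP, Ideal.span_singleton_pow, Ideal.mem_span_singleton]
  constructor
  · rintro ⟨y, hy⟩
    obtain ⟨m, rfl⟩ := rat_eq_intCast y
    exact ⟨m, by exact_mod_cast hy⟩
  · rintro ⟨m, rfl⟩
    exact ⟨m, by push_cast; rfl⟩

theorem rat_resTwo (hP : Above P 2) :
    ResTwo (Valued.v : Valuation (P.adicCompletion ℚ) (WithZero (Multiplicative ℤ))) :=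
  resTwo hP fun a => by
    obtain ⟨n, rfl⟩ := rat_eq_intCast a
    exact ⟨n, by simp⟩

theorem rat_valued_intCast_eq_one (hp : p.Prime) (hP : Above P p) {n : ℤ} (hn : ¬ (p : ℤ) ∣ n) :
    Valued.v (n : P.adicCompletion ℚ) = 1 := by
  have := valued_eq_of_lev ((rat_lev_iff hp hP n 0).2 (by simp))
    (by rw [rat_lev_iff hp hP]; simpa using hn)
  simpa using this

theorem rat_valued_two (hP : Above P 2) :
    Valued.v (2 : P.adicCompletion ℚ) = WithZero.exp (-1 : ℤ) := by
  have := valued_eq_of_lev ((rat_lev_iff Nat.prime_two hP 2 1).2 (by norm_num))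
    (by rw [rat_lev_iff Nat.prime_two hP]; norm_num)
  exact_mod_cast this

end Rat

namespace RealQuad

variable {K : Type*} [Field K] [NumberField K] (Q : RealQuad K)

/-! ### Splitting behaviour and valuations -/

section Splitting

variable {v : HeightOneSpectrum (𝓞 K)} {p : ℕ} (hp : p.Prime) (hv : Above v p)
include hp hv

theorem inertIn_iff : InertIn K p ↔ conjPlace Q.c v = v ∧ Ideal.absNorm v.asIdeal = p ^ 2 := by
  constructor
  · rintro ⟨w, hw⟩
    have hwv : w = v := eq_of_asIdeal_le (by rw [← hw, Ideal.span_singleton_le_iff_mem]; exact hv)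
    subst hwv
    have hN : Ideal.absNorm w.asIdeal = p ^ 2 := by rw [← hw, Q.absNorm_span_natCast]
    refine ⟨?_, hN⟩
    refine (eq_of_asIdeal_le ?_).symm
    rw [← hw, Ideal.span_singleton_le_iff_mem]
    exact Q.above_conjPlace hv
  · rintro ⟨hc, hN⟩
    have hpp : p ≠ p ^ 2 := by
      have := hp.one_lt
      nlinarith
    rcases Q.trichotomy hp hv with ⟨h, -⟩ | ⟨-, h, -⟩ | ⟨-, -, h⟩
    · exact absurd hc h
    · exact ⟨v, h⟩
    · exact absurd (h.symm.trans hN) hpp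

theorem ramifiedIn_iff : RamifiedIn K p ↔ conjPlace Q.c v = v ∧ Ideal.absNorm v.asIdeal = p := by
  constructor
  · rintro ⟨w, hw⟩
    have hwv : w = v := by
      refine (eq_of_asIdeal_le (v.isPrime.le_of_pow_le (n := 2) ?_))
      rw [← hw, Ideal.span_singleton_le_iff_mem]
      exact hv
    subst hwv
    have hN : Ideal.absNorm w.asIdeal = p := by
      have := congrArg Ideal.absNorm hw
      rw [Q.absNorm_span_natCast, map_pow] at this
      exact (Nat.pow_left_injective two_ne_zero this).symm
    refine ⟨?_, hN⟩
    refine (eq_of_asIdeal_le ((conjPlace Q.c w).isPrime.le_of_pow_le (n := 2) ?_)).symm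
    rw [← hw, Ideal.span_singleton_le_iff_mem]
    exact Q.above_conjPlace hv
  · rintro ⟨hc, hN⟩
    have hpp : p ≠ p ^ 2 := by
      have := hp.one_lt
      nlinarith
    rcases Q.trichotomy hp hv with ⟨h, -⟩ | ⟨-, -, h⟩ | ⟨-, h, -⟩
    · exact absurd hc h
    · exact absurd (hN.symm.trans h) hpp
    · exact ⟨v, h⟩

theorem splitIn_iff : SplitIn K p ↔ conjPlace Q.c v ≠ v := by
  constructor
  · rintro ⟨w, w', hne, hw⟩ hc
    have hmem : ∀ u : HeightOneSpectrum (𝓞 K), Above u p → u = v := fun u hu =>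
      (Q.eq_or_eq_conjPlace hp hv hu).elim id fun e => e.trans hc
    have h1 : Above w p := (Ideal.span_singleton_le_iff_mem _).1 (hw.trans_le Ideal.mul_le_left)
    have h2 : Above w' p := (Ideal.span_singleton_le_iff_mem _).1 (hw.trans_le Ideal.mul_le_right)
    exact hne ((hmem w h1).trans (hmem w' h2).symm)
  · intro hc
    rcases Q.trichotomy hp hv with ⟨-, h, -⟩ | ⟨h, -⟩ | ⟨h, -⟩
    · exact ⟨v, _, hc.symm, h⟩
    · exact absurd h hc
    · exact absurd h hc

theorem inertIn_or_ramifiedIn (hc : conjPlace Q.c v = v) : InertIn K p ∨ RamifiedIn K p := by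
  rw [Q.inertIn_iff hp hv, Q.ramifiedIn_iff hp hv]
  rcases Q.trichotomy hp hv with ⟨h, -⟩ | ⟨-, -, h⟩ | ⟨-, -, h⟩
  · exact absurd hc h
  · exact Or.inl ⟨hc, h⟩
  · exact Or.inr ⟨hc, h⟩

include Q in
theorem valued_natCast_of_not_ramified (h : ¬ RamifiedIn K p) :
    Valued.v (p : v.adicCompletion K) = WithZero.exp (-1 : ℤ) := by
  have e : (p : v.adicCompletion K) = emb v (((p : 𝓞 K) : K)) := by simp
  rw [e]
  refine valued_emb_eq (n := 1) (by rw [pow_one]; exact hv) fun hmem => ?_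
  have hlt : v.asIdeal ^ 2 < v.asIdeal :=
    (Ideal.pow_right_strictAnti v.asIdeal v.ne_bot v.isPrime.ne_top one_lt_two).trans_eq
      (pow_one _)
  have hle : Ideal.span {(p : 𝓞 K)} ≤ v.asIdeal ^ 2 := (Ideal.span_singleton_le_iff_mem _).2 hmem
  rcases Q.trichotomy hp hv with ⟨hc, hs, -⟩ | ⟨-, hs, -⟩ | ⟨-, hs, -⟩
  · rw [hs, ← Ideal.dvd_iff_le, sq] at hle
    exact hc (eq_of_asIdeal_le (Ideal.dvd_iff_le.1 ((mul_dvd_mul_iff_left v.ne_bot).1 hle)))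
  · rw [hs] at hle
    exact absurd hle hlt.not_ge
  · exact h ⟨v, hs⟩

theorem eq_d_of_ramifiedIn (h : RamifiedIn K p) : p = Q.d := by
  obtain ⟨h1, h2⟩ := (Q.ramifiedIn_iff hp hv).1 h
  exact Q.eq_d_of_ramified hp hv h1 h2

theorem valued_s_of_ramified (h : RamifiedIn K p) :
    Valued.v (emb v Q.s) = WithZero.exp (-1 : ℤ) := by
  obtain ⟨h1, h2⟩ := (Q.ramifiedIn_iff hp hv).1 h
  rcases Q.trichotomy hp hv with ⟨hc, -⟩ | ⟨-, -, hN⟩ | ⟨-, hs, -⟩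
  · exact absurd h1 hc
  · have := hp.one_lt
    nlinarith
  · have e := Q.asIdeal_eq_of_ramified hp hv h1 h2 hs
    refine valued_emb_eq (a := Q.sInt) (n := 1) (by
      rw [pow_one]; exact e ▸ Ideal.mem_span_singleton_self _) fun hmem => ?_
    have hlt : v.asIdeal ^ 2 < v.asIdeal :=
      (Ideal.pow_right_strictAnti v.asIdeal v.ne_bot v.isPrime.ne_top one_lt_two).trans_eq
      (pow_one _)
    refine hlt.not_ge ?_
    conv_lhs => rw [e]
    exact (Ideal.span_singleton_le_iff_mem _).2 hmem

include Q in
theorem exists_int_sub_mem_of_ramified (h : RamifiedIn K p) (a : 𝓞 K) :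
    ∃ n : ℤ, a - n ∈ v.asIdeal :=
  Above.exists_int_sub_mem hp ((Q.ramifiedIn_iff hp hv).1 h).2 a

theorem exists_int_sub_mem_of_split (h : conjPlace Q.c v ≠ v) (a : 𝓞 K) :
    ∃ n : ℤ, a - n ∈ v.asIdeal := by
  rcases Q.trichotomy hp hv with ⟨-, -, hN⟩ | ⟨hc, -⟩ | ⟨hc, -⟩
  · exact Above.exists_int_sub_mem hp hN a
  · exact absurd hc h
  · exact absurd hc h

end Splitting

end RealQuad

end QuadIdele

namespace QuadIdele

/-! ### Local components of characters -/

open Classical in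
/-- Extension by zero of a unitary character of the multiplicative group of a field. -/
def extendHom {L : Type*} [Field L] (f : Lˣ →* Circle) : L →*₀ ℂ where
  toFun x := if h : x = 0 then 0 else (f (Units.mk0 x h) : ℂ)
  map_zero' := dif_pos rfl
  map_one' := by
    rw [dif_neg one_ne_zero, Units.mk0_one, map_one, Circle.coe_one]
  map_mul' x y := by
    by_cases hx : x = 0
    · rw [dif_pos hx, dif_pos (by rw [hx, zero_mul]), zero_mul]
    by_cases hy : y = 0
    · rw [dif_pos hy, dif_pos (by rw [hy, mul_zero]), mul_zero]
    rw [dif_neg hx, dif_neg hy, dif_neg (mul_ne_zero hx hy), Units.mk0_mul, map_mul,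
      Circle.coe_mul]

section ExtendHom

variable {L : Type*} [Field L] (f : Lˣ →* Circle)

theorem extendHom_of_ne {x : L} (h : x ≠ 0) : extendHom f x = f (Units.mk0 x h) := dif_neg h

theorem extendHom_unit (u : Lˣ) : extendHom f (u : L) = f u := by
  rw [extendHom_of_ne f u.ne_zero, Units.mk0_val]

theorem extendHom_eq_one_iff (u : Lˣ) : extendHom f (u : L) = 1 ↔ f u = 1 := by
  rw [extendHom_unit, Circle.coe_eq_one]

theorem isSq1_extendHom (hf : ∀ u, f u ^ 2 = 1) : IsSq1 (extendHom f) := fun x hx => by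
  rw [extendHom_of_ne f hx, ← Circle.coe_pow, hf, Circle.coe_one]

end ExtendHom

section LocalComponent

variable {F : Type*} [Field F] [NumberField F]

/-- The component of `χ` at a finite place, as a monoid homomorphism. -/
def localHom (χ : Idele F →ₜ* Circle) (v : HeightOneSpectrum (𝓞 F)) : v.adicCompletion F →*₀ ℂ :=
  extendHom (χ.toMonoidHom.comp (localIdele v))

variable (χ η : Idele F →ₜ* Circle) (v : HeightOneSpectrum (𝓞 F))

theorem localHom_unit (u : (v.adicCompletion F)ˣ) :
    localHom χ v (u : v.adicCompletion F) = χ (localIdele v u) := extendHom_unit _ u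

theorem localHom_of_ne {x : v.adicCompletion F} (hx : x ≠ 0) :
    localHom χ v x = χ (localIdele v (Units.mk0 x hx)) := extendHom_of_ne _ hx

theorem localHom_mul {x : v.adicCompletion F} :
    localHom (χ * η) v x = localHom χ v x * localHom η v x := by
  by_cases hx : x = 0
  · rw [hx, map_zero, map_zero, zero_mul]
  · rw [localHom_of_ne _ _ hx, localHom_of_ne _ _ hx, localHom_of_ne _ _ hx, ← Circle.coe_mul]
    rfl

theorem triv_localHom_iff (n : ℕ) : Triv Valued.v (localHom χ v) n ↔
    ∀ u : (v.adicCompletion F)ˣ, Valued.v (u : v.adicCompletion F) = 1 →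
      Lev Valued.v n ((u : v.adicCompletion F) - 1) → χ (localIdele v u) = 1 := by
  constructor
  · intro h u hu hn
    have := h _ hu hn
    rwa [localHom_unit, Circle.coe_eq_one] at this
  · intro h u hu hn
    rw [localHom_of_ne _ _ (ne_zero_of_unit hu), Circle.coe_eq_one]
    exact h _ hu hn

theorem triv_zero_iff : Triv Valued.v (localHom χ v) 0 ↔
    ∀ u : (v.adicCompletion F)ˣ, Valued.v (u : v.adicCompletion F) = 1 → χ (localIdele v u) = 1 := by
  rw [triv_localHom_iff]
  refine forall_congr' fun _ => forall_congr' fun hu => ⟨fun h => h ?_, fun h _ => h⟩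
  refine lev_zero_iff.2 ((Valuation.map_sub_le _ hu.le ?_))
  exact (map_one _).le

variable {χ η v}

variable (hχ : ∀ x, χ x ^ 2 = 1)
include hχ

theorem isSq1_localHom : IsSq1 (localHom χ v) := isSq1_extendHom _ fun _ => hχ _

theorem exists_finset_triv : ∃ (T : Finset (HeightOneSpectrum (𝓞 F))) (N : ℕ),
    ∀ v, Triv Valued.v (localHom χ v) N ∧ (v ∉ T → Triv Valued.v (localHom χ v) 0) := by
  obtain ⟨T, N, h⟩ := exists_trivial_box two_pos χ hχ
  have hmem : ∀ v (u : (v.adicCompletion F)ˣ), Valued.v (u : v.adicCompletion F) = 1 →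
      localIdele v u ∈ unitIdeles F := by
    intro v u hu w
    rw [← finComp_val]
    by_cases hw : w = v
    · subst hw
      rwa [finComp_localIdele]
    · rw [finComp_localIdele_ne hw]
      exact map_one _
  refine ⟨T, N, fun v => ⟨?_, fun hv => ?_⟩⟩
  · rw [triv_localHom_iff]
    intro u hu hN
    refine h _ (hmem v u hu) (fun w => rfl) fun w _ => ?_
    rw [← finComp_val]
    by_cases hw : w = v
    · subst hw
      rwa [finComp_localIdele]
    · rw [finComp_localIdele_ne hw, Units.val_one, sub_self]
      exact Lev.zero N
  · rw [triv_zero_iff]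
    intro u hu
    refine h _ (hmem v u hu) (fun w => rfl) fun w hw => ?_
    rw [← finComp_val, finComp_localIdele_ne (fun e : w = v => hv (by rwa [e] at hw)), Units.val_one, sub_self]
    exact Lev.zero N

/-- The infimum defining the exponent would be `0` on an empty set; `exists_finset_triv` excludes
this, so the infimum is attained. -/
theorem condExponent_le_iff (n : ℕ) : condExponent χ v ≤ n ↔ Triv Valued.v (localHom χ v) n := by
  obtain ⟨T, N, h⟩ := exists_finset_triv hχ
  have hne : {n : ℕ | Triv Valued.v (localHom χ v) n}.Nonempty := ⟨N, (h v).1⟩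
  constructor
  · exact fun hn => (Nat.sInf_mem hne : Triv Valued.v (localHom χ v) (condExponent χ v)).mono hn
  · exact fun hn => Nat.sInf_le hn

theorem condExponent_eq_zero_iff :
    condExponent χ v = 0 ↔ Triv Valued.v (localHom χ v) 0 := by
  rw [← condExponent_le_iff hχ, Nat.le_zero]

theorem finite_support_condExponent : (Function.support (condExponent χ)).Finite := by
  obtain ⟨T, N, h⟩ := exists_finset_triv hχ
  refine T.finite_toSet.subset fun v hv => ?_
  by_contra hT
  exact hv ((condExponent_eq_zero_iff hχ).2 ((h v).2 hT))

theorem ordAt_finiteConductor : ordAt v (finiteConductor χ) = condExponent χ v :=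
  multiplicity_finprod_pow _ (finite_support_condExponent hχ) v

theorem dvd_finiteConductor_iff :
    v.asIdeal ∣ finiteConductor χ ↔ ¬ Triv Valued.v (localHom χ v) 0 := by
  rw [← multiplicity_ne_zero, ← condExponent_eq_zero_iff hχ, ← ordAt_finiteConductor hχ]
  rfl

end LocalComponent

namespace RealQuad

variable {K : Type*} [Field K] [NumberField K] (Q : RealQuad K)

/-! ### The conditions place by place -/

section Good

variable (S : Set (HeightOneSpectrum (𝓞 K)))
  (ϖ ζ : (v : HeightOneSpectrum (𝓞 K)) → v.adicCompletion K)

/-- The condition at the place `v` imposed on quadratic characters by `SatisfiesACD`. -/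
def Good (v : HeightOneSpectrum (𝓞 K)) (ψ : v.adicCompletion K →*₀ ℂ) : Prop :=
  Triv Valued.v ψ 0 ∨ ((conjPlace Q.c v ≠ v → v ∈ S) ∧ (conjPlace Q.c v = v → Above v 2 ∧
    (RamifiedIn K 2 → Triv Valued.v ψ 4 ∧ ψ (1 + ϖ v) = 1 ∧ ψ (1 + ϖ v ^ 3) = -1) ∧
    (InertIn K 2 → Triv Valued.v ψ 2 ∧ ψ (-1) = -1 ∧ ψ (1 + ζ v * 2) = 1)))

theorem valued_two_of_odd {v : HeightOneSpectrum (𝓞 K)} {p : ℕ} (hp : p.Prime) (hv : Above v p)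
    (h2 : p ≠ 2) : Valued.v (2 : v.adicCompletion K) = WithZero.exp (-((0 : ℕ) : ℤ)) := by
  have e : (2 : v.adicCompletion K) = emb v ((2 : 𝓞 K) : K) := by
    rw [show ((2 : 𝓞 K) : K) = 2 from map_ofNat (algebraMap (𝓞 K) K) 2, map_ofNat]
  rw [e, valued_emb_eq_one]
  · simp
  · intro h
    exact h2 (hv.unique hp Nat.prime_two (by simpa [Above] using h))

section Units

variable {v : HeightOneSpectrum (𝓞 K)} {x : v.adicCompletion K}

theorem valued_one_add_of_lev {n : ℕ} (hx : Lev Valued.v (n + 1) x) : Valued.v (1 + x) = 1 := by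
  refine unit_of_lev ?_
  rw [add_sub_cancel_left]
  exact hx.mono (Nat.le_add_left 1 n)

end Units

variable {S ϖ ζ}

/-- Every element at which the condition evaluates the character is a unit. -/
theorem Good.congr {v : HeightOneSpectrum (𝓞 K)} {ψ φ : v.adicCompletion K →*₀ ℂ}
    (hϖ : Above v 2 → RamifiedIn K 2 → Valued.v (ϖ v) = WithZero.exp (-1 : ℤ))
    (hζ : Above v 2 → InertIn K 2 → IsPrimitiveRoot (ζ v) 3)
    (h : ∀ x, Valued.v x = 1 → ψ x = φ x) (hg : Q.Good S ϖ ζ v ψ) : Q.Good S ϖ ζ v φ := by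
  have ht : ∀ n, Triv Valued.v ψ n → Triv Valued.v φ n := fun n hn u hu hl => by
    rw [← h u hu]
    exact hn u hu hl
  refine hg.imp (ht 0) fun ⟨h1, h2⟩ => ⟨h1, fun hc => ?_⟩
  obtain ⟨hA, hR, hI⟩ := h2 hc
  refine ⟨hA, fun hr => ?_, fun hi => ?_⟩
  · obtain ⟨a, b, c⟩ := hR hr
    have hp : Lev Valued.v 1 (ϖ v) := (hϖ hA hr).le
    refine ⟨ht 4 a, ?_, ?_⟩
    · rw [← h _ (valued_one_add_of_lev (n := 0) hp), b]
    · rw [← h _ (valued_one_add_of_lev (n := 2) (by simpa using hp.pow 3)), c]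
  · obtain ⟨a, b, c⟩ := hI hi
    have hram : ¬ RamifiedIn K 2 := by
      rw [Q.ramifiedIn_iff Nat.prime_two hA]
      rintro ⟨-, h'⟩
      have := ((Q.inertIn_iff Nat.prime_two hA).1 hi).2
      rw [h'] at this
      norm_num at this
    have h2 := Q.valued_natCast_of_not_ramified Nat.prime_two hA hram
    have hz : Valued.v (ζ v) ≤ 1 := by
      have := congrArg Valued.v (hζ hA hi).pow_eq_one
      rw [map_pow, map_one] at this
      exact (eq_one_of_pow_eq_one (by norm_num) this).le
    have h2' : Lev Valued.v 1 (2 : v.adicCompletion K) := by exact_mod_cast h2.le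
    refine ⟨ht 2 a, ?_, ?_⟩
    · rw [← h _ (by rw [Valuation.map_neg, map_one]), b]
    · rw [← h _ (valued_one_add_of_lev (n := 0) (h2'.mul_left hz)), c]

/-- The exact exponents come for free. `Triv.descend` gives at most `1` at odd split places and at
most `3` at split `2`, where `1` is impossible over the residue field `𝔽₂`. For ramified `2`, the
value `-1` at `1 + ϖ ^ 3` excludes exponents up to `3`; for inert `2`, the value `-1` at `-1 ≡ 1`
excludes exponents up to `1`. -/
theorem satisfiesACD_iff
    (hϖ : ∀ v, Above v 2 → RamifiedIn K 2 → Valued.v (ϖ v) = WithZero.exp (-1 : ℤ))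
    {χ : Idele K →ₜ* Circle} (hχ : ∀ x, χ x ^ 2 = 1) :
    SatisfiesACD S ϖ ζ χ ↔ ∀ v, Q.Good S ϖ ζ v (localHom χ v) := by
  constructor
  · rintro ⟨hA, hC, hDe, hD⟩ v
    by_cases h0 : Triv Valued.v (localHom χ v) 0
    · exact Or.inl h0
    have hdvd := (dvd_finiteConductor_iff hχ).2 h0
    obtain ⟨p, hp, hv⟩ := exists_prime_mem v
    refine Or.inr ⟨fun hc => (hC p hp ((Q.splitIn_iff hp hv).2 hc) v hv hdvd).1, fun hc => ?_⟩
    have hp2 : p = 2 := by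
      by_contra h2
      exact hA p hp h2 (Q.inertIn_or_ramifiedIn hp hv hc) v hv hdvd
    subst hp2
    obtain ⟨hr, hi⟩ := hDe v hv hdvd
    obtain ⟨hr', hi'⟩ := hD v hv hdvd
    rw [ordAt_finiteConductor hχ] at hr hi
    exact ⟨hv, fun h => ⟨(condExponent_le_iff hχ 4).1 (hr h).le, hr' h⟩,
      fun h => ⟨(condExponent_le_iff hχ 2).1 (hi h).le, hi' h⟩⟩
  · intro hG
    have key : ∀ v, v.asIdeal ∣ finiteConductor χ → (conjPlace Q.c v ≠ v → v ∈ S) ∧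
        (conjPlace Q.c v = v → Above v 2 ∧ (RamifiedIn K 2 → Triv Valued.v (localHom χ v) 4 ∧
          localHom χ v (1 + ϖ v) = 1 ∧ localHom χ v (1 + ϖ v ^ 3) = -1) ∧
        (InertIn K 2 → Triv Valued.v (localHom χ v) 2 ∧ localHom χ v (-1) = -1 ∧
          localHom χ v (1 + ζ v * 2) = 1)) := fun v hv =>
      (hG v).resolve_left ((dvd_finiteConductor_iff hχ).1 hv)
    refine ⟨fun p hp h2 hir v hv hdvd => ?_, fun p hp hs v hv hdvd => ?_, fun v hv hdvd => ?_,
      fun v hv hdvd => ?_⟩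
    · have hc : conjPlace Q.c v = v := hir.elim (fun h => ((Q.inertIn_iff hp hv).1 h).1)
        fun h => ((Q.ramifiedIn_iff hp hv).1 h).1
      exact h2 (hv.unique hp Nat.prime_two ((key v hdvd).2 hc).1)
    · have hc := (Q.splitIn_iff hp hv).1 hs
      have hn0 : condExponent χ v ≠ 0 := fun h =>
        (dvd_finiteConductor_iff hχ).1 hdvd ((condExponent_eq_zero_iff hχ).1 h)
      obtain ⟨T, N, hT⟩ := exists_finset_triv hχ
      refine ⟨(key v hdvd).1 hc, fun h2 => ?_, fun h2 => ?_⟩ <;> rw [ordAt_finiteConductor hχ]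
      · have := (condExponent_le_iff hχ _).2
          ((hT v).1.descend (isSq1_localHom hχ) (valued_two_of_odd hp hv h2))
        omega
      · subst h2
        have hram : ¬ RamifiedIn K 2 := fun h => hc ((Q.ramifiedIn_iff hp hv).1 h).1
        have hV := Q.valued_natCast_of_not_ramified hp hv hram
        have h3 := (condExponent_le_iff hχ _).2
          ((hT v).1.descend (isSq1_localHom hχ) (e := 1) (by exact_mod_cast hV))
        have hn1 : ¬ condExponent χ v ≤ 1 := fun h =>
          hn0 ((condExponent_eq_zero_iff hχ).2 (((condExponent_le_iff hχ 1).1 h).zero_of_one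
            (resTwo hv (Q.exists_int_sub_mem_of_split hp hv hc))))
        omega
    · refine ⟨fun hr => ?_, fun hi => ?_⟩ <;> rw [ordAt_finiteConductor hχ]
      · obtain ⟨-, hR, -⟩ := (key v hdvd).2 ((Q.ramifiedIn_iff Nat.prime_two hv).1 hr).1
        obtain ⟨a, b, c⟩ := hR hr
        have h4 := (condExponent_le_iff hχ _).2 a
        have h3 : ¬ condExponent χ v ≤ 3 := fun h => by
          have hp : Lev Valued.v 1 (ϖ v) := (hϖ v hv hr).le
          have hp3 : Lev Valued.v 3 (ϖ v ^ 3) := by simpa using hp.pow 3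
          have := (condExponent_le_iff hχ _).1 h _ (valued_one_add_of_lev hp3)
            (by rwa [add_sub_cancel_left])
          rw [this] at c
          norm_num at c
        omega
      · obtain ⟨hc, hN⟩ := (Q.inertIn_iff Nat.prime_two hv).1 hi
        obtain ⟨-, -, hI⟩ := (key v hdvd).2 hc
        obtain ⟨a, b, c⟩ := hI hi
        have h2 := (condExponent_le_iff hχ _).2 a
        have h1 : ¬ condExponent χ v ≤ 1 := fun h => by
          have hram : ¬ RamifiedIn K 2 := by
            rw [Q.ramifiedIn_iff Nat.prime_two hv, hN]
            norm_num
          have hV := Q.valued_natCast_of_not_ramified Nat.prime_two hv hram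
          have h2' : Lev Valued.v 1 (2 : v.adicCompletion K) := by exact_mod_cast hV.le
          have := (condExponent_le_iff hχ _).1 h (-1) (by rw [Valuation.map_neg, map_one])
            (by convert h2'.neg using 1; norm_num)
          rw [this] at b
          norm_num at b
        omega
    · refine ⟨fun hr => ?_, fun hi => ?_⟩
      · exact (((key v hdvd).2 ((Q.ramifiedIn_iff Nat.prime_two hv).1 hr).1).2.1 hr).2
      · exact (((key v hdvd).2 ((Q.inertIn_iff Nat.prime_two hv).1 hi).1).2.2 hi).2

end Good

end RealQuad

end QuadIdele

namespace QuadIdele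

/-! ### Conjugation of ideles -/

section Conjugation

variable {K : Type*} [Field K] [NumberField K] (σ : K ≃ₐ[ℚ] K)

theorem continuous_conjFiniteAdele : Continuous (conjFiniteAdele σ) :=
  RestrictedProduct.mapAlong_continuous
    (fun v : HeightOneSpectrum (𝓞 K) => v.adicCompletion K)
    (fun v : HeightOneSpectrum (𝓞 K) => v.adicCompletion K)
    (conjPlace σ) (Equiv.injective _).tendsto_cofinite
    (fun w => finiteCompletionHom (σ : K →+* K) (conjPlace σ w) w rfl)
    (Filter.Eventually.of_forall fun w => finiteCompletionHom_mapsTo _ _ w rfl)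
    fun w => continuous_finiteCompletionHom _ _ w rfl

omit [NumberField K] in
theorem continuous_infiniteCompletionHom {L : Type*} [Field L] [NumberField L] (j : K →+* L)
    (v : InfinitePlace K) (w : InfinitePlace L) (h : w.comap j = v) :
    Continuous (infiniteCompletionHom j v w h) := by
  let _ : Algebra K L := j.toAlgebra
  have : w.LiesOver v := ⟨congrArg Subtype.val h⟩
  exact NumberField.LiesOver.continuous_completionMap

omit [NumberField K] in
theorem infiniteCompletionHom_coe {L : Type*} [Field L] [NumberField L] (j : K →+* L)
    (v : InfinitePlace K) (w : InfinitePlace L) (h : w.comap j = v) (x : K) :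
    infiniteCompletionHom j v w h (x : v.Completion) = (j x : w.Completion) := by
  let _ : Algebra K L := j.toAlgebra
  have : w.LiesOver v := ⟨congrArg Subtype.val h⟩
  exact NumberField.LiesOver.completionMap_coe (v := v) (w := w) (WithAbs.toAbs v.1 x)

theorem continuous_conjIdele : Continuous (conjIdele σ) := by
  refine Continuous.units_map _ ?_
  have : Continuous (conjInfiniteAdele σ) := continuous_pi fun w =>
    (continuous_infiniteCompletionHom (σ : K →+* K) (w.comap (σ : K →+* K)) w rfl).comp
      (continuous_apply (w.comap (σ : K →+* K)))
  exact this.prodMap (continuous_conjFiniteAdele σ)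

theorem finComp_conjIdele (x : Idele K) (w : HeightOneSpectrum (𝓞 K)) :
    (finComp w (conjIdele σ x) : w.adicCompletion K) =
      finiteCompletionHom (σ : K →+* K) (conjPlace σ w) w rfl (finComp (conjPlace σ w) x) := rfl

theorem infComp_conjIdele (x : Idele K) (w : InfinitePlace K) :
    (infComp w (conjIdele σ x) : w.Completion) =
      infiniteCompletionHom (σ : K →+* K) (w.comap (σ : K →+* K)) w rfl
        (infComp (w.comap (σ : K →+* K)) x) := rfl

theorem conjIdele_principal (k : Kˣ) : conjIdele σ (principalIdele K k) =
    principalIdele K (Units.map (σ : K →* K) k) := by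
  refine idele_ext (fun v => Units.ext ?_) fun w => Units.ext ?_
  · rw [finComp_conjIdele, finComp_principal, finComp_principal]
    exact finiteCompletionHom_emb (σ : K →+* K) (conjPlace σ v) v rfl k
  · rw [infComp_conjIdele, infComp_principal, infComp_principal]
    exact infiniteCompletionHom_coe (σ : K →+* K) _ w rfl k

theorem conjIdele_localIdele (w : HeightOneSpectrum (𝓞 K))
    (u : ((conjPlace σ w).adicCompletion K)ˣ) : conjIdele σ (localIdele (conjPlace σ w) u) =
      localIdele w (Units.map (finiteCompletionHom (σ : K →+* K) (conjPlace σ w) w rfl) u) := by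
  refine idele_ext (fun v => Units.ext ?_) fun v => Units.ext ?_
  · rw [finComp_conjIdele]
    by_cases hv : v = w
    · subst hv
      rw [finComp_localIdele, finComp_localIdele]
      rfl
    · have hv' : conjPlace σ v ≠ conjPlace σ w := fun h => hv (Equiv.injective _ h)
      rw [finComp_localIdele_ne hv, finComp_localIdele_ne hv', Units.val_one, map_one,
        Units.val_one]
  · rw [infComp_conjIdele, infComp_localIdele, infComp_localIdele, Units.val_one, map_one,
      Units.val_one]

/-- The conjugate `χ ∘ σ` of a character. -/
def conjChar (χ : Idele K →ₜ* Circle) : Idele K →ₜ* Circle where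
  toMonoidHom := χ.toMonoidHom.comp (conjIdele σ)
  continuous_toFun := χ.continuous_toFun.comp (continuous_conjIdele σ)

theorem conjChar_apply (χ : Idele K →ₜ* Circle) (x : Idele K) :
    conjChar σ χ x = χ (conjIdele σ x) := rfl

theorem localHom_conjChar (χ : Idele K →ₜ* Circle) {v w : HeightOneSpectrum (𝓞 K)}
    (h : w.asIdeal.comap (RingOfIntegers.mapRingHom (σ : K →+* K)) = v.asIdeal)
    (x : v.adicCompletion K) :
    localHom (conjChar σ χ) v x = localHom χ w (finiteCompletionHom (σ : K →+* K) v w h x) := by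
  obtain rfl : v = conjPlace σ w := HeightOneSpectrum.ext h.symm
  by_cases hx : x = 0
  · rw [hx, map_zero, map_zero, map_zero]
  · rw [localHom_of_ne _ _ hx, localHom_of_ne _ _ ((map_ne_zero _).2 hx), conjChar_apply,
      conjIdele_localIdele]
    congr 3
    exact Units.ext rfl

end Conjugation

namespace RealQuad

variable {K : Type*} [Field K] [NumberField K] (Q : RealQuad K)

/-! ### Local components of characters factoring through the norm -/

section CompNorm

variable {κ : Idele K →ₜ* Circle} {ν : Idele ℚ →ₜ* Circle} (hκ : ∀ x, κ x = ν (Q.norm x))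
  {P : HeightOneSpectrum (𝓞 ℚ)} {v : HeightOneSpectrum (𝓞 K)}
  (h : v.asIdeal.comap (RingOfIntegers.mapRingHom (algebraMap ℚ K)) = P.asIdeal)
include hκ

theorem localHom_of_split (hv : conjPlace Q.c v ≠ v) (y : P.adicCompletion ℚ) :
    localHom κ v (finiteCompletionHom (algebraMap ℚ K) P v h y) = localHom ν P y := by
  by_cases hy : y = 0
  · rw [hy, map_zero, map_zero, map_zero]
  · rw [localHom_of_ne _ _ hy, localHom_of_ne _ _ ((map_ne_zero _).2 hy), hκ,
      Q.norm_localIdele_of_split h hv (y := Units.mk0 y hy) rfl]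

include h in
theorem localHom_of_nonsplit (hv : conjPlace Q.c v = v) {x : v.adicCompletion K}
    {y : P.adicCompletion ℚ} (hy : finiteCompletionHom (algebraMap ℚ K) P v h y =
      x * finiteCompletionHom (Q.c : K →+* K) v v
        ((Q.comap_conjPlace v).trans (congrArg _ hv)) x) :
    localHom κ v x = localHom ν P y := by
  by_cases hx : x = 0
  · rw [hx, zero_mul, map_eq_zero] at hy
    rw [hx, hy, map_zero, map_zero]
  · have hy0 : y ≠ 0 := by
      rintro rfl
      rw [map_zero, eq_comm, mul_eq_zero, map_eq_zero, or_self] at hy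
      exact hx hy
    rw [localHom_of_ne _ _ hx, localHom_of_ne _ _ hy0, hκ,
      Q.norm_localIdele_of_nonsplit h _ (u := Units.mk0 x hx) (y := Units.mk0 y hy0) hy]

include h in
-- The working tool for non-split places: the value of `ν ∘ N` at a global element is the value of
-- `ν` at its norm, a rational integer.
theorem localHom_emb (hv : conjPlace Q.c v = v) {a : K} {n : ℤ} (ha : a * Q.c a = n) :
    localHom κ v (emb v a) = localHom ν P (n : P.adicCompletion ℚ) := by
  refine Q.localHom_of_nonsplit hκ h hv ?_
  rw [finiteCompletionHom_emb, map_intCast, ← map_intCast (emb v), ← ha, map_mul]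
  rfl

end CompNorm

/-! ### Characters satisfying the local conditions are determined up to base change -/

section Good

variable {S : Set (HeightOneSpectrum (𝓞 K))} {v : HeightOneSpectrum (𝓞 K)}
  {ϖ ζ : (v : HeightOneSpectrum (𝓞 K)) → v.adicCompletion K}

theorem mem_iff_of_isSplitChoice (hS : IsSplitChoice S) (hv : conjPlace Q.c v ≠ v) :
    v ∈ S ↔ conjPlace Q.c v ∉ S := by
  obtain ⟨p, hp, hvp⟩ := exists_prime_mem v
  obtain ⟨w, ⟨hw, hwp⟩, hu⟩ := hS.2 p hp ((Q.splitIn_iff hp hvp).2 hv)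
  constructor
  · intro h h'
    exact hv ((hu _ ⟨h', Q.above_conjPlace hvp⟩).trans (hu _ ⟨h, hvp⟩).symm)
  · intro h
    rcases Q.eq_or_eq_conjPlace hp hvp hwp with rfl | rfl
    · exact hw
    · exact absurd hw h

include Q in
theorem valued_two_of_ramified (hv : Above v 2) (h : RamifiedIn K 2) :
    Valued.v (2 : v.adicCompletion K) = WithZero.exp (-2 : ℤ) := by
  have hs := Q.s_sq
  rw [← Q.eq_d_of_ramifiedIn Nat.prime_two hv h] at hs
  have : (2 : v.adicCompletion K) = emb v Q.s ^ 2 := by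
    rw [← map_pow, hs, map_natCast]
    rfl
  rw [this, map_pow, Q.valued_s_of_ramified Nat.prime_two hv h, ← WithZero.exp_nsmul]
  rfl

theorem emb_s_sq_of_ramified (hv : Above v 2) (h : RamifiedIn K 2) : emb v Q.s ^ 2 = 2 := by
  have hs := Q.s_sq
  rw [← Q.eq_d_of_ramifiedIn Nat.prime_two hv h] at hs
  rw [← map_pow, hs, map_natCast]
  rfl

include Q in
theorem not_ramifiedIn_of_inertIn (hv : Above v 2) (h : InertIn K 2) : ¬ RamifiedIn K 2 := by
  rw [Q.ramifiedIn_iff Nat.prime_two hv]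
  rintro ⟨-, h'⟩
  have := ((Q.inertIn_iff Nat.prime_two hv).1 h).2
  rw [h'] at this
  norm_num at this

include Q in
theorem valued_two_of_inert (hv : Above v 2) (h : InertIn K 2) :
    Valued.v (2 : v.adicCompletion K) = WithZero.exp (-1 : ℤ) := by
  exact_mod_cast Q.valued_natCast_of_not_ramified Nat.prime_two hv
    (Q.not_ramifiedIn_of_inertIn hv h)

theorem _root_.IsPrimitiveRoot.sq_add_self_add_one {L : Type*} [Field L] {z : L}
    (h : IsPrimitiveRoot z 3) : z ^ 2 + z + 1 = 0 := by
  have := h.geom_sum_eq_zero (by norm_num)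
  rw [Finset.sum_range_succ, Finset.sum_range_succ, Finset.sum_range_one] at this
  linear_combination this

variable (hϖ : ∀ v, Above v 2 → RamifiedIn K 2 → Valued.v (ϖ v) = WithZero.exp (-1 : ℤ))
  (hζ : ∀ v, Above v 2 → InertIn K 2 → IsPrimitiveRoot (ζ v) 3)
include hϖ hζ

omit hζ in
-- Every ramified alternative at a non-split place has value `-1` at `-1`: by definition when `2` is
-- inert, by `ramified_neg_one` when `2` ramifies.
theorem Good.triv_zero_of_neg_one {ψ : v.adicCompletion K →*₀ ℂ} (hψ : IsSq1 ψ)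
    (hc : conjPlace Q.c v = v) (hg : Q.Good S ϖ ζ v ψ) (h : ψ (-1) = 1) :
    Triv Valued.v ψ 0 := by
  refine hg.resolve_right fun ⟨_, h'⟩ => ?_
  obtain ⟨hA, hR, hI⟩ := h' hc
  have h1 : (1 : ℂ) ≠ -1 := by norm_num
  rcases Q.inertIn_or_ramifiedIn Nat.prime_two hA hc with hi | hr
  · exact h1 (h.symm.trans (hI hi).2.1)
  · obtain ⟨a, b, d⟩ := hR hr
    have hres := resTwo hA (Q.exists_int_sub_mem_of_ramified Nat.prime_two hA hr)
    have := ramified_neg_one hres (Q.valued_two_of_ramified hA hr) (hϖ v hA hr) hψ a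
      (Q.emb_s_sq_of_ramified hA hr)
    exact h1 (h.symm.trans (this.trans d))

/-- Comparing values at `-1`, the two characters are both unramified or both ramified. In the latter
case they have the same prescribed values, so the product is `1` on the elements that generate the
filtration. -/
theorem Good.triv_zero_mul {ψ φ κ : v.adicCompletion K →*₀ ℂ} (hψ : IsSq1 ψ) (hφ : IsSq1 φ)
    (hc : conjPlace Q.c v = v) (gψ : Q.Good S ϖ ζ v ψ) (gφ : Q.Good S ϖ ζ v φ)
    (hκ : ∀ x, κ x = ψ x * φ x) (h : κ (-1) = 1) : Triv Valued.v κ 0 := by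
  have hmul : ∀ n, Triv Valued.v ψ n → Triv Valued.v φ n → Triv Valued.v κ n :=
    fun n hn hn' u hu hl => by rw [hκ, hn u hu hl, hn' u hu hl, one_mul]
  have h1 : (-1 : v.adicCompletion K) ≠ 0 := neg_ne_zero.2 one_ne_zero
  rw [hκ] at h
  by_cases h0 : Triv Valued.v ψ 0
  · have : ψ (-1) = 1 := h0 _ (by rw [Valuation.map_neg, map_one]) (lev_zero_iff.2 (by
      refine Valuation.map_sub_le _ ?_ ?_ <;> simp))
    rw [this, one_mul] at h
    exact hmul 0 h0 (Good.triv_zero_of_neg_one Q hϖ hφ hc gφ h)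
  have h0' : ¬ Triv Valued.v φ 0 := by
    intro h0'
    have : φ (-1) = 1 := h0' _ (by rw [Valuation.map_neg, map_one]) (lev_zero_iff.2 (by
      refine Valuation.map_sub_le _ ?_ ?_ <;> simp))
    rw [this, mul_one] at h
    exact h0 (Good.triv_zero_of_neg_one Q hϖ hψ hc gψ h)
  obtain ⟨hA, hR, hI⟩ := (gψ.resolve_left h0).2 hc
  obtain ⟨-, hR', hI'⟩ := (gφ.resolve_left h0').2 hc
  rcases Q.inertIn_or_ramifiedIn Nat.prime_two hA hc with hi | hr
  · obtain ⟨a, b, d⟩ := hI hi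
    obtain ⟨a', b', d'⟩ := hI' hi
    have hN := ((Q.inertIn_iff Nat.prime_two hA).1 hi).2
    have hz := (hζ v hA hi).sq_add_self_add_one
    have hκ2 : IsSq1 κ := fun x hx => by rw [hκ, mul_pow, hψ x hx, hφ x hx, one_mul]
    refine triv_zero_of_inert (Q.valued_two_of_inert hA hi) hz (resFour hN hz) hκ2
      (hmul 2 a a') ?_ ?_
    · rw [hκ, h]
    · rw [hκ, d, d', one_mul]
  · obtain ⟨a, b, d⟩ := hR hr
    obtain ⟨a', b', d'⟩ := hR' hr
    have hres := resTwo hA (Q.exists_int_sub_mem_of_ramified Nat.prime_two hA hr)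
    refine triv_zero_of_ramified hres (Q.valued_two_of_ramified hA hr) (hϖ v hA hr)
      (hmul 4 a a') ?_ ?_
    · rw [hκ, b, b', one_mul]
    · rw [hκ, d, d', neg_mul_neg, one_mul]

/-- The core of (II) and (III): `κ = χη` is unramified everywhere. At a non-split place its value at
`-1` is `1`, because `N(-1) = 1`. At a split place outside `S` both factors are unramified, and this
transfers to the conjugate place in `S`, where `κ` comes from the same component of `ν`. -/
theorem eq_of_good (hS : IsSplitChoice S) {χ η κ : Idele K →ₜ* Circle}
    (hχ : ∀ x, χ x ^ 2 = 1) (hη : ∀ x, η x ^ 2 = 1)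
    (gχ : ∀ v, Q.Good S ϖ ζ v (localHom χ v)) (gη : ∀ v, Q.Good S ϖ ζ v (localHom η v))
    (hκ : FromBaseChange κ) (hκ' : κ ∈ IdeleClassCharacter K) (h : χ = η * κ) : χ = η := by
  obtain ⟨ν, hν, hνκ⟩ := (Q.fromBaseChange_iff κ).1 hκ
  have hmul : ∀ x, κ x = χ x * η x := fun x => by
    rw [h, ContinuousMonoidHom.mul_apply, mul_right_comm, ← sq, hη, one_mul]
  have hloc : ∀ v x, localHom κ v x = localHom χ v x * localHom η v x := fun v x => by
    rw [← localHom_mul]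
    congr 2
    exact DFunLike.ext _ _ hmul
  suffices κ = 1 by rw [h, this, mul_one]
  refine Q.eq_one_of_unramified hκ' (fun x => by rw [hmul, mul_pow, hχ, hη, one_mul]) fun v => ?_
  rw [← triv_zero_iff]
  have hout : ∀ v, conjPlace Q.c v ≠ v → v ∉ S → Triv Valued.v (localHom κ v) 0 := by
    intro v hv hvS u hu hl
    have hχ0 := (gχ v).resolve_right fun h' => hvS (h'.1 hv)
    have hη0 := (gη v).resolve_right fun h' => hvS (h'.1 hv)
    rw [hloc, hχ0 u hu hl, hη0 u hu hl, one_mul]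
  by_cases hc : conjPlace Q.c v = v
  · refine Good.triv_zero_mul Q hϖ hζ (isSq1_localHom hχ) (isSq1_localHom hη) hc (gχ v) (gη v)
      (hloc v) ?_
    obtain ⟨P, hP⟩ := exists_below v
    have := Q.localHom_emb hνκ hP hc (a := -1) (n := 1) (by rw [map_neg, map_one]; norm_num)
    rwa [Int.cast_one, map_one, map_neg, map_one] at this
  · by_cases hvS : v ∈ S
    · have hvS' := (Q.mem_iff_of_isSplitChoice hS hc).1 hvS
      have hc' : conjPlace Q.c (conjPlace Q.c v) ≠ conjPlace Q.c v := by
        rw [Q.conjPlace_conjPlace]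
        exact Ne.symm hc
      obtain ⟨P, hP⟩ := exists_below v
      have hP' := (Q.comap_eq_iff_of_comap_eq hP).2 (Or.inr rfl)
      intro u hu hl
      obtain ⟨y, rfl⟩ := Q.base_surjective hP hc u
      rw [Q.localHom_of_split hνκ hP hc, ← Q.localHom_of_split hνκ hP' hc']
      obtain ⟨e, he, hV⟩ := exists_valued_finiteCompletionHom _ _ _ hP
      obtain ⟨e', he', hV'⟩ := exists_valued_finiteCompletionHom _ _ _ hP'
      rw [hV] at hu
      have hu' := hV' y
      rw [eq_one_of_pow_eq_one he hu, one_pow] at hu'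
      refine hout _ hc' hvS' _ hu' (lev_zero_iff.2 (Valuation.map_sub_le _ hu'.le ?_))
      rw [map_one]
    · exact hout v hc hvS

omit hζ in
-- If `χ` were invariant, then at a non-split place its values at `√d` and `-√d` would agree, so its
-- value at `-1` would be `1` and `χ` would be unramified there. At a place of `S` it would inherit
-- triviality on units from the conjugate place outside `S`. So the conductor would be trivial.
theorem conjChar_ne (hS : IsSplitChoice S) {χ : Idele K →ₜ* Circle}
    (hχ : ∀ x, χ x ^ 2 = 1) (gχ : ∀ v, Q.Good S ϖ ζ v (localHom χ v))
    (hf : finiteConductor χ ≠ ⊤) : conjChar Q.c χ ≠ χ := by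
  intro h
  have hcc : ∀ {v w : HeightOneSpectrum (𝓞 K)} (hw : w.asIdeal.comap
      (RingOfIntegers.mapRingHom (Q.c : K →+* K)) = v.asIdeal) (x : v.adicCompletion K),
      localHom χ v x = localHom χ w (finiteCompletionHom (Q.c : K →+* K) v w hw x) := by
    intro v w hw x
    conv_lhs => rw [← h]
    exact localHom_conjChar Q.c χ hw x
  suffices ∀ v, condExponent χ v = 0 by
    refine hf ?_
    simp only [finiteConductor, this, pow_zero, finprod_one]
    exact Ideal.one_eq_top
  intro v
  rw [condExponent_eq_zero_iff hχ]
  by_cases hc : conjPlace Q.c v = v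
  · refine Good.triv_zero_of_neg_one Q hϖ (isSq1_localHom hχ) hc (gχ v) ?_
    have := hcc ((Q.comap_conjPlace v).trans (congrArg _ hc)) (emb v Q.s)
    rw [finiteCompletionHom_emb, show (Q.c : K →+* K) Q.s = -Q.s from Q.c_s,
      ← neg_one_mul, map_mul (emb v), map_mul, map_neg, map_one] at this
    have hs : localHom χ v (emb v Q.s) ≠ 0 := (map_ne_zero _).2 ((map_ne_zero _).2 Q.s_ne_zero)
    exact mul_right_cancel₀ hs (by rw [← this, one_mul])
  · by_cases hvS : v ∈ S
    · have hvS' := (Q.mem_iff_of_isSplitChoice hS hc).1 hvS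
      have hc' : conjPlace Q.c (conjPlace Q.c v) ≠ conjPlace Q.c v := by
        rw [Q.conjPlace_conjPlace]
        exact Ne.symm hc
      have h0 := (gχ (conjPlace Q.c v)).resolve_right fun h' => hvS' (h'.1 hc')
      have hw : (conjPlace Q.c v).asIdeal.comap (RingOfIntegers.mapRingHom (Q.c : K →+* K)) =
          v.asIdeal := by
        rw [Q.comap_conjPlace, Q.conjPlace_conjPlace]
      intro u hu hl
      rw [hcc hw]
      obtain ⟨e, -, hV⟩ := exists_valued_finiteCompletionHom _ _ _ hw
      have hu' := hV u
      rw [hu, one_pow] at hu'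
      refine h0 _ hu' (lev_zero_iff.2 (Valuation.map_sub_le _ hu'.le ?_))
      rw [map_one]
    · exact (gχ v).resolve_right fun h' => hvS (h'.1 hc)

end Good

end RealQuad

end QuadIdele

namespace QuadIdele

/-! ### Local characters -/

section LocalCharacters

variable {L : Type*} [Field L] (V : Valuation L (WithZero (Multiplicative ℤ)))

/-- The group of principal units of level `n`. -/
def levelUnits (n : ℕ) : Subgroup Lˣ where
  carrier := {u | V (u : L) = 1 ∧ Lev V n ((u : L) - 1)}
  mul_mem' := fun {a b} ha hb => by
    refine ⟨by rw [Units.val_mul, map_mul, ha.1, hb.1, one_mul], ?_⟩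
    have : ((a * b : Lˣ) : L) - 1 = a * ((b : L) - 1) + ((a : L) - 1) := by push_cast; ring
    rw [this]
    exact (hb.2.mul_left ha.1.le).add ha.2
  one_mem' := ⟨map_one V, by rw [Units.val_one, sub_self]; exact Lev.zero n⟩
  inv_mem' := fun {a} ha => by
    have hV : V ((a⁻¹ : Lˣ) : L) = 1 := by
      rw [Units.val_inv_eq_inv_val, map_inv₀, ha.1, inv_one]
    refine ⟨hV, ?_⟩
    have : ((a⁻¹ : Lˣ) : L) - 1 = -(((a⁻¹ : Lˣ) : L) * ((a : L) - 1)) := by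
      rw [mul_sub, Units.inv_mul]
      ring
    rw [this]
    exact (ha.2.mul_left hV.le).neg

variable {V}

/-- If `a` is not congruent to `t ^ m * b ^ k` modulo level `n` for any unit `t`, then some
character of exponent `m`, trivial at `b` and on the principal units of level `n`, is non-trivial
at `a`. -/
theorem exists_local_character {n m : ℕ} (hm : m ≠ 0) {a b : L} (ha : V a = 1) (hb : V b = 1)
    (h : ∀ t, V t = 1 → ∀ k < m, ¬ Lev V n (a - t ^ m * b ^ k)) :
    ∃ f : Lˣ →* Circle, (∀ u : Lˣ, V (u : L) = 1 → Lev V n ((u : L) - 1) → f u = 1) ∧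
      (∀ u, f u ^ m = 1) ∧ extendHom f b = 1 ∧ extendHom f a ≠ 1 := by
  set a' : Lˣ := Units.mk0 a (ne_zero_of_unit ha) with ha'
  set b' : Lˣ := Units.mk0 b (ne_zero_of_unit hb) with hb'
  -- The subgroup on which the character must vanish; it exists as soon as `a` lies outside it.
  let H : Subgroup Lˣ := levelUnits V n ⊔ ((powMonoidHom m).range ⊔ Subgroup.zpowers b')
  have haH : a' ∉ H := by
    intro hH
    obtain ⟨u, hu, y, hy, huy⟩ := Subgroup.mem_sup.1 hH
    obtain ⟨_, ⟨t, rfl⟩, z, hz, rfl⟩ := Subgroup.mem_sup.1 hy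
    obtain ⟨k, rfl⟩ := Subgroup.mem_zpowers_iff.1 hz
    have hm' : (0 : ℤ) < m := by positivity
    obtain ⟨r, hr⟩ := Int.eq_ofNat_of_zero_le (Int.emod_nonneg k hm'.ne')
    have hrm : r < m := by
      have := Int.emod_lt_of_pos k hm'
      omega
    -- An exponent of `b` may be reduced modulo `m`, the rest being absorbed into the `m`-th power.
    have hk : b' ^ k = (b' ^ (k / m)) ^ m * b' ^ r := by
      rw [← zpow_natCast, ← zpow_natCast, ← zpow_mul, ← zpow_add, ← Int.mul_ediv_add_emod k m,
        ← hr]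
      congr 1
      rw [Int.mul_ediv_add_emod, hr]
      have := Int.mul_ediv_add_emod k m
      linarith
    set T : Lˣ := t * b' ^ (k / m) with hT
    have e : (a : L) = u * ((T : L) ^ m * b ^ r) := by
      have := congrArg Units.val huy
      rw [hk, powMonoidHom_apply, ha', Units.val_mk0] at this
      rw [← this, hT]
      push_cast
      rw [hb', Units.val_mk0]
      ring
    have hTV : V (T : L) = 1 := by
      have := congrArg V e
      rw [ha, map_mul, hu.1, one_mul, map_mul, map_pow, map_pow, hb, one_pow, mul_one] at this
      exact RealQuad.eq_one_of_pow_eq_one hm this.symm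
    refine h T hTV r hrm ?_
    have : a - (T : L) ^ m * b ^ r = ((T : L) ^ m * b ^ r) * ((u : L) - 1) := by
      rw [e]
      ring
    rw [this]
    refine hu.2.mul_left ?_
    rw [map_mul, map_pow, map_pow, hb, hTV, one_pow, one_pow, one_mul]
  obtain ⟨f, hf, hfa⟩ := exists_character H haH
  refine ⟨f, fun u hu hl => hf u (Subgroup.mem_sup_left ⟨hu, hl⟩), fun u => ?_, ?_, ?_⟩
  · rw [← map_pow]
    exact hf _ (Subgroup.mem_sup_right (Subgroup.mem_sup_left ⟨u, rfl⟩))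
  · rw [extendHom_of_ne f (ne_zero_of_unit hb), Circle.coe_eq_one]
    exact hf _ (Subgroup.mem_sup_right (Subgroup.mem_sup_right (Subgroup.mem_zpowers b')))
  · rw [extendHom_of_ne f (ne_zero_of_unit ha), Ne, Circle.coe_eq_one]
    exact hfa

theorem exists_local_character' {n m : ℕ} (hm : m ≠ 0) {a : L} (ha : V a = 1)
    (h : ∀ t, V t = 1 → ¬ Lev V n (a - t ^ m)) :
    ∃ f : Lˣ →* Circle, (∀ u : Lˣ, V (u : L) = 1 → Lev V n ((u : L) - 1) → f u = 1) ∧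
      (∀ u, f u ^ m = 1) ∧ extendHom f a ≠ 1 := by
  obtain ⟨f, h1, h2, -, h3⟩ := exists_local_character (V := V) (b := 1) hm ha (map_one V)
    fun t ht k _ => by
      rw [one_pow, mul_one]
      exact h t ht
  exact ⟨f, h1, h2, h3⟩

end LocalCharacters

theorem localIdele_mem_unitIdeles {F : Type*} [Field F] [NumberField F]
    {v : HeightOneSpectrum (𝓞 F)} {u : (v.adicCompletion F)ˣ}
    (hu : Valued.v (u : v.adicCompletion F) = 1) : localIdele v u ∈ unitIdeles F := by
  intro w
  rw [← finComp_val]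
  by_cases hw : w = v
  · subst hw
    rwa [finComp_localIdele]
  · rw [finComp_localIdele_ne hw]
    exact map_one _

theorem triv_of_le {L : Type*} [Field L] {V : Valuation L (WithZero (Multiplicative ℤ))}
    {ψ : L →*₀ ℂ} (h : ∀ u, V u = 1 → ψ u = 1) (n : ℕ) : Triv V ψ n := fun u hu _ => h u hu

theorem Triv.apply_unit {L : Type*} [Field L] {V : Valuation L (WithZero (Multiplicative ℤ))}
    {ψ : L →*₀ ℂ} (h : Triv V ψ 0) {u : L} (hu : V u = 1) : ψ u = 1 :=
  h u hu (lev_zero_iff.2 (Valuation.map_sub_le _ hu.le (map_one V).le))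

namespace RealQuad

variable {K : Type*} [Field K] [NumberField K] (Q : RealQuad K)

/-! ### Twists by characters arising from base change -/

/-- Quadratic-or-trivial characters arising from base change and unramified outside `p`. -/
structure IsTwist (p : ℕ) (κ : Idele K →ₜ* Circle) : Prop where
  mem : κ ∈ IdeleClassCharacter K
  base : FromBaseChange κ
  sq : ∀ x, κ x ^ 2 = 1
  triv : ∀ v, ¬ Above v p → Triv Valued.v (localHom κ v) 0

theorem localHom_one_apply {F : Type*} [Field F] [NumberField F] (v : HeightOneSpectrum (𝓞 F))
    {x : v.adicCompletion F} (hx : x ≠ 0) : localHom (1 : Idele F →ₜ* Circle) v x = 1 :=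
  (localHom_of_ne _ _ hx).trans Circle.coe_one

include Q in
theorem fromBaseChange_one : FromBaseChange (1 : Idele K →ₜ* Circle) :=
  (Q.fromBaseChange_iff 1).2 ⟨1, one_mem _, fun _ => rfl⟩

include Q in
theorem fromBaseChange_mul {κ μ : Idele K →ₜ* Circle} (h : FromBaseChange κ)
    (h' : FromBaseChange μ) : FromBaseChange (κ * μ) := by
  obtain ⟨ν, hν, h⟩ := (Q.fromBaseChange_iff κ).1 h
  obtain ⟨ν', hν', h'⟩ := (Q.fromBaseChange_iff μ).1 h'
  refine (Q.fromBaseChange_iff _).2 ⟨ν * ν', mul_mem hν hν', fun x => ?_⟩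
  rw [ContinuousMonoidHom.mul_apply, ContinuousMonoidHom.mul_apply, h, h']

include Q in
theorem isTwist_one (p : ℕ) : IsTwist p (1 : Idele K →ₜ* Circle) where
  mem := one_mem _
  base := Q.fromBaseChange_one
  sq _ := one_pow 2
  triv v _ _ hu _ := localHom_one_apply v (ne_zero_of_unit hu)

include Q in
theorem IsTwist.mul {p : ℕ} {κ μ : Idele K →ₜ* Circle} (h : IsTwist p κ) (h' : IsTwist p μ) :
    IsTwist p (κ * μ) where
  mem := mul_mem h.mem h'.mem
  base := Q.fromBaseChange_mul h.base h'.base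
  sq x := by rw [ContinuousMonoidHom.mul_apply, mul_pow, h.sq, h'.sq, one_mul]
  triv v hv u hu hl := by rw [localHom_mul, h.triv v hv u hu hl, h'.triv v hv u hu hl, one_mul]

/-- A local character at `P` is globalised over `ℚ` with finite ramification only at `P`, then
composed with the norm. Away from `p` the norm of a local unit idele has component `1` at `P` and
squares at infinity, so the result is unramified there. -/
theorem exists_baseChange {P : HeightOneSpectrum (𝓞 ℚ)} {p : ℕ} (hP : Above P p)
    (φ : (P.adicCompletion ℚ)ˣ →* Circle) (n : ℕ)
    (hn : ∀ u : (P.adicCompletion ℚ)ˣ, Valued.v (u : P.adicCompletion ℚ) = 1 →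
      Lev Valued.v n ((u : P.adicCompletion ℚ) - 1) → φ u = 1)
    (m : ℕ) (hm : Even m) (hφ : ∀ u, φ u ^ m = 1) :
    ∃ κ ∈ IdeleClassCharacter K, ∃ ν : Idele ℚ →ₜ* Circle, FromBaseChange κ ∧
      (∀ x, κ x = ν (Q.norm x)) ∧ (∀ x, ν x ^ m = 1) ∧
      (∀ y : P.adicCompletion ℚ, Valued.v y = 1 → localHom ν P y = extendHom φ y) ∧
      ∀ v, ¬ Above v p → Triv Valued.v (localHom κ v) 0 := by
  obtain ⟨ν, hν, hνm, hνφ⟩ := exists_rat_character P φ n hn m hm hφ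
  obtain ⟨κ, hκ, hκν⟩ := Q.exists_compNorm hν P n fun y hy => by
    rw [hνφ y hy.1 hy.2.2]
    exact hn _ (hy.1 P) (hy.2.1 P (Finset.mem_singleton_self P))
  refine ⟨κ, hκ, ν, (Q.fromBaseChange_iff κ).2 ⟨ν, hν, hκν⟩, hκν, hνm, fun y hy => ?_,
    fun v hv => ?_⟩
  · rw [localHom_of_ne _ _ (ne_zero_of_unit hy), extendHom_of_ne φ (ne_zero_of_unit hy),
      hνφ (localIdele P (Units.mk0 y (ne_zero_of_unit hy)))
        (localIdele_mem_unitIdeles (u := Units.mk0 y (ne_zero_of_unit hy)) hy)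
        fun w => ⟨1, (one_mul 1).symm⟩, finComp_localIdele]
  · rw [triv_zero_iff]
    intro u hu
    rw [hκν, hνφ _ (Q.valued_norm (localIdele_mem_unitIdeles hu)) (Q.isSquare_norm fun w =>
      ⟨1, (one_mul 1).symm⟩)]
    convert map_one φ
    obtain ⟨w, hw⟩ := exists_comap_eq (F := K) P
    have hwp := (above_of_comap_eq (p := p) hw).2 hP
    have h1 : w ≠ v := fun e => hv (e ▸ hwp)
    have h2 : conjPlace Q.c w ≠ v := fun e => hv (e ▸ Q.above_conjPlace hwp)
    apply Units.ext
    apply (finiteCompletionHom (algebraMap ℚ K) P w hw).injective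
    rw [finComp_val, Q.base_norm (localIdele v u) hw (Q.comap_conjPlace w), ← finComp_val,
      ← finComp_val, finComp_localIdele_ne h1, finComp_localIdele_ne h2, Units.val_one,
      Units.val_one, map_one, one_mul, Units.val_one, map_one]

end RealQuad

end QuadIdele

namespace QuadIdele

/-! ### Congruences at rational places -/

section Rational

variable {P : HeightOneSpectrum (𝓞 ℚ)} {p : ℕ}

theorem rat_exists_int_close {t : P.adicCompletion ℚ} (ht : Valued.v t ≤ 1) :
    ∃ k : ℤ, Lev Valued.v 1 (t - k) := by
  obtain ⟨a, ha⟩ := exists_integer_close ht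
  obtain ⟨k, rfl⟩ := rat_eq_intCast a
  refine ⟨k, ?_⟩
  convert ha using 2
  simp

theorem Lev.pow_sub_pow {L : Type*} [Field L] {V : Valuation L (WithZero (Multiplicative ℤ))}
    {n : ℕ} {x y : L} (hx : V x ≤ 1) (hy : V y ≤ 1) (h : Lev V n (x - y)) (m : ℕ) :
    Lev V n (x ^ m - y ^ m) := by
  induction m with
  | zero => simpa using Lev.zero n
  | succ m ih =>
    have : x ^ (m + 1) - y ^ (m + 1) = (x ^ m - y ^ m) * x + y ^ m * (x - y) := by ring
    rw [this]
    refine (ih.mul_right hx).add (h.mul_left ?_)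
    rw [map_pow]
    exact pow_le_one₀ zero_le hy

theorem rat_intCast_le_one (n : ℤ) : Valued.v (n : P.adicCompletion ℚ) ≤ 1 := by
  have := valued_emb_le_one (v := P) (n : 𝓞 ℚ)
  simpa using this

theorem rat_not_lev_of_not_pow (hp : p.Prime) (hP : Above P p) {a : ℤ} {m : ℕ}
    (h : ∀ k : ZMod p, (a : ZMod p) ≠ k ^ m) (t : P.adicCompletion ℚ) (ht : Valued.v t = 1) :
    ¬ Lev Valued.v 1 ((a : P.adicCompletion ℚ) - t ^ m) := by
  intro hl
  obtain ⟨k, hk⟩ := rat_exists_int_close ht.le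
  have := hl.add (hk.pow_sub_pow ht.le (rat_intCast_le_one k) m)
  rw [sub_add_sub_cancel, ← Int.cast_pow, ← Int.cast_sub, rat_lev_iff hp hP, pow_one,
    ← ZMod.intCast_zmod_eq_zero_iff_dvd] at this
  refine h k ?_
  push_cast at this
  exact sub_eq_zero.1 this

/-- Squares of `2`-adic units are congruent to `1` modulo `8`. -/
theorem rat_not_lev_three (hP : Above P 2) {n : ℕ} (hn : n ≤ 3) {a : ℤ} (ha : ¬ (2 : ℤ) ^ n ∣ a - 1)
    (t : P.adicCompletion ℚ) (ht : Valued.v t = 1) :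
    ¬ Lev Valued.v n ((a : P.adicCompletion ℚ) - t ^ 2) := by
  intro hl
  have := hl.add ((lev_three_sq_sub_one (rat_resTwo hP) (rat_valued_two hP) ht).mono hn)
  rw [sub_add_sub_cancel, ← Int.cast_one, ← Int.cast_sub, rat_lev_iff Nat.prime_two hP] at this
  exact ha (by exact_mod_cast this)

/-- Fourth powers of `2`-adic units are `1` modulo `16`, whereas `25` is `9`. This supplies a
character of exponent `4` separating `25` from `1`. -/
theorem rat_not_lev_four (hP : Above P 2) (t : P.adicCompletion ℚ) (ht : Valued.v t = 1) :
    ¬ Lev Valued.v 4 (((25 : ℤ) : P.adicCompletion ℚ) - t ^ 4) := by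
  intro hl
  have h3 := lev_three_sq_sub_one (rat_resTwo hP) (rat_valued_two hP) ht
  have h2 : Lev Valued.v 1 (2 : P.adicCompletion ℚ) := (rat_valued_two hP).le
  have h1 : Lev Valued.v 1 (t ^ 2 + 1) := by
    have := (h3.mono (by norm_num : 1 ≤ 3)).add h2
    convert this using 1
    ring
  have := hl.add (h3.mul h1)
  rw [show ((25 : ℤ) : P.adicCompletion ℚ) - t ^ 4 + (t ^ 2 - 1) * (t ^ 2 + 1) = (24 : ℤ) by
    push_cast; ring, rat_lev_iff Nat.prime_two hP] at this
  norm_num at this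

theorem exists_nonresidue {p : ℕ} (hp : p.Prime) (h2 : p ≠ 2) :
    ∃ g : ℤ, ∀ k : ZMod p, (g : ZMod p) ≠ k ^ 2 := by
  have : Fact p.Prime := ⟨hp⟩
  obtain ⟨a, ha⟩ := FiniteField.exists_nonsquare (F := ZMod p) (by rwa [ZMod.ringChar_zmod_n])
  obtain ⟨g, rfl⟩ := ZMod.intCast_surjective a
  exact ⟨g, fun k hk => ha ⟨k, hk.trans (sq k)⟩⟩

theorem not_dvd_of_nonresidue {p : ℕ} {g : ℤ} {m : ℕ} (hm : m ≠ 0)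
    (h : ∀ k : ZMod p, (g : ZMod p) ≠ k ^ m) : ¬ (p : ℤ) ∣ g := fun hd =>
  h 0 (by rw [zero_pow hm, ZMod.intCast_zmod_eq_zero_iff_dvd]; exact hd)

end Rational

theorem IsSq1.eq_neg_one {L : Type*} [Field L] {ψ : L →*₀ ℂ} (h : IsSq1 ψ) {x : L} (hx : x ≠ 0)
    (h1 : ψ x ≠ 1) : ψ x = -1 := (h.cases hx).resolve_left h1

namespace RealQuad

variable {K : Type*} [Field K] [NumberField K] (Q : RealQuad K)

/-! ### Twists at split primes, and preparations for odd non-split primes -/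

section Twist

variable {S : Set (HeightOneSpectrum (𝓞 K))} {v : HeightOneSpectrum (𝓞 K)}
  {ϖ ζ : (v : HeightOneSpectrum (𝓞 K)) → v.adicCompletion K}
  {χ : Idele K →ₜ* Circle} (hχ : ∀ x, χ x ^ 2 = 1)

include hχ in
-- `K_v` equals the completion of `ℚ`, so `ν` can be taken with the component of `χ` at `v` on
-- units. The twist then cancels the ramification at `v`; at the conjugate place, which belongs to
-- `S`, nothing is required.
theorem exists_twist_of_split (hS : IsSplitChoice S) {p : ℕ} (hp : p.Prime) (hv : Above v p)
    (hc : conjPlace Q.c v ≠ v) (hvS : v ∉ S) :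
    ∃ κ, IsTwist p κ ∧ ∀ w, Above w p → Q.Good S ϖ ζ w (localHom (χ * κ) w) := by
  obtain ⟨P, hP⟩ := exists_below v
  have hPp := (above_of_comap_eq (p := p) hP).1 hv
  obtain ⟨T, N, hT⟩ := exists_finset_triv hχ
  obtain ⟨e, he, hV⟩ := exists_valued_finiteCompletionHom _ _ _ hP
  let i := finiteCompletionHom (algebraMap ℚ K) P v hP
  let φ : (P.adicCompletion ℚ)ˣ →* Circle :=
    (χ.toMonoidHom.comp (localIdele v)).comp (Units.map (i : P.adicCompletion ℚ →* _))
  obtain ⟨κ, hκ, ν, hb, hκν, hν2, hνφ, hκv⟩ := Q.exists_baseChange hPp φ N (fun u hu hl => by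
      refine (triv_localHom_iff χ v N).1 (hT v).1 _ ((hV u).trans (by rw [hu, one_pow])) ?_
      have : Valued.v (i ((u : P.adicCompletion ℚ) - 1)) ≤ Valued.v ((u : P.adicCompletion ℚ) - 1) := by
        refine (hV _).trans_le (pow_le_of_le_one zero_le ?_ he)
        exact Valuation.map_sub_le _ hu.le (map_one _).le
      rw [map_sub, map_one] at this
      exact this.trans hl) 2 even_two fun u => hχ _
  refine ⟨κ, ⟨hκ, hb, fun x => by rw [hκν, hν2], hκv⟩, fun w hw => ?_⟩
  rcases Q.eq_or_eq_conjPlace hp hv hw with rfl | rfl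
  · refine Or.inl fun u hu _ => ?_
    obtain ⟨y, rfl⟩ := Q.base_surjective hP hc u
    have hy := hu
    rw [hV] at hy
    have hy := eq_one_of_pow_eq_one he hy
    rw [localHom_mul, Q.localHom_of_split hκν hP hc, hνφ y hy,
      extendHom_of_ne φ (ne_zero_of_unit hy), localHom_of_ne _ _ (ne_zero_of_unit hu)]
    have : φ (Units.mk0 y (ne_zero_of_unit hy)) =
        χ (localIdele w (Units.mk0 (i y) (ne_zero_of_unit hu))) :=
      congrArg (fun z => χ (localIdele w z)) (Units.ext rfl)
    rw [this, ← Circle.coe_mul, ← sq, hχ, Circle.coe_one]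
  · refine Or.inr ⟨fun _ => ?_, fun h => ?_⟩
    · by_contra h
      exact hvS ((Q.mem_iff_of_isSplitChoice hS hc).2 h)
    · rw [Q.conjPlace_conjPlace] at h
      exact absurd h.symm hc

theorem forall_above_of_nonsplit {p : ℕ} (hp : p.Prime) (hv : Above v p)
    (hc : conjPlace Q.c v = v) {C : HeightOneSpectrum (𝓞 K) → Prop} (h : C v) :
    ∀ w, Above w p → C w := by
  intro w hw
  rcases Q.eq_or_eq_conjPlace hp hv hw with rfl | rfl
  · exact h
  · rwa [hc]

/-- At an odd place, two quadratic characters that are both ramified agree on units. -/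
theorem triv_zero_mul_of_odd {p : ℕ} (hp : p.Prime) (hv : Above v p) (h2 : p ≠ 2)
    {κ : Idele K →ₜ* Circle} (hχ : ∀ x, χ x ^ 2 = 1) (hκ : ∀ x, κ x ^ 2 = 1)
    {a b : v.adicCompletion K} (ha : Valued.v a = 1) (hb : Valued.v b = 1)
    (hχa : localHom χ v a ≠ 1) (hκb : localHom κ v b ≠ 1) :
    Triv Valued.v (localHom (χ * κ) v) 0 := by
  obtain ⟨T, N, hT⟩ := exists_finset_triv hχ
  obtain ⟨T', N', hT'⟩ := exists_finset_triv hκ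
  have hsχ := isSq1_localHom (v := v) hχ
  have hsκ := isSq1_localHom (v := v) hκ
  have hV := valued_two_of_odd hp hv h2
  intro u hu _
  rw [localHom_mul, eq_of_resCyclic resCyclic hsχ hsκ ((hT v).1.descend hsχ hV)
    ((hT' v).1.descend hsκ hV) ha hb hχa hκb hu, ← sq, hsκ u (ne_zero_of_unit hu)]

include Q in
-- A non-degenerate binary quadratic form over `𝔽_p` represents every element; equivalently, norms
-- from the residue field of an inert prime are surjective.
theorem exists_int_quadratic {p : ℕ} (hp : p.Prime) (h2 : p ≠ 2) (hd : ¬ (p : ℤ) ∣ Q.d) (g : ℤ) :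
    ∃ X Y : ℤ, (p : ℤ) ∣ X ^ 2 - Q.d * Y ^ 2 - g := by
  have : Fact p.Prime := ⟨hp⟩
  have hd0 : (Q.d : ZMod p) ≠ 0 := by
    rw [Ne, ZMod.natCast_eq_zero_iff]
    exact fun h => hd (by exact_mod_cast h)
  obtain ⟨a, b, hab⟩ := FiniteField.exists_root_sum_quadratic
    (f := Polynomial.X ^ 2 - Polynomial.C (g : ZMod p))
    (g := Polynomial.C (-(Q.d : ZMod p)) * Polynomial.X ^ 2)
    (Polynomial.degree_X_pow_sub_C two_pos _)
    (Polynomial.degree_C_mul_X_pow 2 (neg_ne_zero.2 hd0))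
    (by rw [ZMod.card]; exact Nat.odd_iff.1 (hp.odd_of_ne_two h2))
  obtain ⟨X, rfl⟩ := ZMod.intCast_surjective a
  obtain ⟨Y, rfl⟩ := ZMod.intCast_surjective b
  refine ⟨X, Y, ?_⟩
  rw [← ZMod.intCast_zmod_eq_zero_iff_dvd]
  push_cast
  simp only [Polynomial.eval_sub, Polynomial.eval_mul, Polynomial.eval_pow, Polynomial.eval_X,
    Polynomial.eval_C] at hab
  linear_combination hab

end Twist

end RealQuad

end QuadIdele

namespace QuadIdele

namespace RealQuad

variable {K : Type*} [Field K] [NumberField K] (Q : RealQuad K)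

/-! ### Twists at odd inert and ramified primes -/

section Twist

variable {S : Set (HeightOneSpectrum (𝓞 K))} {v : HeightOneSpectrum (𝓞 K)}
  {ϖ ζ : (v : HeightOneSpectrum (𝓞 K)) → v.adicCompletion K}
  {χ : Idele K →ₜ* Circle} (hχ : ∀ x, χ x ^ 2 = 1)

theorem exists_unit_ne_one {L : Type*} [Field L] {V : Valuation L (WithZero (Multiplicative ℤ))}
    {ψ : L →*₀ ℂ} {n : ℕ} (h : ¬ Triv V ψ n) : ∃ a, V a = 1 ∧ ψ a ≠ 1 := by
  by_contra! h'
  exact h (triv_of_le h' n)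

/-- A character of exponent `m` of the ideles arising from base change whose rational counterpart
is trivial on units of level `n` and non-trivial at the integer `a`. -/
theorem exists_baseChange_of_int {P : HeightOneSpectrum (𝓞 ℚ)} {p : ℕ} (hp : p.Prime)
    (hP : Above P p) {n m : ℕ} (hm : Even m) (hm0 : m ≠ 0) {a : ℤ} (ha : ¬ (p : ℤ) ∣ a)
    (h : ∀ t : P.adicCompletion ℚ, Valued.v t = 1 →
      ¬ Lev Valued.v n ((a : P.adicCompletion ℚ) - t ^ m)) :
    ∃ κ ∈ IdeleClassCharacter K, ∃ ν : Idele ℚ →ₜ* Circle, FromBaseChange κ ∧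
      (∀ x, κ x = ν (Q.norm x)) ∧ (∀ x, ν x ^ m = 1) ∧ Triv Valued.v (localHom ν P) n ∧
      localHom ν P (a : P.adicCompletion ℚ) ≠ 1 ∧
      ∀ v, ¬ Above v p → Triv Valued.v (localHom κ v) 0 := by
  have ha' := rat_valued_intCast_eq_one hp hP ha
  obtain ⟨φ, hφn, hφm, hφa⟩ := exists_local_character' hm0 ha' h
  obtain ⟨κ, hκ, ν, hb, hκν, hνm, hνφ, hκv⟩ := Q.exists_baseChange hP φ n hφn m hm hφm
  refine ⟨κ, hκ, ν, hb, hκν, hνm, fun u hu hl => ?_, by rwa [hνφ _ ha'], hκv⟩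
  rw [hνφ u hu, extendHom_of_ne φ (ne_zero_of_unit hu), Circle.coe_eq_one]
  exact hφn _ hu hl

theorem localHom_pow_eq_one {F : Type*} [Field F] [NumberField F] {ν : Idele F →ₜ* Circle} {m : ℕ}
    (hν : ∀ x, ν x ^ m = 1) {v : HeightOneSpectrum (𝓞 F)} {x : v.adicCompletion F} (hx : x ≠ 0) :
    localHom ν v x ^ m = 1 := by
  rw [localHom_of_ne _ _ hx, ← Circle.coe_pow, hν, Circle.coe_one]

theorem rat_localHom_eq_one {P : HeightOneSpectrum (𝓞 ℚ)} {p : ℕ} (hp : p.Prime) (hP : Above P p)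
    {ν : Idele ℚ →ₜ* Circle} {n : ℕ} (h : Triv Valued.v (localHom ν P) n) {a : ℤ}
    (ha : ¬ (p : ℤ) ∣ a) (hn : (p : ℤ) ^ n ∣ a - 1) :
    localHom ν P (a : P.adicCompletion ℚ) = 1 := by
  refine h _ (rat_valued_intCast_eq_one hp hP ha) ?_
  rw [← Int.cast_one, ← Int.cast_sub, rat_lev_iff hp hP]
  exact hn

include hχ in
-- Take `ν` with the Legendre symbol at `p`. Some integer of `K` has norm congruent to a
-- non-residue, so `ν ∘ N` is ramified at `v`; two ramified quadratic characters agree on units,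
-- hence cancel.
theorem exists_twist_of_inert_odd {p : ℕ} (hp : p.Prime) (hv : Above v p) (h2 : p ≠ 2)
    (hc : conjPlace Q.c v = v) (hd : ¬ (p : ℤ) ∣ Q.d) :
    ∃ κ, IsTwist p κ ∧ Triv Valued.v (localHom (χ * κ) v) 0 := by
  by_cases h0 : Triv Valued.v (localHom χ v) 0
  · exact ⟨1, Q.isTwist_one p, by rwa [mul_one]⟩
  obtain ⟨a, ha, hχa⟩ := exists_unit_ne_one h0
  obtain ⟨P, hP⟩ := exists_below v
  have hPp := (above_of_comap_eq (p := p) hP).1 hv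
  obtain ⟨g, hg⟩ := exists_nonresidue hp h2
  have hgp := not_dvd_of_nonresidue two_ne_zero hg
  obtain ⟨κ, hκ, ν, hb, hκν, hν2, hνt, hνg, hκv⟩ := Q.exists_baseChange_of_int hp hPp even_two
    two_ne_zero hgp (rat_not_lev_of_not_pow hp hPp hg)
  have hκ2 : ∀ x, κ x ^ 2 = 1 := fun x => by rw [hκν, hν2]
  refine ⟨κ, ⟨hκ, hb, hκ2, hκv⟩, ?_⟩
  obtain ⟨X, Y, hXY⟩ := Q.exists_int_quadratic hp h2 hd g
  set n : ℤ := X ^ 2 - Q.d * Y ^ 2 with hn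
  have hnp : ¬ (p : ℤ) ∣ n := fun h => hgp ((Int.dvd_iff_dvd_of_dvd_sub hXY).1 h)
  have hnorm : ((X : 𝓞 K) + Y * Q.sInt) * ((X : 𝓞 K) - Y * Q.sInt) = n := by
    rw [hn]
    push_cast
    linear_combination (-(Y : 𝓞 K) ^ 2) * Q.sInt_sq
  have hunit : Valued.v (emb v (((X : 𝓞 K) + Y * Q.sInt : 𝓞 K) : K)) = 1 := by
    refine valued_emb_eq_one fun h => hnp ?_
    rw [← hv.intCast_mem_iff hp, ← hnorm]
    exact Ideal.mul_mem_right _ _ h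
  refine triv_zero_mul_of_odd hp hv h2 hχ hκ2 ha hunit hχa ?_
  rw [Q.localHom_emb hκν hP hc (n := n)]
  · have hgn : Valued.v (n : P.adicCompletion ℚ) = 1 := rat_valued_intCast_eq_one hp hPp hnp
    rw [hνt.eq_of_close hgn (rat_valued_intCast_eq_one hp hPp hgp)]
    · exact hνg
    · rw [← Int.cast_sub, rat_lev_iff hp hPp, pow_one]
      exact hXY
  · have hconj : Q.conj ((X : 𝓞 K) + Y * Q.sInt) = (X : 𝓞 K) - Y * Q.sInt := by
      rw [map_add, map_mul, map_intCast, map_intCast, Q.conj_sInt, mul_neg, ← sub_eq_add_neg]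
    rw [← Q.coe_conj, ← map_mul, hconj, hnorm]
    exact map_intCast (algebraMap (𝓞 K) K) n

/-- If the rational counterpart is trivial on principal units, so is the base change. -/
theorem triv_one_of_base {κ : Idele K →ₜ* Circle} {ν : Idele ℚ →ₜ* Circle}
    (hκ : ∀ x, κ x = ν (Q.norm x)) {P : HeightOneSpectrum (𝓞 ℚ)}
    (h : v.asIdeal.comap (RingOfIntegers.mapRingHom (algebraMap ℚ K)) = P.asIdeal)
    (hc : conjPlace Q.c v = v) (hν : Triv Valued.v (localHom ν P) 1) :
    Triv Valued.v (localHom κ v) 1 := by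
  intro u hu hl
  have hw := (Q.comap_conjPlace v).trans (congrArg _ hc)
  set y : P.adicCompletion ℚ :=
    (Q.norm (localIdele v (Units.mk0 u (ne_zero_of_unit hu)))).val.2 P with hydef
  have hy : finiteCompletionHom (algebraMap ℚ K) P v h y =
      u * finiteCompletionHom (Q.c : K →+* K) v v hw u := by
    rw [hydef, Q.base_norm _ h hw, ← finComp_val, finComp_localIdele, Units.val_mk0]
  rw [Q.localHom_of_nonsplit hκ h hc hy]
  obtain ⟨e, he, hV⟩ := exists_valued_finiteCompletionHom _ _ _ h
  obtain ⟨e', he', hV'⟩ := exists_valued_finiteCompletionHom _ _ _ hw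
  have hcu : Valued.v (finiteCompletionHom (Q.c : K →+* K) v v hw u) = 1 := by
    rw [hV', hu, one_pow]
  refine hν y (eq_one_of_pow_eq_one he ?_) ?_
  · rw [← hV, hy, map_mul, hu, hcu, one_mul]
  · rw [lev_one_iff] at hl ⊢
    have h1 : Valued.v (finiteCompletionHom (algebraMap ℚ K) P v h (y - 1)) < 1 := by
      rw [map_sub, map_one, hy]
      have h2 : Valued.v (finiteCompletionHom (Q.c : K →+* K) v v hw (u - 1)) < 1 := by
        rw [hV']
        exact pow_lt_one₀ zero_le hl he'
      rw [map_sub, map_one] at h2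
      have e1 : u * finiteCompletionHom (Q.c : K →+* K) v v hw u - 1 =
        (u - 1) * finiteCompletionHom (Q.c : K →+* K) v v hw u +
          (finiteCompletionHom (Q.c : K →+* K) v v hw u - 1) := by ring
      rw [e1]
      refine Valuation.map_add_lt _ ?_ h2
      rwa [map_mul, hcu, mul_one]
    rw [hV] at h1
    by_contra hle
    exact absurd h1 (not_lt.2 (one_le_pow₀ (not_lt.1 hle)))

include Q in
/-- A base change of a character of order dividing `4`, unramified outside one place, has order
dividing `2` as soon as its square is unramified there. -/
theorem sq_eq_one_of_triv {p : ℕ} (hp : p.Prime) (hv : Above v p) (hc : conjPlace Q.c v = v)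
    {κ : Idele K →ₜ* Circle} (hκ : κ ∈ IdeleClassCharacter K) (h4 : ∀ x, κ x ^ 4 = 1)
    (hout : ∀ v, ¬ Above v p → Triv Valued.v (localHom κ v) 0)
    (h : Triv Valued.v (localHom (κ * κ) v) 0) (x : Idele K) : κ x ^ 2 = 1 := by
  have := Q.eq_one_of_unramified (χ := κ * κ) (mul_mem hκ hκ) (fun x => by
    rw [ContinuousMonoidHom.mul_apply, ← sq, ← pow_mul, h4]) fun w => by
      rw [← triv_zero_iff]
      by_cases hw : Above w p
      · exact Q.forall_above_of_nonsplit hp hv hc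
          (C := fun w => Triv Valued.v (localHom (κ * κ) w) 0) h w hw
      · intro u hu hl
        rw [localHom_mul, hout w hw u hu hl, one_mul]
  rw [sq, ← ContinuousMonoidHom.mul_apply, this]
  rfl

include hχ in
-- The residue field is prime, so units are congruent to integers `k`, of norm `k ^ 2`, and a
-- quadratic `ν` of conductor `p` would die on them. With `ν` of exponent `4`, the base change takes
-- the value `ν(k) ^ 2`: quadratic on units, and non-trivial at a non-residue `g`.
theorem exists_twist_of_ramified_odd (hv : Above v Q.d) (h2 : Q.d ≠ 2)
    (hr : RamifiedIn K Q.d) :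
    ∃ κ, IsTwist Q.d κ ∧ Triv Valued.v (localHom (χ * κ) v) 0 := by
  have hp := Q.prime_d
  by_cases h0 : Triv Valued.v (localHom χ v) 0
  · exact ⟨1, Q.isTwist_one _, by rwa [mul_one]⟩
  have hc := ((Q.ramifiedIn_iff hp hv).1 hr).1
  obtain ⟨a, ha, hχa⟩ := exists_unit_ne_one h0
  obtain ⟨P, hP⟩ := exists_below v
  have hPp := (above_of_comap_eq (p := Q.d) hP).1 hv
  obtain ⟨g, hg⟩ := exists_nonresidue hp h2
  have hgp := not_dvd_of_nonresidue two_ne_zero hg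
  have hmod : Q.d % 4 = 1 := (Q.d_cases.resolve_left h2).2
  -- As `-1 = i ^ 2` modulo `d`, the equation `g ^ 2 = k ^ 4` would give `g = k ^ 2` or `g = (i * k)
  -- ^ 2`.
  have hg4 : ∀ k : ZMod Q.d, ((g ^ 2 : ℤ) : ZMod Q.d) ≠ k ^ 4 := by
    intro k hk
    have : Fact Q.d.Prime := ⟨hp⟩
    obtain ⟨i, hi⟩ := ZMod.exists_sq_eq_neg_one_iff.2 (by omega : Q.d % 4 ≠ 3)
    push_cast at hk
    have hfac : ((g : ZMod Q.d) - k ^ 2) * ((g : ZMod Q.d) - (i * k) ^ 2) = 0 := by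
      linear_combination hk - ((g : ZMod Q.d) * k ^ 2 - k ^ 4) * hi * (-1)
    rcases mul_eq_zero.1 hfac with h | h
    · exact hg k (sub_eq_zero.1 h)
    · exact hg (i * k) (sub_eq_zero.1 h)
  have hg2p : ¬ (Q.d : ℤ) ∣ g ^ 2 := not_dvd_of_nonresidue four_ne_zero hg4
  obtain ⟨κ, hκ, ν, hb, hκν, hν4, hνt, hνg, hκv⟩ := Q.exists_baseChange_of_int hp hPp
    (by decide : Even 4) four_ne_zero hg2p (rat_not_lev_of_not_pow hp hPp hg4)
  have hκint : ∀ k : ℤ, localHom κ v (emb v (k : K)) = localHom ν P (k : P.adicCompletion ℚ) ^ 2 :=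
    fun k => by
      rw [Q.localHom_emb hκν hP hc (n := k ^ 2) (by
        rw [map_intCast]
        push_cast
        ring), Int.cast_pow, map_pow]
  have hκ1 := Q.triv_one_of_base hκν hP hc hνt
  -- `κ` has exponent `4` a priori. On units its square is `ν(k) ^ 4 = 1`, so `κ ^ 2` is unramified
  -- everywhere and therefore trivial.
  have hκ2 := Q.sq_eq_one_of_triv hp hv hc hκ (fun x => by rw [hκν, hν4]) hκv (by
    intro u hu _
    obtain ⟨b, hb⟩ := exists_integer_close hu.le
    obtain ⟨k, hk⟩ := Q.exists_int_sub_mem_of_ramified hp hv hr b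
    have hk' : Lev Valued.v 1 (u - emb v (k : K)) := by
      have h1 : Lev Valued.v 1 (emb v ((b - k : 𝓞 K) : K)) := by
        rw [lev_emb_iff, pow_one]
        exact hk
      have := hb.add h1
      rwa [show ((b - k : 𝓞 K) : K) = (b : K) - k by simp, map_sub, sub_add_sub_cancel] at this
    have hku := unit_of_close hu hk'
    have hk0 : (k : P.adicCompletion ℚ) ≠ 0 := by
      intro h
      have h' : emb v (k : K) = finiteCompletionHom (algebraMap ℚ K) P v hP k := by
        rw [map_intCast, map_intCast]
      rw [h', h, map_zero, map_zero] at hku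
      exact zero_ne_one hku
    rw [localHom_mul, hκ1.eq_of_close hu hku hk', hκint, ← pow_add, localHom_pow_eq_one hν4 hk0])
  refine ⟨κ, ⟨hκ, hb, hκ2, hκv⟩, ?_⟩
  have hgu : Valued.v (emb v (g : K)) = 1 := by
    have := valued_emb_eq_one (v := v) (a := (g : 𝓞 K)) fun h => hgp ((hv.intCast_mem_iff hp g).1 h)
    rwa [show ((g : 𝓞 K) : K) = g from map_intCast (algebraMap (𝓞 K) K) g] at this
  refine triv_zero_mul_of_odd hp hv h2 hχ hκ2 ha hgu hχa ?_
  rw [hκint, ← map_pow, ← Int.cast_pow]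
  exact hνg

end Twist

end RealQuad

end QuadIdele

namespace QuadIdele

namespace RealQuad

variable {K : Type*} [Field K] [NumberField K] (Q : RealQuad K)

/-! ### Twists at the place above a non-split `2` -/

section TwistTwo

variable {S : Set (HeightOneSpectrum (𝓞 K))} {v : HeightOneSpectrum (𝓞 K)}
  {ϖ ζ : (v : HeightOneSpectrum (𝓞 K)) → v.adicCompletion K}
  {χ : Idele K →ₜ* Circle} (hχ : ∀ x, χ x ^ 2 = 1)

include hχ in
theorem triv_descend {e : ℕ}
    (h2 : Valued.v (2 : v.adicCompletion K) = WithZero.exp (-(e : ℤ))) :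
    Triv Valued.v (localHom χ v) (2 * e + 1) := by
  obtain ⟨T, N, hT⟩ := exists_finset_triv hχ
  exact (hT v).1.descend (isSq1_localHom hχ) h2

theorem triv_mul {κ : Idele K →ₜ* Circle} {n : ℕ} (h : Triv Valued.v (localHom χ v) n)
    (h' : Triv Valued.v (localHom κ v) n) : Triv Valued.v (localHom (χ * κ) v) n :=
  fun u hu hl => by rw [localHom_mul, h u hu hl, h' u hu hl, one_mul]

theorem localHom_mul_eq_one {κ : Idele K →ₜ* Circle} (hχ : ∀ x, χ x ^ 2 = 1)
    (hκ : ∀ x, κ x ^ 2 = 1) {x : v.adicCompletion K} (hx : x ≠ 0) (h : localHom χ v x ≠ 1)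
    (h' : localHom κ v x ≠ 1) : localHom (χ * κ) v x = 1 := by
  rw [localHom_mul, (isSq1_localHom hχ).eq_neg_one hx h, (isSq1_localHom hκ).eq_neg_one hx h',
    neg_mul_neg, one_mul]

section Ramified

variable (hv : Above v 2) (hr : RamifiedIn K 2)
include hv hr

include Q in
theorem valued_two_of_ramified' :
    Valued.v (2 : v.adicCompletion K) = WithZero.exp (-((2 : ℕ) : ℤ)) :=
  Q.valued_two_of_ramified hv hr

theorem s_sq_eq_two : Q.s ^ 2 = 2 := by
  have := Q.s_sq
  rw [← Q.eq_d_of_ramifiedIn Nat.prime_two hv hr] at this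
  exact_mod_cast this

section Values

variable {κ : Idele K →ₜ* Circle} {ν : Idele ℚ →ₜ* Circle} (hκ : ∀ x, κ x = ν (Q.norm x))
  {P : HeightOneSpectrum (𝓞 ℚ)}
  (hP : v.asIdeal.comap (RingOfIntegers.mapRingHom (algebraMap ℚ K)) = P.asIdeal)
include hκ hP

theorem localHom_five : localHom κ v 5 = localHom ν P ((25 : ℤ) : P.adicCompletion ℚ) := by
  have hc := ((Q.ramifiedIn_iff Nat.prime_two hv).1 hr).1
  rw [← Q.localHom_emb hκ hP hc (a := 5) (n := 25) (by rw [map_ofNat]; norm_num), map_ofNat (emb v)]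

theorem localHom_one_add_s :
    localHom κ v (1 + emb v Q.s) = localHom ν P ((-1 : ℤ) : P.adicCompletion ℚ) := by
  have hc := ((Q.ramifiedIn_iff Nat.prime_two hv).1 hr).1
  rw [← Q.localHom_emb hκ hP hc (a := 1 + Q.s) (n := -1) (by
    rw [map_add, map_one, Q.c_s]
    push_cast
    linear_combination -Q.s_sq_eq_two hv hr), map_add (emb v), map_one (emb v)]

theorem localHom_one_add_s_cube :
    localHom κ v (1 + emb v Q.s ^ 3) = localHom ν P ((-7 : ℤ) : P.adicCompletion ℚ) := by
  have hc := ((Q.ramifiedIn_iff Nat.prime_two hv).1 hr).1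
  rw [← Q.localHom_emb hκ hP hc (a := 1 + Q.s ^ 3) (n := -7) (by
    rw [map_add, map_one, map_pow, Q.c_s]
    push_cast
    linear_combination (-(Q.s ^ 4) - 2 * Q.s ^ 2 - 4) * Q.s_sq_eq_two hv hr), map_add (emb v), map_one (emb v),
    map_pow (emb v)]

theorem localHom_three : localHom κ v 3 = localHom ν P ((9 : ℤ) : P.adicCompletion ℚ) := by
  have hc := ((Q.ramifiedIn_iff Nat.prime_two hv).1 hr).1
  rw [← Q.localHom_emb hκ hP hc (a := 3) (n := 9) (by rw [map_ofNat]; norm_num), map_ofNat (emb v)]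

end Values

include Q hχ in
-- The level can be lowered from `5` to `4` once the value at `5` is `1`. If it is not, twist by a
-- base change with `ν` of exponent `4`, trivial modulo `16` and non-trivial at `N(5) = 25`. Its
-- square is trivial at `5`, `1 + √2` and `1 + √2 ^ 3`, as the squared norms `625`, `1`, `49` are
-- `1` modulo `16`; hence the twist is quadratic.
theorem exists_twist_triv_four :
    ∃ κ, IsTwist 2 κ ∧ Triv Valued.v (localHom (χ * κ) v) 4 := by
  have hp := Nat.prime_two
  have hc := ((Q.ramifiedIn_iff hp hv).1 hr).1
  have h2 := Q.valued_two_of_ramified hv hr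
  have hs := Q.valued_s_of_ramified hp hv hr
  have hR := resTwo hv (Q.exists_int_sub_mem_of_ramified hp hv hr)
  have h5 : (5 : v.adicCompletion K) ≠ 0 := by
    have : Valued.v (5 : v.adicCompletion K) = 1 := by
      refine unit_of_lev (lev_one_iff.2 ?_)
      rw [show (5 : v.adicCompletion K) - 1 = 2 ^ 2 by norm_num, map_pow, h2]
      exact pow_lt_one₀ zero_le (by rw [← WithZero.exp_zero, WithZero.exp_lt_exp]; norm_num)
        two_ne_zero
    exact ne_zero_of_unit this
  by_cases h0 : localHom χ v 5 = 1
  · refine ⟨1, Q.isTwist_one 2, ?_⟩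
    rw [mul_one]
    exact triv_four_of_ramified hR h2 hs (triv_descend hχ (Q.valued_two_of_ramified' hv hr)) h0
  obtain ⟨P, hP⟩ := exists_below v
  have hPp := (above_of_comap_eq (p := 2) hP).1 hv
  obtain ⟨κ, hκ, ν, hb, hκν, hν4, hνt, hνg, hκv⟩ := Q.exists_baseChange_of_int hp hPp
    (by decide : Even 4) four_ne_zero (a := 25) (by norm_num) (rat_not_lev_four hPp)
  have hκ4 : ∀ x, κ x ^ 4 = 1 := fun x => by rw [hκν, hν4]
  have hsq : ∀ x, (κ * κ) x ^ 2 = 1 := fun x => by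
    rw [ContinuousMonoidHom.mul_apply, ← sq, ← pow_mul, hκ4]
  have hκ2 := Q.sq_eq_one_of_triv hp hv hc hκ hκ4 hκv (by
    refine triv_zero_of_ramified hR h2 hs (triv_four_of_ramified hR h2 hs
      (triv_descend hsq (Q.valued_two_of_ramified' hv hr)) ?_) ?_ ?_
    · rw [localHom_mul, Q.localHom_five hv hr hκν hP, ← map_mul, ← Int.cast_mul]
      exact rat_localHom_eq_one hp hPp hνt (by norm_num) (by norm_num)
    · rw [localHom_mul, Q.localHom_one_add_s hv hr hκν hP, ← map_mul, ← Int.cast_mul]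
      exact rat_localHom_eq_one hp hPp hνt (by norm_num) (by norm_num)
    · rw [localHom_mul, Q.localHom_one_add_s_cube hv hr hκν hP, ← map_mul, ← Int.cast_mul]
      exact rat_localHom_eq_one hp hPp hνt (by norm_num) (by norm_num))
  refine ⟨κ, ⟨hκ, hb, hκ2, hκv⟩, ?_⟩
  refine triv_four_of_ramified hR h2 hs (triv_descend (χ := χ * κ) (fun x => ?_)
    (Q.valued_two_of_ramified' hv hr)) ?_
  · rw [ContinuousMonoidHom.mul_apply, mul_pow, hχ, hκ2, one_mul]
  · refine localHom_mul_eq_one hχ hκ2 h5 h0 ?_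
    rwa [Q.localHom_five hv hr hκν hP]

include Q hχ in
-- Twist by the base change of a character modulo `4` that is non-trivial at `-1 = N(1 + √2)`. The
-- norms `25`, `-7`, `9` of `5`, `1 + √2 ^ 3`, `3 = 1 + √2 ^ 2` are `1` modulo `4`, so the twist has
-- level `2`, and there `1 + p` and `1 + √2` are not distinguished.
theorem exists_twist_one_add (h4 : Triv Valued.v (localHom χ v) 4)
    {p : v.adicCompletion K} (hpV : Valued.v p = WithZero.exp (-1 : ℤ)) :
    ∃ κ, IsTwist 2 κ ∧ Triv Valued.v (localHom (χ * κ) v) 4 ∧ localHom (χ * κ) v (1 + p) = 1 := by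
  have hp := Nat.prime_two
  have hc := ((Q.ramifiedIn_iff hp hv).1 hr).1
  have h2 := Q.valued_two_of_ramified hv hr
  have hs := Q.valued_s_of_ramified hp hv hr
  have hR := resTwo hv (Q.exists_int_sub_mem_of_ramified hp hv hr)
  by_cases h0 : localHom χ v (1 + p) = 1
  · refine ⟨1, Q.isTwist_one 2, ?_⟩
    rw [mul_one]
    exact ⟨h4, h0⟩
  obtain ⟨P, hP⟩ := exists_below v
  have hPp := (above_of_comap_eq (p := 2) hP).1 hv
  obtain ⟨κ, hκ, ν, hb, hκν, hν2, hνt, hνg, hκv⟩ := Q.exists_baseChange_of_int hp hPp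
    even_two two_ne_zero (a := -1) (by norm_num)
    (rat_not_lev_three hPp (n := 2) (by norm_num) (by norm_num))
  have hκ2 : ∀ x, κ x ^ 2 = 1 := fun x => by rw [hκν, hν2]
  have t4 : Triv Valued.v (localHom κ v) 4 := by
    refine triv_four_of_ramified hR h2 hs (triv_descend hκ2 (Q.valued_two_of_ramified' hv hr)) ?_
    rw [Q.localHom_five hv hr hκν hP]
    exact rat_localHom_eq_one hp hPp hνt (by norm_num) (by norm_num)
  have t3 : Triv Valued.v (localHom κ v) 3 := by
    refine Triv.step hR hs (by norm_num) t4 (w := 1 + emb v Q.s ^ 3)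
      (by rw [sub_self]; exact Lev.zero _) ?_
    rw [Q.localHom_one_add_s_cube hv hr hκν hP]
    exact rat_localHom_eq_one hp hPp hνt (by norm_num) (by norm_num)
  have t2 : Triv Valued.v (localHom κ v) 2 := by
    refine Triv.step hR hs (by norm_num) t3 (w := 3) ?_ ?_
    · rw [Q.emb_s_sq_of_ramified hv hr]
      convert Lev.zero (V := Valued.v) (2 + 1) using 1
      norm_num
    · rw [Q.localHom_three hv hr hκν hP]
      exact rat_localHom_eq_one hp hPp hνt (by norm_num) (by norm_num)
  have hp1 : Valued.v (1 + p) = 1 := valued_one_add_of_lev (n := 0) hpV.le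
  have hs1 : Valued.v (1 + emb v Q.s) = 1 := valued_one_add_of_lev (n := 0) hs.le
  have hs0 : emb v Q.s ≠ 0 := (map_ne_zero _).2 Q.s_ne_zero
  have hclose : Lev Valued.v 2 (1 + p - (1 + emb v Q.s)) := by
    have hq : Valued.v (p / emb v Q.s) = 1 := by
      rw [map_div₀, hpV, hs, div_self WithZero.exp_ne_zero]
    have hl : Lev Valued.v 1 (p / emb v Q.s - 1) := by
      refine (hR _ hq.le).resolve_left fun h => ?_
      rw [lev_one_iff, hq] at h
      exact lt_irrefl _ h
    have := hl.mul (show Lev Valued.v 1 (emb v Q.s) from hs.le)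
    rw [sub_mul, div_mul_cancel₀ _ hs0, one_mul] at this
    rwa [add_sub_add_left_eq_sub]
  refine ⟨κ, ⟨hκ, hb, hκ2, hκv⟩, triv_mul h4 t4, localHom_mul_eq_one hχ hκ2 (ne_zero_of_unit hp1)
    h0 ?_⟩
  rw [t2.eq_of_close hp1 hs1 hclose, Q.localHom_one_add_s hv hr hκν hP]
  exact hνg

include hχ in
-- After level `4` and the value at `1 + ϖ` have been arranged, only the value at `1 + ϖ ^ 3` is
-- left: if it is `1` the character is unramified, if it is `-1` it satisfies the condition.
theorem exists_twist_of_ramified_two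
    (hϖ : Valued.v (ϖ v) = WithZero.exp (-1 : ℤ)) :
    ∃ κ, IsTwist 2 κ ∧ Q.Good S ϖ ζ v (localHom (χ * κ) v) := by
  have hc := ((Q.ramifiedIn_iff Nat.prime_two hv).1 hr).1
  have h2 := Q.valued_two_of_ramified hv hr
  have hR := resTwo hv (Q.exists_int_sub_mem_of_ramified Nat.prime_two hv hr)
  obtain ⟨κ, hκ, t4⟩ := Q.exists_twist_triv_four hχ hv hr
  have hχκ : ∀ x, (χ * κ) x ^ 2 = 1 := fun x => by
    rw [ContinuousMonoidHom.mul_apply, mul_pow, hχ, hκ.sq, one_mul]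
  obtain ⟨μ, hμ, t4', h1⟩ := Q.exists_twist_one_add hχκ hv hr t4 hϖ
  have hχκμ : ∀ x, (χ * κ * μ) x ^ 2 = 1 := fun x => by
    rw [ContinuousMonoidHom.mul_apply, mul_pow, hχκ, hμ.sq, one_mul]
  refine ⟨κ * μ, hκ.mul Q hμ, ?_⟩
  rw [← mul_assoc]
  have h3 : Valued.v (1 + ϖ v ^ 3) = 1 :=
    valued_one_add_of_lev (n := 2) (by simpa using Lev.pow (show Lev Valued.v 1 (ϖ v) from hϖ.le) 3)
  rcases (isSq1_localHom hχκμ).cases (ne_zero_of_unit h3) with h | h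
  · exact Or.inl (triv_zero_of_ramified hR h2 hϖ t4' h1 h)
  · refine Or.inr ⟨fun h' => absurd hc h', fun _ => ⟨hv, fun _ => ⟨t4', h1, h⟩, fun hi => ?_⟩⟩
    exact absurd hr (Q.not_ramifiedIn_of_inertIn hv hi)

end Ramified

section Inert

variable (hv : Above v 2) (hi : InertIn K 2) {z : v.adicCompletion K} (hz : z ^ 2 + z + 1 = 0)
include hv hi hz

/-- Conjugation permutes the roots of `X ^ 2 + X + 1`. A fixed root would lie in the completion of
`ℚ` at `2` and be congruent to `1` there, which makes `3 = -(a - 1)(a + 2)` even. -/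
theorem conj_cube_root {h : v.asIdeal.comap (RingOfIntegers.mapRingHom (Q.c : K →+* K)) =
    v.asIdeal} : finiteCompletionHom (Q.c : K →+* K) v v h z = z ^ 2 := by
  obtain ⟨P, hP⟩ := exists_below v
  have hPp := (above_of_comap_eq (p := 2) hP).1 hv
  set C := finiteCompletionHom (Q.c : K →+* K) v v h
  set i := finiteCompletionHom (algebraMap ℚ K) P v hP
  have h20 : (2 : v.adicCompletion K) ≠ 0 := by
    intro h0
    have := Q.valued_two_of_inert hv hi
    rw [h0, map_zero] at this
    exact WithZero.exp_ne_zero this.symm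
  have hC : C z ^ 2 + C z + 1 = 0 := by rw [← map_pow, ← map_add, ← map_one C, ← map_add, hz, map_zero]
  have hfac : (C z - z) * (C z - z ^ 2) = 0 := by
    linear_combination hC + (z - 1 - C z) * hz
  rcases mul_eq_zero.1 hfac with h' | h'
  · exfalso
    obtain ⟨a, b, hab⟩ := Q.exists_base_add_base_mul hP z
    have hCz : C z = i a - i b * emb v Q.s := by
      rw [hab, map_add, map_mul, Q.conj_base hP hP h, Q.conj_base hP hP h, finiteCompletionHom_emb,
        show (Q.c : K →+* K) Q.s = -Q.s from Q.c_s, map_neg, mul_neg, ← sub_eq_add_neg]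
    have hza : z = i a := by
      have e := sub_eq_zero.1 h'
      rw [hCz] at e
      refine mul_left_cancel₀ h20 ?_
      linear_combination hab - e
    have ha : a ^ 2 + a + 1 = 0 := by
      apply i.injective
      rw [map_add, map_add, map_pow, ← hza, map_one, hz, map_zero]
    have hV := cube_root_unit ha (V := Valued.v)
    rcases rat_resTwo hPp a hV.le with hl | hl
    · rw [lev_one_iff, hV] at hl
      exact lt_irrefl _ hl
    · have h3 : Lev Valued.v 1 (((3 : ℤ) : P.adicCompletion ℚ)) := by
        have h2 : Valued.v (a + 2) ≤ 1 := Valuation.map_add_le _ hV.le (ofNat_le_one 2)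
        have := (hl.mul_right h2).neg
        convert this using 1
        push_cast
        linear_combination ha
      rw [rat_lev_iff Nat.prime_two hPp] at h3
      norm_num at h3
  · exact sub_eq_zero.1 h'

section Values

variable {κ : Idele K →ₜ* Circle} {ν : Idele ℚ →ₜ* Circle} (hκ : ∀ x, κ x = ν (Q.norm x))
  {P : HeightOneSpectrum (𝓞 ℚ)}
  (hP : v.asIdeal.comap (RingOfIntegers.mapRingHom (algebraMap ℚ K)) = P.asIdeal)
include hκ hP

theorem localHom_one_add_int_mul (m : ℤ) : localHom κ v (1 + m * z) =
    localHom ν P ((1 - m + m ^ 2 : ℤ) : P.adicCompletion ℚ) := by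
  have hc := ((Q.inertIn_iff Nat.prime_two hv).1 hi).1
  refine Q.localHom_of_nonsplit hκ hP hc ?_
  rw [map_intCast, map_add, map_mul, map_one, map_intCast, Q.conj_cube_root hv hi hz]
  push_cast
  linear_combination (-(m : v.adicCompletion K) - (m : v.adicCompletion K) ^ 2 * (z - 1)) * hz

end Values

include Q hχ in
-- By `triv_two_of_inert` the only obstruction is the value at `1 + 4z`, whose norm is `13`. A
-- character modulo `8` non-trivial at `13` removes it.
theorem exists_twist_triv_two :
    ∃ κ, IsTwist 2 κ ∧ Triv Valued.v (localHom (χ * κ) v) 2 := by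
  have hp := Nat.prime_two
  have hc := ((Q.inertIn_iff hp hv).1 hi).1
  have hR := resFour ((Q.inertIn_iff hp hv).1 hi).2 hz
  have h2 := Q.valued_two_of_inert hv hi
  have h2' : Valued.v (2 : v.adicCompletion K) = WithZero.exp (-((1 : ℕ) : ℤ)) := h2
  by_cases h0 : localHom χ v (1 + 4 * z) = 1
  · refine ⟨1, Q.isTwist_one 2, ?_⟩
    rw [mul_one]
    exact triv_two_of_inert h2 hz hR (isSq1_localHom hχ) (triv_descend hχ h2') h0
  obtain ⟨P, hP⟩ := exists_below v
  have hPp := (above_of_comap_eq (p := 2) hP).1 hv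
  obtain ⟨κ, hκ, ν, hb, hκν, hν2, hνt, hνg, hκv⟩ := Q.exists_baseChange_of_int hp hPp
    even_two two_ne_zero (a := 13) (by norm_num)
    (rat_not_lev_three hPp (n := 3) (by norm_num) (by norm_num))
  have hκ2 : ∀ x, κ x ^ 2 = 1 := fun x => by rw [hκν, hν2]
  refine ⟨κ, ⟨hκ, hb, hκ2, hκv⟩, ?_⟩
  have hχκ : ∀ x, (χ * κ) x ^ 2 = 1 := fun x => by
    rw [ContinuousMonoidHom.mul_apply, mul_pow, hχ, hκ2, one_mul]
  have hx : (1 + 4 * z) ≠ 0 := by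
    refine ne_zero_of_unit (V := Valued.v) (valued_one_add_of_lev (n := 1) ?_)
    have := (show Lev Valued.v 1 (2 : v.adicCompletion K) from h2.le).pow 2
    rw [show (2 : v.adicCompletion K) ^ 2 = 4 by norm_num] at this
    exact this.mul_right (cube_root_unit hz).le
  refine triv_two_of_inert h2 hz hR (isSq1_localHom hχκ) (triv_descend hχκ h2')
    (localHom_mul_eq_one hχ hκ2 hx h0 ?_)
  have := Q.localHom_one_add_int_mul hv hi hz hκν hP 4
  norm_num at this
  rw [this]
  exact_mod_cast hνg

include Q hχ in
-- `N(1 + 2z) = 3`, so a character modulo `4` non-trivial at `3` corrects the value. It preserves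
-- level `2`, because `N(1 + 4z) = 13` is `1` modulo `4`.
theorem exists_twist_one_add_two (ht : Triv Valued.v (localHom χ v) 2) :
    ∃ κ, IsTwist 2 κ ∧ Triv Valued.v (localHom (χ * κ) v) 2 ∧
      localHom (χ * κ) v (1 + z * 2) = 1 := by
  have hp := Nat.prime_two
  have hc := ((Q.inertIn_iff hp hv).1 hi).1
  have hR := resFour ((Q.inertIn_iff hp hv).1 hi).2 hz
  have h2 := Q.valued_two_of_inert hv hi
  have h2' : Valued.v (2 : v.adicCompletion K) = WithZero.exp (-((1 : ℕ) : ℤ)) := h2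
  by_cases h0 : localHom χ v (1 + z * 2) = 1
  · refine ⟨1, Q.isTwist_one 2, ?_⟩
    rw [mul_one]
    exact ⟨ht, h0⟩
  obtain ⟨P, hP⟩ := exists_below v
  have hPp := (above_of_comap_eq (p := 2) hP).1 hv
  obtain ⟨κ, hκ, ν, hb, hκν, hν2, hνt, hνg, hκv⟩ := Q.exists_baseChange_of_int hp hPp
    even_two two_ne_zero (a := 3) (by norm_num)
    (rat_not_lev_three hPp (n := 2) (by norm_num) (by norm_num))
  have hκ2 : ∀ x, κ x ^ 2 = 1 := fun x => by rw [hκν, hν2]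
  have t2 : Triv Valued.v (localHom κ v) 2 := by
    refine triv_two_of_inert h2 hz hR (isSq1_localHom hκ2) (triv_descend hκ2 h2') ?_
    have := Q.localHom_one_add_int_mul hv hi hz hκν hP 4
    rw [Int.cast_ofNat] at this
    rw [this]
    exact rat_localHom_eq_one hp hPp hνt (by norm_num) (by norm_num)
  have hx : (1 + z * 2) ≠ 0 := by
    refine ne_zero_of_unit (V := Valued.v) (valued_one_add_of_lev (n := 0) ?_)
    exact Lev.mul_left (cube_root_unit hz).le h2.le
  refine ⟨κ, ⟨hκ, hb, hκ2, hκv⟩, triv_mul ht t2, localHom_mul_eq_one hχ hκ2 hx h0 ?_⟩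
  have := Q.localHom_one_add_int_mul hv hi hz hκν hP 2
  rw [Int.cast_ofNat, mul_comm] at this
  rw [this]
  exact hνg

omit hz in
include hχ in
-- With level `2` and the value at `1 + 2ζ` arranged, the value at `-1` decides between unramified
-- and the prescribed ramified type.
theorem exists_twist_of_inert_two (hζ : IsPrimitiveRoot (ζ v) 3) :
    ∃ κ, IsTwist 2 κ ∧ Q.Good S ϖ ζ v (localHom (χ * κ) v) := by
  have hz := hζ.sq_add_self_add_one
  have hc := ((Q.inertIn_iff Nat.prime_two hv).1 hi).1
  have hR := resFour ((Q.inertIn_iff Nat.prime_two hv).1 hi).2 hz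
  have h2 := Q.valued_two_of_inert hv hi
  obtain ⟨κ, hκ, t2⟩ := Q.exists_twist_triv_two hχ hv hi hz
  have hχκ : ∀ x, (χ * κ) x ^ 2 = 1 := fun x => by
    rw [ContinuousMonoidHom.mul_apply, mul_pow, hχ, hκ.sq, one_mul]
  obtain ⟨μ, hμ, t2', h1⟩ := Q.exists_twist_one_add_two hχκ hv hi hz t2
  have hχκμ : ∀ x, (χ * κ * μ) x ^ 2 = 1 := fun x => by
    rw [ContinuousMonoidHom.mul_apply, mul_pow, hχκ, hμ.sq, one_mul]
  refine ⟨κ * μ, hκ.mul Q hμ, ?_⟩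
  rw [← mul_assoc]
  rcases (isSq1_localHom hχκμ).cases (neg_ne_zero.2 one_ne_zero) with h | h
  · exact Or.inl (triv_zero_of_inert h2 hz hR (isSq1_localHom hχκμ) t2' h h1)
  · refine Or.inr ⟨fun h' => absurd hc h', fun _ => ⟨hv, fun hr => ?_, fun _ => ⟨t2', h, h1⟩⟩⟩
    exact absurd hr (Q.not_ramifiedIn_of_inertIn hv hi)

end Inert

end TwistTwo

end RealQuad

end QuadIdele

namespace QuadIdele

namespace RealQuad

variable {K : Type*} [Field K] [NumberField K] (Q : RealQuad K)

theorem not_inertIn_d : ¬ InertIn K Q.d := by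
  rintro ⟨v, hv⟩
  have hd : (Q.d : 𝓞 K) ∈ v.asIdeal := hv ▸ Ideal.mem_span_singleton_self _
  have hs : Q.sInt ∈ v.asIdeal := v.isPrime.mem_of_pow_mem 2 (Q.sInt_sq ▸ hd)
  rw [← hv] at hs
  obtain ⟨t, ht⟩ := Ideal.mem_span_singleton.1 hs
  have hd0 : (Q.d : 𝓞 K) ≠ 0 := Nat.cast_ne_zero.2 Q.prime_d.ne_zero
  have h1 : (Q.d : 𝓞 K) * t ^ 2 = 1 := by
    apply mul_left_cancel₀ hd0
    have := Q.sInt_sq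
    rw [ht] at this
    linear_combination this
  refine Above.one_notMem v ?_
  rw [← h1]
  exact Ideal.mul_mem_right _ _ hd

/-! ### Assembling the twists over all primes -/

section GlobalTwist

variable {S : Set (HeightOneSpectrum (𝓞 K))}
  {ϖ ζ : (v : HeightOneSpectrum (𝓞 K)) → v.adicCompletion K}
  (hS : IsSplitChoice S)
  (hϖ : ∀ v, Above v 2 → RamifiedIn K 2 → Valued.v (ϖ v) = WithZero.exp (-1 : ℤ))
  (hζ : ∀ v, Above v 2 → InertIn K 2 → IsPrimitiveRoot (ζ v) 3)
  {χ : Idele K →ₜ* Circle} (hχ : ∀ x, χ x ^ 2 = 1)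
include hS hϖ hζ hχ

theorem exists_twist {p : ℕ} (hp : p.Prime) :
    ∃ κ, IsTwist p κ ∧ ∀ w, Above w p → Q.Good S ϖ ζ w (localHom (χ * κ) w) := by
  obtain ⟨v, hv⟩ := exists_above (F := K) hp
  by_cases hc : conjPlace Q.c v = v
  · have key : ∀ κ, IsTwist p κ ∧ Q.Good S ϖ ζ v (localHom (χ * κ) v) →
        ∃ κ, IsTwist p κ ∧ ∀ w, Above w p → Q.Good S ϖ ζ w (localHom (χ * κ) w) :=
      fun κ h => ⟨κ, h.1, Q.forall_above_of_nonsplit hp hv hc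
        (C := fun w => Q.Good S ϖ ζ w (localHom (χ * κ) w)) h.2⟩
    rcases Q.inertIn_or_ramifiedIn hp hv hc with hi | hr
    · by_cases h2 : p = 2
      · subst h2
        obtain ⟨κ, h⟩ := Q.exists_twist_of_inert_two (S := S) (ϖ := ϖ) hχ hv hi (hζ v hv hi)
        exact key κ h
      · by_cases hd : (p : ℤ) ∣ Q.d
        · have hpd : p = Q.d := (Nat.prime_dvd_prime_iff_eq hp Q.prime_d).1 (by exact_mod_cast hd)
          exact absurd hi (hpd ▸ Q.not_inertIn_d)
        · obtain ⟨κ, h, h'⟩ := Q.exists_twist_of_inert_odd hχ hp hv h2 hc hd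
          exact key κ ⟨h, Or.inl h'⟩
    · have hpd := Q.eq_d_of_ramifiedIn hp hv hr
      by_cases h2 : p = 2
      · subst h2
        obtain ⟨κ, h⟩ := Q.exists_twist_of_ramified_two (S := S) (ζ := ζ) hχ hv hr (hϖ v hv hr)
        exact key κ h
      · subst hpd
        obtain ⟨κ, h, h'⟩ := Q.exists_twist_of_ramified_odd hχ hv h2 hr
        exact key κ ⟨h, Or.inl h'⟩
  · by_cases hvS : v ∈ S
    · refine Q.exists_twist_of_split hχ hS hp (Q.above_conjPlace hv) ?_
        ((Q.mem_iff_of_isSplitChoice hS hc).1 hvS)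
      rw [Q.conjPlace_conjPlace]
      exact Ne.symm hc
    · exact Q.exists_twist_of_split hχ hS hp hv hc hvS

/-- A twist for one prime is unramified above the others and so does not change the character on
units there, which is all that `Good` depends on. -/
theorem exists_twist_finset (A : Finset ℕ) (hA : ∀ p ∈ A, p.Prime) :
    ∃ μ ∈ IdeleClassCharacter K, FromBaseChange μ ∧ (∀ x, μ x ^ 2 = 1) ∧
      (∀ v, (∀ p ∈ A, ¬ Above v p) → Triv Valued.v (localHom μ v) 0) ∧
      ∀ p ∈ A, ∀ v, Above v p → Q.Good S ϖ ζ v (localHom (χ * μ) v) := by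
  induction A using Finset.induction_on with
  | empty =>
    refine ⟨1, one_mem _, Q.fromBaseChange_one, fun x => one_pow 2, fun v _ u hu _ =>
      localHom_one_apply v (ne_zero_of_unit hu), by simp⟩
  | insert p A hpA ih =>
    obtain ⟨μ, hμ, hb, hμ2, hμt, hμg⟩ := ih fun q hq => hA q (Finset.mem_insert_of_mem hq)
    have hp := hA p (Finset.mem_insert_self p A)
    obtain ⟨κ, hκ, hκg⟩ := Q.exists_twist hS hϖ hζ hχ hp
    have hdisj : ∀ v : HeightOneSpectrum (𝓞 K), Above v p → ∀ q ∈ A, ¬ Above v q := fun v hv q hq hv' =>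
      hpA (by rwa [hv.unique hp (hA q (Finset.mem_insert_of_mem hq)) hv'])
    refine ⟨μ * κ, mul_mem hμ hκ.mem, Q.fromBaseChange_mul hb hκ.base, fun x => ?_,
      fun v hv => ?_, fun q hq v hv => ?_⟩
    · rw [ContinuousMonoidHom.mul_apply, mul_pow, hμ2, hκ.sq, one_mul]
    · exact triv_mul (hμt v fun q hq => hv q (Finset.mem_insert_of_mem hq))
        (hκ.triv v (hv p (Finset.mem_insert_self p A)))
    · rcases Finset.mem_insert.1 hq with rfl | hq
      · refine Good.congr Q (hϖ v) (hζ v) (fun x hx => ?_) (hκg v hv)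
        rw [localHom_mul, localHom_mul, localHom_mul, (hμt v (hdisj v hv)).apply_unit hx, one_mul]
      · refine Good.congr Q (hϖ v) (hζ v) (fun x hx => ?_) (hμg q hq v hv)
        rw [localHom_mul, localHom_mul, localHom_mul,
          (hκ.triv v fun h => hdisj v h q hq hv).apply_unit hx, mul_one]

theorem exists_global_twist : ∃ μ ∈ IdeleClassCharacter K, FromBaseChange μ ∧
    (∀ x, μ x ^ 2 = 1) ∧ ∀ v, Q.Good S ϖ ζ v (localHom (χ * μ) v) := by
  obtain ⟨T, N, hT⟩ := exists_finset_triv hχ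
  choose p hp hpv using fun v : HeightOneSpectrum (𝓞 K) => exists_prime_mem v
  obtain ⟨μ, hμ, hb, hμ2, hμt, hμg⟩ := Q.exists_twist_finset hS hϖ hζ hχ (T.image p)
    (by simp only [Finset.mem_image]; rintro _ ⟨v, -, rfl⟩; exact hp v)
  refine ⟨μ, hμ, hb, hμ2, fun v => ?_⟩
  by_cases hv : p v ∈ T.image p
  · exact hμg _ hv v (hpv v)
  · refine Or.inl (triv_mul ((hT v).2 fun h => hv (Finset.mem_image_of_mem p h)) (hμt v ?_))
    intro q hq hvq
    refine hv ?_
    obtain ⟨w, -, rfl⟩ := Finset.mem_image.1 hq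
    rwa [(hpv v).unique (hp v) (hp w) hvq]

end GlobalTwist

end RealQuad

end QuadIdele

namespace QuadIdele

/-! ### Units that are not congruent to squares -/

section NonSquares

variable {L : Type*} [Field L] {V : Valuation L (WithZero (Multiplicative ℤ))}

theorem not_lev_of_eq {n : ℕ} {x : L} (h : V x = WithZero.exp (-(n : ℤ))) {m : ℕ} (hnm : n < m) :
    ¬ Lev V m x := fun hl => by
  have : V x ≤ WithZero.exp (-(m : ℤ)) := hl
  rw [h, WithZero.exp_le_exp] at this
  omega

theorem not_lev_one_of_unit {x : L} (h : V x = 1) {m : ℕ} (hm : 0 < m) : ¬ Lev V m x :=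
  not_lev_of_eq (n := 0) (by simpa using h) hm

theorem lev_one_sub_one (hR : ResTwo V) {t : L} (ht : V t = 1) : Lev V 1 (t - 1) :=
  (hR t ht.le).resolve_left (not_lev_one_of_unit ht one_pos)

theorem exists_local_triv {n : ℕ} {a b : L} (ha : V a = 1) (hb : V b = 1)
    (h0 : ∀ t, V t = 1 → ¬ Lev V n (a - t ^ 2)) (h1 : ∀ t, V t = 1 → ¬ Lev V n (a - t ^ 2 * b)) :
    ∃ f : Lˣ →* Circle, (∀ u, f u ^ 2 = 1) ∧ Triv V (extendHom f) n ∧ extendHom f b = 1 ∧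
      extendHom f a = -1 := by
  obtain ⟨f, hf, hf2, hb, ha'⟩ := exists_local_character (n := n) two_ne_zero ha hb
    fun t ht k hk => by
      interval_cases k
      · rw [pow_zero, mul_one]
        exact h0 t ht
      · rw [pow_one]
        exact h1 t ht
  refine ⟨f, hf2, fun u hu hl => ?_, hb,
    (isSq1_extendHom f hf2).eq_neg_one (ne_zero_of_unit ha) ha'⟩
  rw [extendHom_of_ne f (ne_zero_of_unit hu), Circle.coe_eq_one]
  exact hf _ hu hl

theorem exists_local_triv' {n : ℕ} {a : L} (ha : V a = 1)
    (h : ∀ t, V t = 1 → ¬ Lev V n (a - t ^ 2)) :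
    ∃ f : Lˣ →* Circle, (∀ u, f u ^ 2 = 1) ∧ Triv V (extendHom f) n ∧ extendHom f a = -1 := by
  obtain ⟨f, h1, h2, -, h3⟩ := exists_local_triv ha (map_one V) h fun t ht => by
    rw [mul_one]
    exact h t ht
  exact ⟨f, h1, h2, h3⟩

theorem not_triv_of_neg_one {ψ : L →*₀ ℂ} {n : ℕ} {a : L} (ha : V a = 1) (hl : Lev V n (a - 1))
    (h : ψ a = -1) : ¬ Triv V ψ n := fun ht => by
  rw [ht a ha hl] at h
  norm_num at h

section Ramified

variable {p : L} (hR : ResTwo V) (h2 : V 2 = WithZero.exp (-2 : ℤ))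
  (hp : V p = WithZero.exp (-1 : ℤ))
include hR h2 hp

/-- Write `t = 1 + p * y`; the two cases are `y ≡ 0` and `y ≡ 1` in the residue field. -/
theorem lev_sq_of_ramified {t : L} (ht : V t = 1) :
    Lev V 4 (t ^ 2 - 1) ∨ Lev V 4 (t ^ 2 - (1 + p) ^ 2) := by
  have hp1 : Lev V 1 p := hp.le
  have h22 : Lev V 2 (2 : L) := h2.le
  have hp0 : p ≠ 0 := fun h => by
    rw [h, map_zero] at hp
    exact WithZero.exp_ne_zero hp.symm
  have ht1 := lev_one_sub_one hR ht
  set y := (t - 1) / p with hy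
  have hty : t = 1 + p * y := by rw [hy]; field_simp; ring
  have hy0 : Lev V 0 y := lev_div (n := 1) ht1 hp
  rcases hR y (lev_zero_iff.1 hy0) with h | h
  · have hq : Lev V 2 (p * y) := hp1.mul h
    left
    rw [show t ^ 2 - 1 = 2 * (p * y) + (p * y) * (p * y) by rw [hty]; ring]
    exact (h22.mul hq).add (hq.mul hq)
  · have hq : Lev V 2 (p * (y - 1)) := hp1.mul h
    have hu : V (1 + p) ≤ 1 := Valuation.map_add_le _ (map_one V).le
      (lev_zero_iff.1 (hp1.mono zero_le_one))
    right
    rw [show t ^ 2 - (1 + p) ^ 2 = (2 * (p * (y - 1))) * (1 + p) +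
      (p * (y - 1)) * (p * (y - 1)) by rw [hty]; ring]
    exact ((h22.mul hq).mul_right hu).add (hq.mul hq)

/-- The element `1 + p ^ 3` differs from `1` exactly at level `3`, from `(1 + p) ^ 2` at level `2`,
and from any `t ^ 2 * (1 + p)` at level `1`; so modulo level `4` it is neither a square nor a square
times `1 + p`. -/
theorem exists_local_ramified :
    ∃ f : Lˣ →* Circle, (∀ u, f u ^ 2 = 1) ∧ Triv V (extendHom f) 4 ∧
      extendHom f (1 + p) = 1 ∧ extendHom f (1 + p ^ 3) = -1 := by
  have hp1 : Lev V 1 p := hp.le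
  have h22 : Lev V 2 (2 : L) := h2.le
  have hp2 : Lev V 2 (p ^ 2) := by simpa using hp1.pow 2
  have hp3 : Lev V 3 (p ^ 3) := by simpa using hp1.pow 3
  have e2 : V (p ^ 2) = WithZero.exp (-((2 : ℕ) : ℤ)) := by
    rw [map_pow, hp, ← WithZero.exp_nsmul]
    norm_num
  have e3 : V (p ^ 3) = WithZero.exp (-((3 : ℕ) : ℤ)) := by
    rw [map_pow, hp, ← WithZero.exp_nsmul]
    norm_num
  have hu1 : V (1 + p) = 1 := by
    refine unit_of_lev ?_
    rwa [add_sub_cancel_left]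
  have hu3 : V (1 + p ^ 3) = 1 := by
    refine unit_of_lev ?_
    rw [add_sub_cancel_left]
    exact hp3.mono (by norm_num)
  refine exists_local_triv hu3 hu1 (fun t ht hl => ?_) fun t ht hl => ?_
  · rcases lev_sq_of_ramified hR h2 hp ht with h | h
    · refine not_lev_of_eq e3 (by norm_num) (m := 4) ?_
      convert hl.add h using 1
      ring
    · refine not_lev_of_eq e2 (by norm_num) (m := 3) ?_
      have h3 := (hl.add h).mono (by norm_num : 3 ≤ 4)
      have h2p : Lev V 3 (2 * p) := h22.mul hp1
      convert (hp3.sub h2p).sub h3 using 1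
      ring
  · refine not_lev_of_eq (n := 1) (by simpa using hp) (by norm_num) (m := 2) ?_
    have h : Lev V 2 (t ^ 2 - 1) := by
      rcases lev_sq_of_ramified hR h2 hp ht with h | h
      · exact h.mono (by norm_num)
      · convert ((h.mono (by norm_num : 2 ≤ 4)).add (h22.mul_right
          (lev_zero_iff.1 (hp1.mono zero_le_one)))).add hp2 using 1
        ring
    convert ((hp3.mono (by norm_num : 2 ≤ 3)).sub (hl.mono (by norm_num : 2 ≤ 4))).sub
      (h.mul_right hu1.le) using 1
    ring

end Ramified

section Inert

variable {z : L} (h2 : V 2 = WithZero.exp (-1 : ℤ)) (hz : z ^ 2 + z + 1 = 0) (hR : ResFour V z)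
include h2 hz hR

/-- Squares of units at level `2` are `1`, `z ^ 2`, `z`. The differences `-1 - t ^ 2` are then `-2`,
`z`, `z ^ 2`. The difference of `-1` and `1 + 2z` is `2 * z ^ 2`, and for the other two squares the
factor `1 + 2z` is invisible at level `1`. -/
theorem exists_local_inert :
    ∃ f : Lˣ →* Circle, (∀ u, f u ^ 2 = 1) ∧ Triv V (extendHom f) 2 ∧
      extendHom f (1 + z * 2) = 1 ∧ extendHom f (-1) = -1 := by
  have h21 : Lev V 1 (2 : L) := h2.le
  have hzV := cube_root_unit (V := V) hz
  have hz2V : V (z ^ 2) = 1 := by rw [map_pow, hzV, one_pow]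
  have hu : V (1 + z * 2) = 1 := by
    refine unit_of_lev ?_
    rw [add_sub_cancel_left]
    exact h21.mul_left hzV.le
  have e1 : V (2 : L) = WithZero.exp (-((1 : ℕ) : ℤ)) := h2
  have e1' : V (2 * z ^ 2) = WithZero.exp (-((1 : ℕ) : ℤ)) := by rw [map_mul, hz2V, mul_one, e1]
  have hsq : ∀ t w, V t = 1 → Lev V 1 (t - w) → Lev V 2 (t ^ 2 - w ^ 2) := fun t w ht h => by
    have hw := unit_of_close ht h
    rw [show t ^ 2 - w ^ 2 = (t - w) * (t - w) + 2 * (t - w) * w by ring]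
    exact (h.mul h).add ((h21.mul h).mul_right hw.le)
  have hcases : ∀ t, V t = 1 → Lev V 2 (t ^ 2 - 1) ∨ Lev V 2 (t ^ 2 - z ^ 2) ∨
      Lev V 2 (t ^ 2 - z) := fun t ht => by
    rcases hR t ht.le with h | h | h | h
    · exact absurd h (not_lev_one_of_unit ht one_pos)
    · left
      have := hsq t 1 ht h
      rwa [one_pow] at this
    · exact Or.inr (Or.inl (hsq t z ht h))
    · right; right
      have := hsq t (z ^ 2) ht h
      rwa [show (z ^ 2) ^ 2 = z by linear_combination (z ^ 2 - z) * hz] at this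
  have h12 : (1 : ℕ) ≤ 2 := by norm_num
  refine exists_local_triv (by rw [Valuation.map_neg, map_one]) hu (fun t ht hl => ?_)
    fun t ht hl => ?_
  · rcases hcases t ht with h | h | h
    · refine not_lev_of_eq e1 (by norm_num) (m := 2) ?_
      convert (hl.add h).neg using 1
      ring
    · refine not_lev_one_of_unit hzV two_pos ?_
      convert hl.add h using 1
      linear_combination hz
    · refine not_lev_one_of_unit hz2V two_pos ?_
      convert hl.add h using 1
      linear_combination hz
  · have hl1 : Lev V 1 (-1 - t ^ 2) := by
      convert (hl.mono h12).add (h21.mul_left (a := t ^ 2 * z) (by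
        rw [map_mul, map_pow, ht, hzV]; norm_num)) using 1
      ring
    rcases hcases t ht with h | h | h
    · refine not_lev_of_eq e1' (by norm_num) (m := 2) ?_
      convert hl.add (h.mul_right hu.le) using 1
      linear_combination 2 * hz
    · refine not_lev_one_of_unit hzV one_pos ?_
      convert hl1.add (h.mono h12) using 1
      linear_combination hz
    · refine not_lev_one_of_unit hz2V one_pos ?_
      convert hl1.add (h.mono h12) using 1
      linear_combination hz

end Inert

end NonSquares

namespace RealQuad

variable {K : Type*} [Field K] [NumberField K] (Q : RealQuad K)

/-! ### Local characters with prescribed conductor exponent -/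

section LocalExistence

variable {S : Set (HeightOneSpectrum (𝓞 K))} {v : HeightOneSpectrum (𝓞 K)}
  {ϖ ζ : (v : HeightOneSpectrum (𝓞 K)) → v.adicCompletion K}

theorem exists_local_split_odd {p : ℕ} (hp : p.Prime) (hv : Above v p) (h2 : p ≠ 2)
    (hc : conjPlace Q.c v ≠ v) :
    ∃ f : (v.adicCompletion K)ˣ →* Circle, (∀ u, f u ^ 2 = 1) ∧ Triv Valued.v (extendHom f) 1 ∧
      ¬ Triv Valued.v (extendHom f) 0 := by
  obtain ⟨g, hg⟩ := exists_nonresidue hp h2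
  have hgp := not_dvd_of_nonresidue two_ne_zero hg
  have hgK : ∀ n : ℤ, ((n : 𝓞 K) : K) = n := fun n => map_intCast (algebraMap (𝓞 K) K) n
  have hgu : Valued.v (emb v (g : K)) = 1 := by
    rw [← hgK]
    exact valued_emb_eq_one fun h => hgp ((hv.intCast_mem_iff hp g).1 h)
  obtain ⟨f, hf2, hft, hfg⟩ := exists_local_triv' (n := 1) hgu fun t ht hl => by
    obtain ⟨b, hb⟩ := exists_integer_close ht.le
    obtain ⟨k, hk⟩ := Q.exists_int_sub_mem_of_split hp hv hc b
    have hk' : Lev Valued.v 1 (t - emb v (k : K)) := by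
      have h1 : Lev Valued.v 1 (emb v ((b - k : 𝓞 K) : K)) := by
        rw [lev_emb_iff, pow_one]
        exact hk
      have := hb.add h1
      rwa [show ((b - k : 𝓞 K) : K) = (b : K) - k by simp, map_sub, sub_add_sub_cancel] at this
    have hku := unit_of_close ht hk'
    have := hl.add (hk'.pow_sub_pow ht.le hku.le 2)
    rw [sub_add_sub_cancel, ← map_pow, ← map_sub, ← Int.cast_pow, ← Int.cast_sub, ← hgK,
      lev_emb_iff, pow_one, hv.intCast_mem_iff hp, ← ZMod.intCast_zmod_eq_zero_iff_dvd] at this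
    push_cast at this
    exact hg k (sub_eq_zero.1 this)
  exact ⟨f, hf2, hft, not_triv_of_neg_one hgu
    (lev_zero_iff.2 (Valuation.map_sub_le _ hgu.le (map_one _).le)) hfg⟩

/-- Unit squares are `1` modulo `8`. A character modulo `4` with value `-1` at `-1` has exponent
`2`; one modulo `8` with value `-1` at `5`, which is `1` modulo `4`, has exponent `3`. -/
theorem exists_local_split_two (hv : Above v 2) (hc : conjPlace Q.c v ≠ v) {m : ℕ}
    (hm : m = 2 ∨ m = 3) :
    ∃ f : (v.adicCompletion K)ˣ →* Circle, (∀ u, f u ^ 2 = 1) ∧ Triv Valued.v (extendHom f) m ∧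
      ¬ Triv Valued.v (extendHom f) (m - 1) := by
  have hp := Nat.prime_two
  have hram : ¬ RamifiedIn K 2 := fun h => hc ((Q.ramifiedIn_iff hp hv).1 h).1
  have hV : Valued.v (2 : v.adicCompletion K) = WithZero.exp (-1 : ℤ) := by
    exact_mod_cast Q.valued_natCast_of_not_ramified hp hv hram
  have hV1 : Valued.v (2 : v.adicCompletion K) = WithZero.exp (-((1 : ℕ) : ℤ)) := hV
  have h21 : Lev Valued.v 1 (2 : v.adicCompletion K) := hV.le
  have hR := resTwo hv (Q.exists_int_sub_mem_of_split hp hv hc)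
  have e4 : (4 : v.adicCompletion K) = 2 ^ 2 := by norm_num
  have hV2 : Valued.v (4 : v.adicCompletion K) = WithZero.exp (-((2 : ℕ) : ℤ)) := by
    rw [e4, map_pow, hV, ← WithZero.exp_nsmul]
    norm_num
  rcases hm with rfl | rfl
  · have hu : Valued.v (-1 : v.adicCompletion K) = 1 := by rw [Valuation.map_neg, map_one]
    obtain ⟨f, hf2, hft, hfg⟩ := exists_local_triv' (n := 2) hu fun t ht hl => by
      refine not_lev_of_eq hV1 (by norm_num) (m := 2) ?_
      convert (hl.add ((lev_three_sq_sub_one hR hV ht).mono (by norm_num))).neg using 1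
      ring
    refine ⟨f, hf2, hft, not_triv_of_neg_one hu ?_ hfg⟩
    convert h21.neg using 1
    norm_num
  · have h42 : Lev Valued.v 2 (4 : v.adicCompletion K) := Lev.of_eq hV2
    have hu : Valued.v (5 : v.adicCompletion K) = 1 := by
      refine unit_of_lev ?_
      convert h42.mono (by norm_num : 1 ≤ 2) using 1
      norm_num
    obtain ⟨f, hf2, hft, hfg⟩ := exists_local_triv' (n := 3) hu fun t ht hl => by
      refine not_lev_of_eq hV2 (by norm_num) (m := 3) ?_
      convert hl.add (lev_three_sq_sub_one hR hV ht) using 1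
      ring
    refine ⟨f, hf2, hft, not_triv_of_neg_one hu ?_ hfg⟩
    convert h42 using 1
    norm_num

theorem exists_local_of_conductor {f : Ideal (𝓞 K)} (hA : CondA f) (hC : CondC S f)
    (hD : CondDExponent f)
    (hϖ : ∀ v, Above v 2 → RamifiedIn K 2 → Valued.v (ϖ v) = WithZero.exp (-1 : ℤ))
    (hζ : ∀ v, Above v 2 → InertIn K 2 → IsPrimitiveRoot (ζ v) 3) (hvf : v.asIdeal ∣ f) :
    ∃ φ : (v.adicCompletion K)ˣ →* Circle, (∀ u, φ u ^ 2 = 1) ∧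
      Triv Valued.v (extendHom φ) (ordAt v f) ∧ ¬ Triv Valued.v (extendHom φ) (ordAt v f - 1) ∧
      Q.Good S ϖ ζ v (extendHom φ) := by
  obtain ⟨p, hp, hv⟩ := exists_prime_mem v
  by_cases hc : conjPlace Q.c v = v
  · have hir := Q.inertIn_or_ramifiedIn hp hv hc
    have hp2 : p = 2 := by
      by_contra h2
      exact hA p hp h2 hir v hv hvf
    subst hp2
    obtain ⟨hDr, hDi⟩ := hD v hv hvf
    rcases hir with hi | hr
    · have hz := (hζ v hv hi).sq_add_self_add_one
      have h2 := Q.valued_two_of_inert hv hi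
      obtain ⟨φ, hφ2, hφt, hφz, hφ1⟩ := exists_local_inert h2 hz
        (resFour ((Q.inertIn_iff hp hv).1 hi).2 hz)
      rw [hDi hi]
      refine ⟨φ, hφ2, hφt, not_triv_of_neg_one (a := -1) (by rw [Valuation.map_neg, map_one]) ?_
        hφ1, Or.inr ⟨fun h => absurd hc h, fun _ => ⟨hv, fun hr => ?_, fun _ => ⟨hφt, hφ1, hφz⟩⟩⟩⟩
      · convert (show Lev Valued.v 1 (2 : v.adicCompletion K) from h2.le).neg using 1
        norm_num
      · exact absurd hr (Q.not_ramifiedIn_of_inertIn hv hi)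
    · have hp1 := hϖ v hv hr
      have hp3 : Lev Valued.v 3 (ϖ v ^ 3) := by
        simpa using (show Lev Valued.v 1 (ϖ v) from hp1.le).pow 3
      obtain ⟨φ, hφ2, hφt, hφ1, hφ3⟩ := exists_local_ramified
        (resTwo hv (Q.exists_int_sub_mem_of_ramified hp hv hr)) (Q.valued_two_of_ramified hv hr) hp1
      rw [hDr hr]
      refine ⟨φ, hφ2, hφt, not_triv_of_neg_one (a := 1 + ϖ v ^ 3)
        (valued_one_add_of_lev (n := 2) hp3) (by rwa [add_sub_cancel_left]) hφ3,
        Or.inr ⟨fun h => absurd hc h, fun _ => ⟨hv, fun _ => ⟨hφt, hφ1, hφ3⟩, fun hi => ?_⟩⟩⟩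
      exact absurd hr (Q.not_ramifiedIn_of_inertIn hv hi)
  · obtain ⟨hS, h1, h2⟩ := hC p hp ((Q.splitIn_iff hp hv).2 hc) v hv hvf
    have hg : ∀ ψ, Q.Good S ϖ ζ v ψ := fun ψ => Or.inr ⟨fun _ => hS, fun h => absurd h hc⟩
    by_cases hp2 : p = 2
    · subst hp2
      obtain ⟨φ, a, b, d⟩ := Q.exists_local_split_two hv hc (h2 rfl)
      exact ⟨φ, a, b, d, hg _⟩
    · obtain ⟨φ, a, b, d⟩ := Q.exists_local_split_odd hp hv hp2 hc
      rw [h1 hp2]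
      exact ⟨φ, a, b, d, hg _⟩

end LocalExistence

/-! ### Characters with prescribed ramification -/

include Q in
-- The product, over the places of `A`, of the characters ramified at one place each; agreement with
-- `φ v` can be asked only on units.
theorem exists_character_of_local {A : Finset (HeightOneSpectrum (𝓞 K))}
    (φ : ∀ v : HeightOneSpectrum (𝓞 K), (v.adicCompletion K)ˣ →* Circle) (n : HeightOneSpectrum (𝓞 K) → ℕ)
    (h2 : ∀ v u, φ v u ^ 2 = 1) (ht : ∀ v, Triv Valued.v (extendHom (φ v)) (n v)) :
    ∃ χ ∈ IdeleClassCharacter K, (∀ x, χ x ^ 2 = 1) ∧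
      (∀ v ∉ A, Triv Valued.v (localHom χ v) 0) ∧
      ∀ v ∈ A, ∀ x, Valued.v x = 1 → localHom χ v x = extendHom (φ v) x := by
  classical
  induction A using Finset.induction_on with
  | empty =>
    exact ⟨1, one_mem _, fun x => one_pow 2, fun v _ u hu _ =>
      localHom_one_apply v (ne_zero_of_unit hu), by simp⟩
  | insert v A hvA ih =>
    obtain ⟨χ, hχ, hχ2, hχt, hχA⟩ := ih
    obtain ⟨η, hη, hη2, hηv⟩ := Q.exists_quadratic_character v (φ v) (n v) (fun u hu hl => by
      have := ht v u hu hl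
      rwa [extendHom_eq_one_iff] at this) (h2 v)
    have hloc : ∀ w (u : (w.adicCompletion K)ˣ), Valued.v (u : w.adicCompletion K) = 1 →
        η (localIdele w u) = φ v (finComp v (localIdele w u)) := fun w u hu =>
      hηv _ (localIdele_mem_unitIdeles hu) fun _ => ⟨1, (one_mul 1).symm⟩
    have hηt : ∀ w, w ≠ v → Triv Valued.v (localHom η w) 0 := fun w hw => by
      rw [triv_zero_iff]
      intro u hu
      rw [hloc w u hu, finComp_localIdele_ne hw.symm, map_one]
    have hηv' : ∀ x : v.adicCompletion K, Valued.v x = 1 → localHom η v x = extendHom (φ v) x := by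
      intro x hx
      have hx0 := ne_zero_of_unit hx
      rw [localHom_of_ne _ _ hx0, extendHom_of_ne _ hx0, hloc v (Units.mk0 x hx0) hx,
        finComp_localIdele]
    refine ⟨χ * η, mul_mem hχ hη, fun x => ?_, fun w hw => ?_, fun w hw x hx => ?_⟩
    · rw [ContinuousMonoidHom.mul_apply, mul_pow, hχ2, hη2, one_mul]
    · rw [Finset.mem_insert, not_or] at hw
      exact triv_mul (hχt w hw.2) (hηt w hw.1)
    · rw [localHom_mul]
      rcases Finset.mem_insert.1 hw with rfl | hw
      · rw [(hχt w hvA).apply_unit hx, one_mul, hηv' x hx]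
      · rw [hχA w hw x hx, (hηt w fun h => hvA (h ▸ hw)).apply_unit hx, mul_one]

include Q in
theorem exists_of_conductor {S : Set (HeightOneSpectrum (𝓞 K))}
    {ϖ ζ : (v : HeightOneSpectrum (𝓞 K)) → v.adicCompletion K} {f : Ideal (𝓞 K)} (hf : f ≠ ⊥)
    (hA : CondA f) (hC : CondC S f) (hD : CondDExponent f)
    (hϖ : ∀ v, Above v 2 → RamifiedIn K 2 → Valued.v (ϖ v) = WithZero.exp (-1 : ℤ))
    (hζ : ∀ v, Above v 2 → InertIn K 2 → IsPrimitiveRoot (ζ v) 3) :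
    ∃ χ ∈ IdeleClassCharacter K, (∀ x, χ x ^ 2 = 1) ∧ finiteConductor χ = f ∧
      ∀ v, Q.Good S ϖ ζ v (localHom χ v) := by
  have hloc : ∀ v : HeightOneSpectrum (𝓞 K), ∃ φ : (v.adicCompletion K)ˣ →* Circle,
      (∀ u, φ u ^ 2 = 1) ∧ Triv Valued.v (extendHom φ) (ordAt v f) ∧ (v.asIdeal ∣ f →
        ¬ Triv Valued.v (extendHom φ) (ordAt v f - 1) ∧ Q.Good S ϖ ζ v (extendHom φ)) := by
    intro v
    by_cases hvf : v.asIdeal ∣ f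
    · obtain ⟨φ, a, b, d, e⟩ := Q.exists_local_of_conductor hA hC hD hϖ hζ hvf
      exact ⟨φ, a, b, fun _ => ⟨d, e⟩⟩
    · refine ⟨1, fun u => one_pow 2, fun u hu _ => ?_, fun h => absurd h hvf⟩
      rw [extendHom_of_ne _ (ne_zero_of_unit hu), MonoidHom.one_apply, Circle.coe_one]
  choose φ hφ2 hφt hφ using hloc
  have hfin := Ideal.finite_factors hf
  obtain ⟨χ, hχ, hχ2, hχt, hχφ⟩ := Q.exists_character_of_local (A := hfin.toFinset) φ
    (fun v => ordAt v f) hφ2 hφt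
  have hout : ∀ v : HeightOneSpectrum (𝓞 K), ¬ v.asIdeal ∣ f → Triv Valued.v (localHom χ v) 0 :=
    fun v hv => hχt v (by simpa using hv)
  have hin : ∀ v : HeightOneSpectrum (𝓞 K), v.asIdeal ∣ f →
      ∀ x, Valued.v x = 1 → localHom χ v x = extendHom (φ v) x :=
    fun v hv => hχφ v (by simpa using hv)
  refine ⟨χ, hχ, hχ2, ?_, fun v => ?_⟩
  · rw [finiteConductor, ← Ideal.finprod_heightOneSpectrum_pow_multiplicity hf]
    refine finprod_congr fun v => congrArg _ ?_
    by_cases hvf : v.asIdeal ∣ f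
    · refine le_antisymm ?_ ?_
      · rw [condExponent_le_iff hχ2]
        intro u hu hl
        rw [hin v hvf u hu]
        exact hφt v u hu hl
      -- A smaller exponent would make the character trivial at level `ordAt v f - 1`; the truncated
      -- subtraction is harmless since `ordAt v f` is then positive.
      · by_contra hlt
        have hle : condExponent χ v ≤ ordAt v f - 1 := by
          have : condExponent χ v < ordAt v f := not_le.1 hlt
          omega
        rw [condExponent_le_iff hχ2] at hle
        refine (hφ v hvf).1 fun u hu hl => ?_
        rw [← hin v hvf u hu]
        exact hle u hu hl
    · rw [(condExponent_eq_zero_iff hχ2).2 (hout v hvf)]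
      exact (multiplicity_eq_zero.2 hvf).symm
  · by_cases hvf : v.asIdeal ∣ f
    · exact Good.congr Q (hϖ v) (hζ v) (fun x hx => (hin v hvf x hx).symm) (hφ v hvf).2
    · exact Or.inl (hout v hvf)

end RealQuad

end QuadIdele

end

/-! ### The four statements assembled -/

theorem theorem4p7 {K : Type*} [Field K] [NumberField K]
    (d : ℕ) (hd : d = 2 ∨ (d.Prime ∧ d % 4 = 1))
    (s : K) (hs : s ^ 2 = (d : K)) (hK : IntermediateField.adjoin ℚ {s} = ⊤)
    (c : K ≃ₐ[ℚ] K) (hc : c ≠ 1)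
    (S : Set (HeightOneSpectrum (𝓞 K))) (hS : IsSplitChoice S)
    (ϖ ζ : (v : HeightOneSpectrum (𝓞 K)) → v.adicCompletion K)
    (hϖ : ∀ v, Above v 2 → RamifiedIn K 2 → Valued.v (ϖ v) = WithZero.exp (-1 : ℤ))
    (hζ : ∀ v, Above v 2 → InertIn K 2 → IsPrimitiveRoot (ζ v) 3) :
    -- (I)
    (∀ χ : Idele K →ₜ* Circle, IsQuadratic χ →
      ∃ μ ∈ IdeleClassCharacter K, FromBaseChange μ ∧ μ ^ 2 = 1 ∧ SatisfiesACD S ϖ ζ (χ * μ)) ∧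
    -- (II)
    (∀ χ : Idele K →ₜ* Circle, IsQuadratic χ → finiteConductor χ ≠ ⊤ → SatisfiesACD S ϖ ζ χ →
      ¬ FromBaseChange χ ∧
      ∃ δ : Idele K →ₜ* Circle, IsQuadratic δ ∧ ∀ x, χ (conjIdele c x) = χ x * δ x) ∧
    -- (III)
    (∀ χ η : Idele K →ₜ* Circle, IsQuadratic χ → IsQuadratic η → χ ≠ η →
      SatisfiesACD S ϖ ζ χ → SatisfiesACD S ϖ ζ η →
      ¬ ∃ μ ∈ IdeleClassCharacter K, FromBaseChange μ ∧ χ = η * μ) ∧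
    -- (IV)
    (∀ f : Ideal (𝓞 K), f ≠ ⊥ → f ≠ ⊤ → CondA f → CondC S f → CondDExponent f →
      ∃ χ : Idele K →ₜ* Circle, IsQuadratic χ ∧ finiteConductor χ = f ∧ SatisfiesACD S ϖ ζ χ) := by
  let Q : RealQuad K := ⟨d, hd, s, hs, hK, c, hc⟩
  have sq : ∀ {χ : Idele K →ₜ* Circle}, IsQuadratic χ → ∀ x, χ x ^ 2 = 1 := fun {χ} h x => by
    have := pow_orderOf_eq_one χ
    rw [h.2] at this
    exact DFunLike.congr_fun this x
  have quad : ∀ {χ : Idele K →ₜ* Circle}, χ ∈ IdeleClassCharacter K → (∀ x, χ x ^ 2 = 1) →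
      χ ≠ 1 → IsQuadratic χ := fun {χ} h h2 h1 =>
    ⟨h, orderOf_eq_prime (DFunLike.ext _ _ h2) h1⟩
  have good : ∀ {χ : Idele K →ₜ* Circle}, (∀ x, χ x ^ 2 = 1) →
      (SatisfiesACD S ϖ ζ χ ↔ ∀ v, Q.Good S ϖ ζ v (localHom χ v)) := Q.satisfiesACD_iff hϖ
  refine ⟨fun χ hχ => ?_, fun χ hχ hf hA => ⟨fun hb => ?_, ?_⟩, fun χ η hχ hη hne hA hA' => ?_,
    fun f hf hf' hA hC hD => ?_⟩
  · obtain ⟨μ, hμ, hb, hμ2, hg⟩ := Q.exists_global_twist hS hϖ hζ (sq hχ)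
    refine ⟨μ, hμ, hb, DFunLike.ext _ _ hμ2, (good fun x => ?_).2 hg⟩
    rw [ContinuousMonoidHom.mul_apply, mul_pow, sq hχ, hμ2, one_mul]
  -- The trivial character is good at every place, so comparing `χ` with it shows that a base change
  -- satisfying the conditions is trivial, against its order `2`.
  · have h1 : χ = 1 := Q.eq_of_good hϖ hζ hS (sq hχ) (fun x => one_pow 2) ((good (sq hχ)).1 hA)
      (fun v => Or.inl fun u hu _ => RealQuad.localHom_one_apply v (ne_zero_of_unit hu)) hb hχ.1
      (one_mul χ).symm
    have := hχ.2
    rw [h1, orderOf_one] at this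
    norm_num at this
  -- As `χ ^ 2 = 1`, the ratio `χ^c / χ` is the product `χ^c * χ`.
  · refine ⟨conjChar c χ * χ, quad (mul_mem (fun k => ?_) hχ.1) (fun x => ?_) fun h => ?_,
      fun x => ?_⟩
    · rw [conjChar_apply, conjIdele_principal, hχ.1]
    · rw [ContinuousMonoidHom.mul_apply, mul_pow, conjChar_apply, sq hχ, sq hχ, one_mul]
    · refine Q.conjChar_ne hϖ hS (sq hχ) ((good (sq hχ)).1 hA) hf (DFunLike.ext _ _ fun x => ?_)
      have hx := DFunLike.congr_fun h x
      rw [ContinuousMonoidHom.mul_apply] at hx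
      refine mul_right_cancel (b := χ x) (hx.trans ?_)
      rw [← pow_two, sq hχ]
      rfl
    · rw [ContinuousMonoidHom.mul_apply, conjChar_apply, mul_left_comm, ← pow_two, sq hχ, mul_one]
  · rintro ⟨μ, hμ, hb, h⟩
    exact hne (Q.eq_of_good hϖ hζ hS (sq hχ) (sq hη) ((good (sq hχ)).1 hA) ((good (sq hη)).1 hA')
      hb hμ h)
  · obtain ⟨χ, hχ, hχ2, hcond, hg⟩ := Q.exists_of_conductor hf hA hC hD hϖ hζ
    -- The order is exactly `2`: the trivial character has conductor `⊤`, which `f` is not.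
    refine ⟨χ, quad hχ hχ2 fun h1 => hf' ?_, hcond, (good hχ2).2 hg⟩
    have h0 : ∀ v, condExponent χ v = 0 := fun v => by
      rw [condExponent_eq_zero_iff hχ2, h1]
      exact fun u hu _ => RealQuad.localHom_one_apply v (ne_zero_of_unit hu)
    rw [← hcond, finiteConductor]
    simp only [h0, pow_zero, finprod_one]
    exact Ideal.one_eq_top
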